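/- \textbf{Setting.} On $\mathbb R^4$ with coordinates $q=(x_1,x_2,y,z)$ let $X_1=\partial_{x_1}-\frac{x_2}{2}\partial_y$, $X_2=\partial_{x_2}+\frac{x_1}{2}\partial_y+\frac{x_1^2+x_2^2}{2}\partial_z$, $X_3=\partial_y+x_1\partial_z$, $X_4=\partial_z$ be the left-invariant frame of the Engel group, let $h_i(q,\xi)=\langle\xi,X_i(q)\rangle$ for a covector $\xi$, and let $H=\frac12(-h_1^2+h_2^2)$ be the Hamiltonian of the sub-Lorentzian metric $g(X_1,X_1)=-1$, $g(X_2,X_2)=1$, $g(X_1,X_2)=0$ on $\mathrm{span}(X_1,X_2)$. A normal extremal is a solution $(q(t),\xi(t))$ of $\dot q=\partial H/\partial\xi$, $\dot\xi=-\partial H/\partial q$. We consider normal extremals with $q(0)=0$ and $H=\frac12$ (spacelike). The reflection $\varepsilon^0:(x_1,x_2,y,z,\xi_1,\xi_2,\xi_3,\xi_4)\mapsto(x_1,-x_2,-y,-z,\xi_1,-\xi_2,-\xi_3,-\xi_4)$ maps normal extremals to normal extremals and acts on the $h_i$ by $(h_1,h_2,h_3,h_4)\mapsto(h_1,-h_2,-h_3,-h_4)$,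 so one may assume $h_2>0$. The set $C=\{H=\frac12,\ h_2>0\}\subset T_0^*\mathbb R^4$ is parametrized bijectively by $\lambda=(\theta,c,\alpha)\in\mathbb R^3$ through $h_1=\sinh\theta$, $h_2=\cosh\theta$, $h_3=c$, $h_4=\alpha$. Put $E=\frac{c^2}{2}-\alpha\cosh\theta$. Then $C$ is the disjoint union of $C_1=\{\alpha<0,E>-\alpha\}$, $C_2=\{\alpha>0,E<-\alpha\}$, $C_3=\{\alpha>0,E>-\alpha\}$, $C_4=\{\alpha>0,E=-\alpha,c\ne0,\theta\ne0\}$, $C_5=\{\alpha\ne0,E=-\alpha,c=0,\theta=0\}$, $C_6=\{\alpha=0,E>0,c\ne0\}$, $C_7=\{\alpha=0,E=0,c=0\}$. Let $t_{\sup}(\lambda)\in[0,+\infty]$ be the supremum of all $T\ge0$ such that a normal extremal starting at $0$ with costate $\lambda$ exists on $[0,T]$. Jacobi functions have modulus $k$ with $k^2<1$ (possibly $k^2<0$): $\mathrm{am}$ is the inverse of $\varphi\mapsto\int_0^\varphi\frac{ds}{\sqrt{1-k^2\sin^2s}}$, $\mathrm{sn}=\sin\mathrm{am}$, $\mathrm{cn}=\cos\mathrm{am}$,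 $\mathrm{dn}=\sqrt{1-k^2\mathrm{sn}^2}$, $\mathrm{sc}=\mathrm{sn}/\mathrm{cn}$, $\mathrm{dc}=\mathrm{dn}/\mathrm{cn}$, $\mathrm E(u)=\int_0^u\mathrm{dn}^2$, $K=\int_0^{\pi/2}\frac{ds}{\sqrt{1-k^2\sin^2s}}$. On $C_1,\dots,C_4$ below, a number $\kappa>0$ and a coordinate $\varphi$ of $\lambda$ are introduced; we write $\varphi_0$ for a coordinate of the initial $\lambda$, $\psi_0=\kappa\varphi_0$, $\psi=\kappa(\varphi_0+t)$, and $S,C,D,\mathrm{SC},\mathrm{DC}$ (resp. $S_0,C_0,D_0,\mathrm{SC}_0,\mathrm{DC}_0$) for $\mathrm{sn},\mathrm{cn},\mathrm{dn},\mathrm{sc},\mathrm{dc}$ at $\psi$ (resp. $\psi_0$), and $\Delta=\mathrm E(\psi)-\mathrm E(\psi_0)$. \textbf{Theorem.} Let $\lambda\in C_i$ be the initial costate. Every normal extremal starting at $0$ with costate $\lambda$ on $[0,T]$ satisfies $T<t_{\sup}(\lambda)$, has $H=\frac12$, stays in $C_i$ with $E,\alpha$ constant, and is given by the formulas below; conversely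 the curve $q(t)$ below is the projection of such an extremal on all of $[0,t_{\sup}(\lambda))$. On $C_1,\dots,C_4$ the coordinate evolves by $\varphi(t)=\varphi_0+t$. $C_1$: $k^2=\frac{E+\alpha}{E-\alpha}\in(0,1)$, $\kappa=\sqrt{\frac{E-\alpha}2}$; each $\lambda\in C_1$ has a coordinate $\varphi$, unique in $[0,4K/\kappa)$, with $$c=\sqrt{2(E+\alpha)}\,\mathrm{sn}(\kappa\varphi),\quad \sinh\theta=-\tfrac{\sqrt{E-\alpha}\sqrt{E+\alpha}\,\mathrm{cn}(\kappa\varphi)\mathrm{dn}(\kappa\varphi)}{\alpha},\quad \cosh\theta=1-\tfrac{(E+\alpha)\mathrm{cn}^2(\kappa\varphi)}{\alpha}.$$ For every such coordinate $\varphi_0$: $t_{\sup}=+\infty$ and $$x_1=\tfrac{\sqrt2\sqrt{\alpha+E}}{\alpha}(S-S_0),\qquad x_2=-\tfrac{2\kappa}{\alpha}\Delta-t,$$ $$y=\tfrac{\sqrt{\alpha+E}}{\sqrt2\alpha^2}\Big(2\kappa\big(CD-C_0D_0+\Delta(S+S_0)\big)+\alpha(S+S_0)t\Big),$$ $$z=\tfrac{x_2^3}{6}+\tfrac1{3\alpha^3}\Big(2\kappa\big((\alpha+E)(CD(S-S_0)-2(CD-C_0D_0)S_0)-(E+3(\alpha+E)S_0^2)\Delta\big)+\alpha(\alpha-E-3(\alpha+E)S_0^2)t\Big).$$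 $C_2$: $k^2=\frac{2\alpha}{\alpha-E}\in(0,1)$, $\kappa=\sqrt{\frac{\alpha-E}2}$; each $\lambda\in C_2$ has a unique coordinate $\varphi\in(-\frac K\kappa,\frac K\kappa)$ with $$c=-\mathrm{sgn}\,\theta\,\sqrt{2(-\alpha-E)}\,\mathrm{sc}(\kappa\varphi),\quad \sinh\theta=\mathrm{sgn}\,\theta\,\tfrac{\sqrt{-\alpha-E}\sqrt{\alpha-E}\,\mathrm{dn}(\kappa\varphi)}{\alpha\,\mathrm{cn}^2(\kappa\varphi)},\quad\cosh\theta=1-\tfrac{\alpha+E}{\alpha\,\mathrm{cn}^2(\kappa\varphi)}.$$ Then $t_{\sup}=\frac{K-\psi_0}{\kappa}$ and, with $\theta$ in $\mathrm{sgn}\,\theta$ taken at the initial costate, $$x_1=-\tfrac{\sqrt2\sqrt{-\alpha-E}\,\mathrm{sgn}\,\theta}{\alpha}(\mathrm{SC}-\mathrm{SC}_0),\qquad x_2=-\tfrac{2\kappa(\Delta+D_0\mathrm{SC}_0-D\,\mathrm{SC})+Et}{\alpha},$$ $$y=-\tfrac{\sqrt{-\alpha-E}\,\mathrm{sgn}\,\theta}{\sqrt2\alpha^2}\Big(E(\mathrm{SC}_0+\mathrm{SC})t+2\kappa\big((\mathrm{SC}_0+\mathrm{SC})\Delta+(D-D_0)(1-\mathrm{SC}_0\mathrm{SC})\big)\Big),$$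 $$z=\tfrac{x_2^3}{6}+\tfrac{2\kappa(3(\alpha+E)S_0^2-EC_0^2)}{3\alpha^3C_0^2}\Delta+\tfrac{2\kappa}{3\alpha^3C^3C_0^3}\Big(C\big(\alpha(C^2D_0(1-3C_0^2)+3C_0^2D)+(C^2D_0(1-4C_0^2)+3C_0^2D)E\big)S_0$$ $$-C_0D\big(\alpha C_0^2+3\alpha S_0^2C^2+(3C^2+C_0^2(1-4C^2))E\big)S\Big)+\tfrac{(\alpha+E)(C_0^2(\alpha-4E)+3E)}{3\alpha^3C_0^2}t.$$ $C_3$: $k_2=k^2=\frac{E-\alpha}{E+\alpha}\in(-\infty,1)$, $\kappa=\sqrt{\frac{E+\alpha}2}$; each $\lambda\in C_3$ has a unique coordinate $\varphi\in(-\frac K\kappa,\frac K\kappa)$ with $$c=\mathrm{sgn}\,c\,\tfrac{2\kappa\,\mathrm{dn}(\kappa\varphi)}{\mathrm{cn}(\kappa\varphi)},\quad \sinh\theta=-\mathrm{sgn}\,c\,\tfrac{2\,\mathrm{sn}(\kappa\varphi)}{\mathrm{cn}^2(\kappa\varphi)},\quad\cosh\theta=\tfrac{1+\mathrm{sn}^2(\kappa\varphi)}{\mathrm{cn}^2(\kappa\varphi)}.$$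 Then $t_{\sup}=\frac{K-\psi_0}{\kappa}$ and, with $c$ in $\mathrm{sgn}\,c$ taken at the initial costate, $$x_1=\tfrac{2\,\mathrm{sgn}\,c\,(C_0D-CD_0)}{\kappa CC_0(1-k_2)},\qquad x_2=\tfrac{2}{\kappa(1-k_2)}\big(D\,\mathrm{SC}-D_0\mathrm{SC}_0-\Delta\big)+t,$$ $$y=\tfrac{\mathrm{sgn}\,c}{\kappa(1-k_2)}\Big(\tfrac2{\kappa(1-k_2)}\big((\mathrm{DC}+\mathrm{DC}_0)\Delta+(\mathrm{DC}_0\mathrm{DC}+k_2)(S_0-S)\big)-(\mathrm{DC}_0+\mathrm{DC})t\Big),$$ $$z=\tfrac{2\Delta(6-6k_2+C_0^2(1+7k_2))}{3\kappa^3C_0^2(k_2-1)^3}+\tfrac{2(3D_0^2+C_0^2)}{3\kappa^2C_0^2(k_2-1)^2}t+\tfrac{2}{3\kappa^3C^3C_0^3(k_2-1)^3}\Big(C^3D_0(2+C_0^2-2k_2+7C_0^2k_2)S_0$$ $$-6C_0^2CD_0(k_2-1)S+2C_0^3D(k_2-1)S-C_0C^2D(6-6k_2+C_0^2(1+7k_2))S\Big)+\tfrac{x_2^3}6.$$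 If $k^2<0$, put $\tilde k=\sqrt{\frac{-k^2}{1-k^2}}$; then $\tilde k=\sqrt{\frac{\alpha-E}{2\alpha}}\in(0,1)$, $\sqrt{1-\tilde k^2}=\sqrt{\frac{\alpha+E}{2\alpha}}$, and for all $\varphi\in\mathbb R$ $$\mathrm{sn}(\kappa\varphi,k)=\tfrac{\sqrt{1-\tilde k^2}\,\mathrm{sn}(\sqrt\alpha\varphi,\tilde k)}{\mathrm{dn}(\sqrt\alpha\varphi,\tilde k)},\quad \mathrm{cn}(\kappa\varphi,k)=\tfrac{\mathrm{cn}(\sqrt\alpha\varphi,\tilde k)}{\mathrm{dn}(\sqrt\alpha\varphi,\tilde k)},\quad\mathrm{dn}(\kappa\varphi,k)=\tfrac1{\mathrm{dn}(\sqrt\alpha\varphi,\tilde k)}.$$ $C_4$: $\kappa=\sqrt\alpha$; each $\lambda\in C_4$ has a unique coordinate $\varphi\in\mathbb R$ with $\alpha e^{2\kappa\varphi}\ne1$ and $$c=\mathrm{sgn}\,\theta\,\tfrac{4\alpha e^{\kappa\varphi}}{\alpha e^{2\kappa\varphi}-1},\quad\sinh\theta=\mathrm{sgn}\,\theta\,\tfrac{4\kappa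 e^{\kappa\varphi}(\alpha e^{2\kappa\varphi}+1)}{(\alpha e^{2\kappa\varphi}-1)^2},\quad\cosh\theta=\tfrac{\alpha e^{2\kappa\varphi}(\alpha e^{2\kappa\varphi}+6)+1}{(\alpha e^{2\kappa\varphi}-1)^2}.$$ Let $t_0=-\frac{\ln\alpha}{2\sqrt\alpha}-\varphi_0$. Then $t_0\ne0$; $t_{\sup}=+\infty$ if $t_0<0$, and $t_{\sup}=t_0$ if $t_0>0$. With $e=e^{\psi}$, $e_0=e^{\psi_0}$, $r=e^{\psi-\psi_0}$, $A=\alpha e^2-1$, $A_0=\alpha e_0^2-1$, and $\theta$ in $\mathrm{sgn}\,\theta$ taken at the initial costate, $$x_1=4\,\mathrm{sgn}\,\theta\Big(\tfrac eA-\tfrac{e_0}{A_0}\Big),\quad x_2=\tfrac4\kappa\Big(\tfrac1{A_0}-\tfrac1A\Big)+t,\quad y=-\mathrm{sgn}\,\theta\,\tfrac{2e_0(\alpha ee_0-1)(2+\kappa t+r(\kappa t-2))}{\kappa A_0A},$$ $$z=\tfrac{x_2^3}6+\tfrac43\Big(\tfrac{6e_0^2t}{A_0^2}+\tfrac{-1-9\alpha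 e_0^2(\alpha e_0^2-2)}{\alpha\kappa A_0^3}+\tfrac{12(1+\alpha e_0^2(2r-1))}{\alpha\kappa A_0A^2}-\tfrac8{\alpha\kappa A^3}-\tfrac{3(1+\alpha e_0^2(6+4r-\alpha e_0^2(4r-1)))}{\alpha\kappa A_0^2A}\Big).$$ $C_5$: $t_{\sup}=+\infty$, $\theta\equiv c\equiv0$, $x_1=0$, $x_2=t$, $y=0$, $z=t^3/6$. $C_6$: $t_{\sup}=+\infty$; writing $\theta,c$ for the initial values, the costate at time $t$ has $c(t)=c$, $\theta(t)=\theta-ct$, and $$x_1=\tfrac{\cosh(ct-\theta)-\cosh\theta}c,\quad x_2=\tfrac{\sinh(ct-\theta)+\sinh\theta}c,\quad y=\tfrac{ct-\sinh(ct)}{2c^2},\quad z=\tfrac{4\cosh(\frac{3ct}2-3\theta)\sinh^3\frac{ct}2-3\cosh\theta\,(ct-\sinh(ct))}{6c^3}.$$ $C_7$: $t_{\sup}=+\infty$, $c\equiv0$, $\theta$ is constant, and $x_1=-t\sinh\theta$, $x_2=t\cosh\theta$, $y=0$, $z=\frac{\cosh\theta\,(1+2\sinh^2\theta)}6t^3$.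 -/

import Mathlib

noncomputable section

namespace EngelSL

/-! ### Elliptic integrals and Jacobi functions of a real parameter `m = k ^ 2 < 1`

The parameter `m` is the square of the modulus, so `m < 0` is the case of an imaginary modulus. -/

/-- Incomplete elliptic integral of the first kind. -/
def ellF (m φ : ℝ) : ℝ := ∫ t in (0 : ℝ)..φ, 1 / √(1 - m * Real.sin t ^ 2)

/-- Complete elliptic integral of the first kind `K(k)`, with `m = k ^ 2`. -/
def ellK (m : ℝ) : ℝ := ellF m (Real.pi / 2)

/-- Jacobi amplitude: the inverse of `φ ↦ F(φ, k)`, which is a bijection of `ℝ` when `m < 1`. -/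
def am (m u : ℝ) : ℝ := Function.invFun (ellF m) u

def sn (m u : ℝ) : ℝ := Real.sin (am m u)

def cn (m u : ℝ) : ℝ := Real.cos (am m u)

def dn (m u : ℝ) : ℝ := √(1 - m * Real.sin (am m u) ^ 2)

def sc (m u : ℝ) : ℝ := sn m u / cn m u

def dc (m u : ℝ) : ℝ := dn m u / cn m u

/-- `E(u) = ∫₀ᵘ dn² t dt`. -/
def jacE (m u : ℝ) : ℝ := ∫ t in (0 : ℝ)..u, dn m t ^ 2

/-! ### The sub-Lorentzian Engel group and its normal extremals -/

/-- Points `q = (x₁, x₂, y, z)` of the Engel group, and covectors `ξ = (ξ₁, ξ₂, ξ₃, ξ₄)` in the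
dual coordinates. -/
abbrev R4 : Type := Fin 4 → ℝ

/-- The left-invariant frame `X₁, X₂, X₃, X₄` in the coordinates `(x₁, x₂, y, z)`; `X₁, X₂` span
the distribution, with `g(X₁, X₁) = -1`, `g(X₂, X₂) = 1`, `g(X₁, X₂) = 0`. -/
def frame (q : R4) : Fin 4 → R4 :=
  ![![1, 0, -(q 1) / 2, 0],
    ![0, 1, q 0 / 2, (q 0 ^ 2 + q 1 ^ 2) / 2],
    ![0, 0, 1, q 0],
    ![0, 0, 0, 1]]

/-- `h i q ξ = ⟨ξ, X_{i+1}(q)⟩`. -/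
def h (i : Fin 4) (q ξ : R4) : ℝ := ∑ j, ξ j * frame q i j

/-- The sub-Lorentzian Hamiltonian `H = (-h₁² + h₂²) / 2`. -/
def ham (q ξ : R4) : ℝ := (-(h 0 q ξ) ^ 2 + h 1 q ξ ^ 2) / 2

/-- `(q, ξ)` is a normal extremal on the time set `J`: there it solves the Hamiltonian system
`q̇ = ∂H/∂ξ`, `ξ̇ = -∂H/∂q` (with one-sided derivatives at end points of `J`). -/
def IsNormalExtremal (J : Set ℝ) (q ξ : ℝ → R4) : Prop :=
  ∀ t ∈ J, ∀ i,
    HasDerivWithinAt (fun s => q s i)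
      (deriv (fun p => ham (q t) (Function.update (ξ t) i p)) (ξ t i)) J t ∧
    HasDerivWithinAt (fun s => ξ s i)
      (-deriv (fun p => ham (Function.update (q t) i p) (ξ t)) (q t i)) J t

/-- The reflection `ε⁰`, in the canonical coordinates: it acts by
`(x₁, x₂, y, z) ↦ (x₁, -x₂, -y, -z)` on points and by the same formula on covectors. -/
def reflect (v : R4) : R4 := ![v 0, -v 1, -v 2, -v 3]

/-! ### The costate space -/

/-- Coordinates `λ = (θ, c, α)` on the costate space `{H = 1/2, h₂ > 0}`. -/
@[ext] structure Costate where
  θ : ℝ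
  c : ℝ
  α : ℝ

/-- `h₁ = sinh θ`, `h₂ = cosh θ`, `h₃ = c`, `h₄ = α`. -/
def Costate.hVec (l : Costate) : R4 := ![Real.sinh l.θ, Real.cosh l.θ, l.c, l.α]

/-- The energy integral `E`. -/
def Costate.E (l : Costate) : ℝ := l.c ^ 2 / 2 - l.α * Real.cosh l.θ

def C1 : Set Costate := {l | l.α < 0 ∧ l.E > -l.α}
def C2 : Set Costate := {l | l.α > 0 ∧ l.E < -l.α}
def C3 : Set Costate := {l | l.α > 0 ∧ l.E > -l.α}
def C4 : Set Costate := {l | l.α > 0 ∧ l.E = -l.α ∧ l.c ≠ 0 ∧ l.θ ≠ 0}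
def C5 : Set Costate := {l | l.α ≠ 0 ∧ l.E = -l.α ∧ l.c = 0 ∧ l.θ = 0}
def C6 : Set Costate := {l | l.α = 0 ∧ l.E > 0 ∧ l.c ≠ 0}
def C7 : Set Costate := {l | l.α = 0 ∧ l.E = 0 ∧ l.c = 0}

def pieces : Fin 7 → Set Costate := ![C1, C2, C3, C4, C5, C6, C7]

/-- The extremal `(q, ξ)` starts at the origin with costate `l`. -/
def StartsAt (l : Costate) (q ξ : ℝ → R4) : Prop :=
  q 0 = 0 ∧ ∀ i, h i (q 0) (ξ 0) = l.hVec i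

/-- The maximal time `t_sup(λ)`: the supremum of all `T ≥ 0` such that a normal extremal which
starts at the origin with costate `λ` exists on `[0, T]`. -/
def tSup (l : Costate) : EReal :=
  sSup {τ : EReal | ∃ T : ℝ, τ = (T : EReal) ∧ 0 ≤ T ∧
    ∃ q ξ : ℝ → R4, IsNormalExtremal (Set.Icc 0 T) q ξ ∧ StartsAt l q ξ}

/-- The extremal with initial costate `l ∈ S` has maximal time `τ`, its trajectory is the explicit
curve `q` on all of `[0, τ)`, its level of `H` is `1/2`, it stays in the invariant set `S` with
constant `E` and `α`, and its costate at time `t` satisfies the explicit condition `P t`. -/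
def ExtremalGivenBy (S : Set Costate) (l : Costate) (τ : EReal) (P : ℝ → Costate → Prop)
    (q : ℝ → R4) : Prop :=
  tSup l = τ ∧
  (∃ ξ : ℝ → R4, IsNormalExtremal {t : ℝ | 0 ≤ t ∧ (t : EReal) < τ} q ξ ∧ StartsAt l q ξ) ∧
  ∀ (T : ℝ) (p ξ : ℝ → R4), 0 ≤ T → IsNormalExtremal (Set.Icc 0 T) p ξ → StartsAt l p ξ →
    (T : EReal) < τ ∧
    ∀ t ∈ Set.Icc 0 T,
      p t = q t ∧ ham (p t) (ξ t) = 1 / 2 ∧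
      ∃ m ∈ S, (∀ i, h i (p t) (ξ t) = m.hVec i) ∧ m.α = l.α ∧ m.E = l.E ∧ P t m

/-! ### The piece `C₁` -/

/-- `k²` on `C₁`. -/
def m1 (l : Costate) : ℝ := (l.E + l.α) / (l.E - l.α)

def ae1 (l : Costate) : ℝ := √((l.E - l.α) / 2)

/-- `φ` is a `φ`-coordinate of `l ∈ C₁`. -/
def Chart1 (φ : ℝ) (l : Costate) : Prop :=
  l.c = √(2 * (l.E + l.α)) * sn (m1 l) (ae1 l * φ) ∧
  Real.sinh l.θ = -(√(l.E - l.α) * √(l.E + l.α) *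
    cn (m1 l) (ae1 l * φ) * dn (m1 l) (ae1 l * φ)) / l.α ∧
  Real.cosh l.θ = 1 - (l.E + l.α) * cn (m1 l) (ae1 l * φ) ^ 2 / l.α

def q1 (l : Costate) (φ₀ t : ℝ) : R4 :=
  let α := l.α
  let E := l.E
  let κ := ae1 l
  let S := sn (m1 l) (κ * (φ₀ + t))
  let S₀ := sn (m1 l) (κ * φ₀)
  let C := cn (m1 l) (κ * (φ₀ + t))
  let C₀ := cn (m1 l) (κ * φ₀)
  let D := dn (m1 l) (κ * (φ₀ + t))
  let D₀ := dn (m1 l) (κ * φ₀)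
  let ΔE := jacE (m1 l) (κ * (φ₀ + t)) - jacE (m1 l) (κ * φ₀)
  let x₁ := √2 * √(α + E) / α * (S - S₀)
  let x₂ := -(2 * κ / α) * ΔE - t
  let y := √(α + E) / (√2 * α ^ 2) *
    (2 * κ * (C * D - C₀ * D₀ + ΔE * (S + S₀)) + α * (S + S₀) * t)
  let z := x₂ ^ 3 / 6 + 1 / (3 * α ^ 3) *
    (2 * κ * ((α + E) * (C * D * (S - S₀) - 2 * (C * D - C₀ * D₀) * S₀)
        - (E + 3 * (α + E) * S₀ ^ 2) * ΔE)
      + α * (α - E - 3 * (α + E) * S₀ ^ 2) * t)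
  ![x₁, x₂, y, z]

/-! ### The piece `C₂` -/

/-- `k²` on `C₂`. -/
def m2 (l : Costate) : ℝ := 2 * l.α / (l.α - l.E)

def ae2 (l : Costate) : ℝ := √((l.α - l.E) / 2)

/-- `φ` is the `φ`-coordinate of `l ∈ C₂`. -/
def Chart2 (φ : ℝ) (l : Costate) : Prop :=
  φ ∈ Set.Ioo (-(ellK (m2 l) / ae2 l)) (ellK (m2 l) / ae2 l) ∧
  l.c = -(Real.sign l.θ * (√(2 * (-l.α - l.E)) * sn (m2 l) (ae2 l * φ) /
    cn (m2 l) (ae2 l * φ))) ∧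
  Real.sinh l.θ = Real.sign l.θ * (√(-l.α - l.E) * √(l.α - l.E) * dn (m2 l) (ae2 l * φ) /
    (l.α * cn (m2 l) (ae2 l * φ) ^ 2)) ∧
  Real.cosh l.θ = 1 - (l.α + l.E) / (l.α * cn (m2 l) (ae2 l * φ) ^ 2)

def tSup2 (l : Costate) (φ₀ : ℝ) : EReal :=
  (((ellK (m2 l) - ae2 l * φ₀) / ae2 l : ℝ) : EReal)

def q2 (l : Costate) (φ₀ t : ℝ) : R4 :=
  let α := l.α
  let E := l.E
  let κ := ae2 l
  let S := sn (m2 l) (κ * (φ₀ + t))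
  let S₀ := sn (m2 l) (κ * φ₀)
  let C := cn (m2 l) (κ * (φ₀ + t))
  let C₀ := cn (m2 l) (κ * φ₀)
  let D := dn (m2 l) (κ * (φ₀ + t))
  let D₀ := dn (m2 l) (κ * φ₀)
  let SC := sc (m2 l) (κ * (φ₀ + t))
  let SC₀ := sc (m2 l) (κ * φ₀)
  let ΔE := jacE (m2 l) (κ * (φ₀ + t)) - jacE (m2 l) (κ * φ₀)
  let x₁ := -(√2 * √(-α - E) * Real.sign l.θ / α) * (SC - SC₀)
  let x₂ := -(2 * κ * (ΔE + D₀ * SC₀ - D * SC) + E * t) / α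
  let y := -(√(-α - E) * Real.sign l.θ / (√2 * α ^ 2)) *
    (E * (SC₀ + SC) * t +
      2 * κ * ((SC₀ + SC) * ΔE + (D - D₀) * (1 - SC₀ * SC)))
  let z := x₂ ^ 3 / 6
    + 2 * κ * (3 * (α + E) * S₀ ^ 2 - E * C₀ ^ 2) / (3 * α ^ 3 * C₀ ^ 2) * ΔE
    + 2 * κ / (3 * α ^ 3 * C ^ 3 * C₀ ^ 3) *
      (C * (α * (C ^ 2 * D₀ * (1 - 3 * C₀ ^ 2) + 3 * C₀ ^ 2 * D)
          + (C ^ 2 * D₀ * (1 - 4 * C₀ ^ 2) + 3 * C₀ ^ 2 * D) * E) * S₀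
        - C₀ * D * (α * C₀ ^ 2 + 3 * α * S₀ ^ 2 * C ^ 2
          + (3 * C ^ 2 + C₀ ^ 2 * (1 - 4 * C ^ 2)) * E) * S)
    + (α + E) * (C₀ ^ 2 * (α - 4 * E) + 3 * E) / (3 * α ^ 3 * C₀ ^ 2) * t
  ![x₁, x₂, y, z]

/-! ### The piece `C₃` -/

/-- `k₂ = k²` on `C₃`; it lies in `(-∞, 1)`. -/
def m3 (l : Costate) : ℝ := (l.E - l.α) / (l.E + l.α)

def ae3 (l : Costate) : ℝ := √((l.E + l.α) / 2)

/-- `φ` is the `φ`-coordinate of `l ∈ C₃`. -/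
def Chart3 (φ : ℝ) (l : Costate) : Prop :=
  φ ∈ Set.Ioo (-(ellK (m3 l) / ae3 l)) (ellK (m3 l) / ae3 l) ∧
  l.c = Real.sign l.c * (2 * ae3 l * dn (m3 l) (ae3 l * φ) / cn (m3 l) (ae3 l * φ)) ∧
  Real.sinh l.θ = -(Real.sign l.c *
    (2 * sn (m3 l) (ae3 l * φ) / cn (m3 l) (ae3 l * φ) ^ 2)) ∧
  Real.cosh l.θ = (1 + sn (m3 l) (ae3 l * φ) ^ 2) / cn (m3 l) (ae3 l * φ) ^ 2

def tSup3 (l : Costate) (φ₀ : ℝ) : EReal :=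
  (((ellK (m3 l) - ae3 l * φ₀) / ae3 l : ℝ) : EReal)

/-- The real modulus `k̃`, used on `C₃` when `k² < 0`. -/
def kTilde (l : Costate) : ℝ := √(-m3 l / (1 - m3 l))

def q3 (l : Costate) (φ₀ t : ℝ) : R4 :=
  let k₂ := m3 l
  let κ := ae3 l
  let S := sn (m3 l) (κ * (φ₀ + t))
  let S₀ := sn (m3 l) (κ * φ₀)
  let C := cn (m3 l) (κ * (φ₀ + t))
  let C₀ := cn (m3 l) (κ * φ₀)
  let D := dn (m3 l) (κ * (φ₀ + t))
  let D₀ := dn (m3 l) (κ * φ₀)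
  let SC := sc (m3 l) (κ * (φ₀ + t))
  let SC₀ := sc (m3 l) (κ * φ₀)
  let DC := dc (m3 l) (κ * (φ₀ + t))
  let DC₀ := dc (m3 l) (κ * φ₀)
  let ΔE := jacE (m3 l) (κ * (φ₀ + t)) - jacE (m3 l) (κ * φ₀)
  let x₁ := 2 * Real.sign l.c * (C₀ * D - C * D₀) / (κ * C * C₀ * (1 - k₂))
  let x₂ := 2 / (κ * (1 - k₂)) * (D * SC - D₀ * SC₀ - ΔE) + t
  let y := Real.sign l.c / (κ * (1 - k₂)) *
    (2 / (κ * (1 - k₂)) * ((DC + DC₀) * ΔE + (DC₀ * DC + k₂) * (S₀ - S))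
      - (DC₀ + DC) * t)
  let z := 2 * ΔE * (6 - 6 * k₂ + C₀ ^ 2 * (1 + 7 * k₂)) /
      (3 * κ ^ 3 * C₀ ^ 2 * (-1 + k₂) ^ 3)
    + 2 * (3 * D₀ ^ 2 + C₀ ^ 2) / (3 * κ ^ 2 * C₀ ^ 2 * (-1 + k₂) ^ 2) * t
    + 2 / (3 * κ ^ 3 * C ^ 3 * C₀ ^ 3 * (-1 + k₂) ^ 3) *
      (C ^ 3 * D₀ * (2 + C₀ ^ 2 - 2 * k₂ + 7 * C₀ ^ 2 * k₂) * S₀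
        - 6 * C₀ ^ 2 * C * D₀ * (k₂ - 1) * S
        + 2 * C₀ ^ 3 * D * (k₂ - 1) * S
        - C₀ * C ^ 2 * D * (6 - 6 * k₂ + C₀ ^ 2 * (1 + 7 * k₂)) * S)
    + x₂ ^ 3 / 6
  ![x₁, x₂, y, z]

/-! ### The piece `C₄` -/

/-- `φ` is the `φ`-coordinate of `l ∈ C₄`. -/
def Chart4 (φ : ℝ) (l : Costate) : Prop :=
  l.α * Real.exp (2 * (√l.α * φ)) ≠ 1 ∧
  l.c = Real.sign l.θ * (4 * l.α * Real.exp (√l.α * φ) /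
    (l.α * Real.exp (2 * (√l.α * φ)) - 1)) ∧
  Real.sinh l.θ = Real.sign l.θ * (4 * √l.α * Real.exp (√l.α * φ) *
    (l.α * Real.exp (2 * (√l.α * φ)) + 1) / (l.α * Real.exp (2 * (√l.α * φ)) - 1) ^ 2) ∧
  Real.cosh l.θ = (l.α * Real.exp (2 * (√l.α * φ)) *
    (l.α * Real.exp (2 * (√l.α * φ)) + 6) + 1) / (l.α * Real.exp (2 * (√l.α * φ)) - 1) ^ 2

def t0 (l : Costate) (φ₀ : ℝ) : ℝ := -Real.log l.α / (2 * √l.α) - φ₀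

def q4 (l : Costate) (φ₀ t : ℝ) : R4 :=
  let α := l.α
  let κ := √l.α
  let e := Real.exp (κ * (φ₀ + t))
  let e₀ := Real.exp (κ * φ₀)
  let r := Real.exp (κ * (φ₀ + t) - κ * φ₀)
  let x₁ := 4 * Real.sign l.θ * (e / (-1 + α * e ^ 2) - e₀ / (-1 + α * e₀ ^ 2))
  let x₂ := 4 / κ * (1 / (-1 + α * e₀ ^ 2) - 1 / (-1 + α * e ^ 2)) + t
  let y := -(Real.sign l.θ) *
    (2 * e₀ * (-1 + α * (e * e₀)) * (2 + κ * t + r * (κ * t - 2)) /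
      (κ * (-1 + α * e₀ ^ 2) * (-1 + α * e ^ 2)))
  let z := x₂ ^ 3 / 6 + 4 / 3 *
    (6 * e₀ ^ 2 * t / (-1 + α * e₀ ^ 2) ^ 2
      + (-1 - 9 * α * e₀ ^ 2 * (-2 + α * e₀ ^ 2)) / (α * κ * (-1 + α * e₀ ^ 2) ^ 3)
      + 12 * (1 + α * e₀ ^ 2 * (-1 + 2 * r)) /
        (α * κ * (-1 + α * e₀ ^ 2) * (-1 + α * e ^ 2) ^ 2)
      - 8 / (α * κ * (-1 + α * e ^ 2) ^ 3)
      - 3 * (1 + α * e₀ ^ 2 * (6 + 4 * r - α * e₀ ^ 2 * (-1 + 4 * r))) /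
        (α * κ * (-1 + α * e₀ ^ 2) ^ 2 * (-1 + α * e ^ 2)))
  ![x₁, x₂, y, z]

/-! ### The pieces `C₅`, `C₆`, `C₇` -/

def q5 (t : ℝ) : R4 := ![0, t, 0, t ^ 3 / 6]

def q6 (l : Costate) (t : ℝ) : R4 :=
  ![(Real.cosh (l.c * t - l.θ) - Real.cosh l.θ) / l.c,
    (Real.sinh (l.c * t - l.θ) + Real.sinh l.θ) / l.c,
    (l.c * t - Real.sinh (l.c * t)) / (2 * l.c ^ 2),
    (4 * Real.cosh (3 * (l.c * t) / 2 - 3 * l.θ) * Real.sinh (l.c * t / 2) ^ 3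
      - 3 * Real.cosh l.θ * (l.c * t - Real.sinh (l.c * t))) / (6 * l.c ^ 3)]

def q7 (l : Costate) (t : ℝ) : R4 :=
  ![-Real.sinh l.θ * t, Real.cosh l.θ * t, 0,
    Real.cosh l.θ * (1 + 2 * Real.sinh l.θ ^ 2) / 6 * t ^ 3]

end EngelSL

end

open Filter Topology

namespace EngelSL

/-! A covector is best described by its frame values `h i`; `coframe` inverts this change of
variables. In these variables the Hamiltonian system is triangular. The value h₄ = α is constant,
and (h₁, h₂, h₃) = (a, b, c) satisfies a' = -bc, b' = -ac, c' = -αa, that is θ' = -c, c' = -α sinh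
θ. The point then follows by quadrature. If α ≠ 0, conservation of E gives b = (c²/2 - E)/α. Since
x₁' = -a = c'/α, integration by parts expresses x₁, y, z polynomially through a, c, t and X = x₂ = ∫
b. A single elliptic quadrature, the one for X, is left (`isExplicitSolution_trajectory`).

No equation has to be solved. On each piece an explicit candidate is differentiated, and uniqueness
for locally Lipschitz fields (`IsNormalExtremal.eqOn`) identifies every extremal with it. When the
candidate stops at a finite time, |c| tends to infinity there, whereas h₃ is continuous along an
extremal on a closed interval. Hence no extremal reaches that time
(`IsExplicitSolution.lt_of_tendsto`), and `IsExplicitSolution.extremalGivenBy` gathers all the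
conclusions.

The coordinates φ parametrize the energy levels. On `C1` the level is a closed curve run through
once by (sn, cn) over a period 4K. On `C2` and `C3` it is a pair of unbounded branches, told apart
by a sign, each described over (-K, K) with poles at the ends. On the separatrices `C4` the Jacobi
functions degenerate to rational functions of an exponential. `C5` consists of equilibria, and α = 0
leaves hyperbolic functions or constants. -/

/-! ### Frame values and Hamilton's equations -/

theorem h_zero (q ξ : R4) : h 0 q ξ = ξ 0 - q 1 / 2 * ξ 2 := by
  simp [h, frame, Fin.sum_univ_four]; ring

theorem h_one (q ξ : R4) :
    h 1 q ξ = ξ 1 + q 0 / 2 * ξ 2 + (q 0 ^ 2 + q 1 ^ 2) / 2 * ξ 3 := by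
  simp [h, frame, Fin.sum_univ_four]; ring

theorem h_two (q ξ : R4) : h 2 q ξ = ξ 2 + q 0 * ξ 3 := by
  simp [h, frame, Fin.sum_univ_four]; ring

theorem h_three (q ξ : R4) : h 3 q ξ = ξ 3 := by
  simp [h, frame, Fin.sum_univ_four]

/-- The covector at `q` on which the frame takes the values `w`. -/
noncomputable def coframe (q w : R4) : R4 :=
  ![w 0 + q 1 / 2 * (w 2 - q 0 * w 3),
    w 1 - q 0 / 2 * (w 2 - q 0 * w 3) - (q 0 ^ 2 + q 1 ^ 2) / 2 * w 3,
    w 2 - q 0 * w 3, w 3]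

theorem h_coframe (q w : R4) (i : Fin 4) : h i q (coframe q w) = w i := by
  fin_cases i <;> (simp [h_zero, h_one, h_two, h_three, coframe]; try ring)

theorem coframe_h (q ξ : R4) : coframe q (fun i => h i q ξ) = ξ := by
  ext i
  fin_cases i <;> (simp [h_zero, h_one, h_two, h_three, coframe]; try ring)

theorem deriv_half_sq_sub_sq {f g : ℝ → ℝ} {f' g' p : ℝ}
    (hf : HasDerivAt f f' p) (hg : HasDerivAt g g' p) :
    deriv (fun p => (-(f p) ^ 2 + g p ^ 2) / 2) p = -(f p * f') + g p * g' := by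
  have := (((hf.pow 2).neg.add (hg.pow 2)).div_const 2).deriv
  simp only [Pi.add_apply, Pi.neg_apply, Pi.pow_apply] at this
  refine Eq.trans ?_ (this.trans ?_)
  · rfl
  · push_cast; ring

/-- `∂H/∂ξ`, as a function of the point and of the values of the frame. -/
noncomputable def velocity (q w : R4) : R4 :=
  ![-w 0, w 1, (w 0 * q 1 + w 1 * q 0) / 2, w 1 * (q 0 ^ 2 + q 1 ^ 2) / 2]

/-- `-∂H/∂q`, as a function of the canonical coordinates. -/
noncomputable def force (q ξ : R4) : R4 :=
  ![-(h 1 q ξ * (ξ 2 / 2 + q 0 * ξ 3)), -(h 0 q ξ * ξ 2 / 2 + h 1 q ξ * q 1 * ξ 3), 0, 0]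

theorem deriv_ham_covector (q ξ : R4) (i : Fin 4) :
    deriv (fun p => ham q (Function.update ξ i p)) (ξ i) =
      velocity q (fun j => h j q ξ) i := by
  have hid := hasDerivAt_id (ξ i)
  -- On a coordinate line `h 0` and `h 1` become functions `f`, `g` of one variable, and the partial
  -- derivative of H follows from theirs. The four cases only supply these restrictions.
  have key : ∀ {f g : ℝ → ℝ} {f' g' : ℝ}, HasDerivAt f f' (ξ i) → HasDerivAt g g' (ξ i) →
      (∀ p, h 0 q (Function.update ξ i p) = f p) → (∀ p, h 1 q (Function.update ξ i p) = g p) →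
      deriv (fun p => ham q (Function.update ξ i p)) (ξ i) =
        -(h 0 q ξ * f') + h 1 q ξ * g' := by
    intro f g f' g' hf hg h0 h1
    have e0 := h0 (ξ i)
    have e1 := h1 (ξ i)
    rw [Function.update_eq_self] at e0 e1
    simp only [ham, h0, h1]
    rw [deriv_half_sq_sub_sq hf hg, ← e0, ← e1]
  fin_cases i
  · refine (key (hid.sub_const (q 1 / 2 * ξ 2))
      (hasDerivAt_const _ (ξ 1 + q 0 / 2 * ξ 2 + (q 0 ^ 2 + q 1 ^ 2) / 2 * ξ 3)) ?_ ?_).trans ?_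
    · intro p; simp [h_zero]
    · intro p; simp [h_one]
    · simp [velocity]
  · refine (key (hasDerivAt_const _ (ξ 0 - q 1 / 2 * ξ 2))
      ((hid.add_const (q 0 / 2 * ξ 2)).add_const ((q 0 ^ 2 + q 1 ^ 2) / 2 * ξ 3)) ?_ ?_).trans ?_
    · intro p; simp [h_zero]
    · intro p; simp [h_one]
    · simp [velocity]
  · refine (key ((hid.const_mul (q 1 / 2)).const_sub (ξ 0))
      (((hid.const_mul (q 0 / 2)).const_add (ξ 1)).add_const
        ((q 0 ^ 2 + q 1 ^ 2) / 2 * ξ 3)) ?_ ?_).trans ?_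
    · intro p; simp [h_zero]
    · intro p; simp [h_one]
    · simp [velocity]; ring
  · refine (key (hasDerivAt_const _ (ξ 0 - q 1 / 2 * ξ 2))
      ((hid.const_mul ((q 0 ^ 2 + q 1 ^ 2) / 2)).const_add (ξ 1 + q 0 / 2 * ξ 2)) ?_ ?_).trans ?_
    · intro p; simp [h_zero]
    · intro p; simp [h_one]
    · simp [velocity]; ring

theorem neg_deriv_ham_point (q ξ : R4) (i : Fin 4) :
    -deriv (fun p => ham (Function.update q i p) ξ) (q i) = force q ξ i := by
  have hid := hasDerivAt_id (q i)
  have key : ∀ {f g : ℝ → ℝ} {f' g' : ℝ}, HasDerivAt f f' (q i) → HasDerivAt g g' (q i) →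
      (∀ p, h 0 (Function.update q i p) ξ = f p) → (∀ p, h 1 (Function.update q i p) ξ = g p) →
      -deriv (fun p => ham (Function.update q i p) ξ) (q i) =
        h 0 q ξ * f' - h 1 q ξ * g' := by
    intro f g f' g' hf hg h0 h1
    have e0 := h0 (q i)
    have e1 := h1 (q i)
    rw [Function.update_eq_self] at e0 e1
    simp only [ham, h0, h1]
    rw [deriv_half_sq_sub_sq hf hg, ← e0, ← e1]
    ring
  fin_cases i
  · refine (key (hasDerivAt_const _ (ξ 0 - q 1 / 2 * ξ 2))
      ((((hid.div_const 2).mul_const (ξ 2)).const_add (ξ 1)).add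
        ((((hid.pow 2).add_const (q 1 ^ 2)).div_const 2).mul_const (ξ 3))) ?_ ?_).trans ?_
    · intro p; simp [h_zero]
    · intro p; simp [h_one]
    · simp only [force, id]; simp; ring_nf; simp
  · refine (key (((hid.div_const 2).mul_const (ξ 2)).const_sub (ξ 0))
      ((((((hid.pow 2).const_add (q 0 ^ 2)).div_const 2).mul_const (ξ 3))).const_add
        (ξ 1 + q 0 / 2 * ξ 2)) ?_ ?_).trans ?_
    · intro p; simp [h_zero]
    · intro p; simp [h_one]
    · simp [force]; ring
  · refine (key (hasDerivAt_const _ (ξ 0 - q 1 / 2 * ξ 2))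
      (hasDerivAt_const _ (ξ 1 + q 0 / 2 * ξ 2 + (q 0 ^ 2 + q 1 ^ 2) / 2 * ξ 3)) ?_ ?_).trans ?_
    · intro p; simp [h_zero]
    · intro p; simp [h_one]
    · simp [force]
  · refine (key (hasDerivAt_const _ (ξ 0 - q 1 / 2 * ξ 2))
      (hasDerivAt_const _ (ξ 1 + q 0 / 2 * ξ 2 + (q 0 ^ 2 + q 1 ^ 2) / 2 * ξ 3)) ?_ ?_).trans ?_
    · intro p; simp [h_zero]
    · intro p; simp [h_one]
    · simp [force]

/-- Partial derivatives are traded for one autonomous equation on R⁴ × R⁴ with polynomial right-hand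
side, the form in which ODE uniqueness applies. -/
theorem isNormalExtremal_iff {J : Set ℝ} {q ξ : ℝ → R4} :
    IsNormalExtremal J q ξ ↔ ∀ t ∈ J,
      HasDerivWithinAt q (velocity (q t) (fun j => h j (q t) (ξ t))) J t ∧
      HasDerivWithinAt ξ (force (q t) (ξ t)) J t := by
  simp only [IsNormalExtremal, deriv_ham_covector, neg_deriv_ham_point, hasDerivWithinAt_pi,
    forall_and]

theorem IsNormalExtremal.mono {J J' : Set ℝ} {q ξ : ℝ → R4} (hJ : J' ⊆ J)
    (hq : IsNormalExtremal J q ξ) : IsNormalExtremal J' q ξ :=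
  fun t ht i => ⟨(hq t (hJ ht) i).1.mono hJ, (hq t (hJ ht) i).2.mono hJ⟩

/-! ### Uniqueness of extremals -/

/-- Solutions on `[0, T]` of a locally Lipschitz autonomous system are unique. -/
theorem eqOn_Icc_of_hasDerivWithinAt {V : Type*} [NormedAddCommGroup V] [NormedSpace ℝ V]
    {F : V → V} (hF : LocallyLipschitz F) {f g : ℝ → V} {T : ℝ}
    (hf : ∀ t ∈ Set.Icc 0 T, HasDerivWithinAt f (F (f t)) (Set.Icc 0 T) t)
    (hg : ∀ t ∈ Set.Icc 0 T, HasDerivWithinAt g (F (g t)) (Set.Icc 0 T) t)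
    (h0 : f 0 = g 0) : Set.EqOn f g (Set.Icc 0 T) := by
  have cf : ContinuousOn f (Set.Icc 0 T) := fun t ht => (hf t ht).continuousWithinAt
  have cg : ContinuousOn g (Set.Icc 0 T) := fun t ht => (hg t ht).continuousWithinAt
  -- Both curves stay in this compact union, on which local Lipschitz continuity becomes a uniform
  -- Lipschitz bound.
  have hK : IsCompact (f '' Set.Icc 0 T ∪ g '' Set.Icc 0 T) :=
    (isCompact_Icc.image_of_continuousOn cf).union (isCompact_Icc.image_of_continuousOn cg)
  obtain ⟨K, hK⟩ :=
    (LocallyLipschitz.locallyLipschitzOn hF (s := _)).exists_lipschitzOnWith_of_compact hK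
  have right : ∀ {φ : ℝ → V}, (∀ t ∈ Set.Icc 0 T,
      HasDerivWithinAt φ (F (φ t)) (Set.Icc 0 T) t) →
      ∀ t ∈ Set.Ico 0 T, HasDerivWithinAt φ (F (φ t)) (Set.Ici t) t := fun hφ t ht =>
    (hφ t (Set.Ico_subset_Icc_self ht)).mono_of_mem_nhdsWithin
      (mem_of_superset (Icc_mem_nhdsGE ht.2) (Set.Icc_subset_Icc_left ht.1))
  exact ODE_solution_unique_of_mem_Icc_right (v := fun _ => F) (fun _ _ => hK)
    cf (right hf) (fun t ht => Or.inl ⟨t, Set.Ico_subset_Icc_self ht, rfl⟩)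
    cg (right hg) (fun t ht => Or.inr ⟨t, Set.Ico_subset_Icc_self ht, rfl⟩) h0

theorem locallyLipschitz_hamiltonian :
    LocallyLipschitz (fun v : R4 × R4 => (velocity v.1 (fun j => h j v.1 v.2), force v.1 v.2)) := by
  refine ContDiff.locallyLipschitz (𝕂 := ℝ) ?_
  refine ContDiff.prodMk ?_ ?_ <;> rw [contDiff_pi] <;> intro i <;> fin_cases i <;>
    simp [velocity, force, h_zero, h_one] <;> fun_prop

theorem IsNormalExtremal.eqOn {q ξ q' ξ' : ℝ → R4} {T : ℝ}
    (hq : IsNormalExtremal (Set.Icc 0 T) q ξ) (hq' : IsNormalExtremal (Set.Icc 0 T) q' ξ')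
    (h0 : q 0 = q' 0) (h1 : ξ 0 = ξ' 0) :
    ∀ t ∈ Set.Icc 0 T, q t = q' t ∧ ξ t = ξ' t := by
  rw [isNormalExtremal_iff] at hq hq'
  intro t ht
  have := eqOn_Icc_of_hasDerivWithinAt locallyLipschitz_hamiltonian
    (f := fun t => (q t, ξ t)) (g := fun t => (q' t, ξ' t))
    (fun t ht => (hq t ht).1.prodMk (hq t ht).2) (fun t ht => (hq' t ht).1.prodMk (hq' t ht).2)
    (by simp [h0, h1]) ht
  simpa using this

theorem hasDerivAt_of_eq {f g : ℝ → ℝ} {f' g' t : ℝ} (hf : HasDerivAt f f' t)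
    (hg : ∀ s, g s = f s) (hg' : g' = f') : HasDerivAt g g' t := by
  rw [funext hg, hg']
  exact hf

/-! ### The costate space and its decomposition -/

theorem hVec_eq_of_h {l : Costate} {ξ : R4} {q : R4} (hl : ∀ i, h i q ξ = l.hVec i) :
    ham q ξ = 1 / 2 ∧ 0 < h 1 q ξ := by
  have h0 : h 0 q ξ = Real.sinh l.θ := hl 0
  have h1 : h 1 q ξ = Real.cosh l.θ := hl 1
  refine ⟨?_, h1 ▸ Real.cosh_pos _⟩
  rw [ham, h0, h1]
  linarith [Real.cosh_sq l.θ]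

/-- The branch w₁ > 0 of the hyperbola w₁² - w₀² = 1 is the graph w₁ = √(1 + w₀²), so arsinh w₀
serves as θ. -/
theorem exists_costate {w : R4} (hw : -(w 0) ^ 2 + w 1 ^ 2 = 1) (hpos : 0 < w 1) :
    ∃ l : Costate, ∀ i, w i = l.hVec i := by
  refine ⟨⟨Real.arsinh (w 0), w 2, w 3⟩, fun i => ?_⟩
  fin_cases i
  · simp [Costate.hVec]
  · simp only [Costate.hVec, Real.cosh_arsinh]
    simpa [show 1 + w 0 ^ 2 = w 1 ^ 2 by linarith] using (Real.sqrt_sq hpos.le).symm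
  · simp [Costate.hVec]
  · simp [Costate.hVec]

theorem Costate.hVec_injective : Function.Injective Costate.hVec := by
  intro l m hlm
  have h0 : Real.sinh l.θ = Real.sinh m.θ := congrFun hlm 0
  have h2 : l.c = m.c := congrFun hlm 2
  have h3 : l.α = m.α := congrFun hlm 3
  exact Costate.ext (Real.sinh_injective h0) h2 h3

theorem spacelike_iff_existsUnique_costate (ξ : R4) :
    (ham 0 ξ = 1 / 2 ∧ 0 < h 1 0 ξ) ↔ ∃! l : Costate, ∀ i, h i 0 ξ = l.hVec i := by
  constructor
  · rintro ⟨hH, hpos⟩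
    obtain ⟨l, hl⟩ := exists_costate (w := fun i => h i 0 ξ) (by rw [ham] at hH; linarith) hpos
    exact ⟨l, hl, fun m hm => Costate.hVec_injective (funext fun i => (hm i).symm.trans (hl i))⟩
  · rintro ⟨l, hl, -⟩
    exact hVec_eq_of_h hl

/-- Both terms of E are nonnegative when α < 0, and cosh θ ≥ 1. So for α < 0 only `C1` and the
equality case `C5` can occur. -/
theorem neg_α_le_E {l : Costate} (hα : l.α < 0) : -l.α ≤ l.E := by
  have := Real.one_le_cosh l.θ
  unfold Costate.E
  nlinarith [sq_nonneg l.c]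

/-- The level E = -α reads c²/2 = α (cosh θ - 1). For α < 0 the two sides have opposite signs; in
the other cases the vanishing of one side forces that of the other. This separates the equilibria
`C5` from the separatrices `C4`. -/
theorem eq_zero_of_E_eq_neg_α {l : Costate} (hα : l.α ≠ 0) (hE : l.E = -l.α)
    (h0 : l.α < 0 ∨ l.c = 0 ∨ l.θ = 0) : l.c = 0 ∧ l.θ = 0 := by
  have h1 := Real.one_le_cosh l.θ
  unfold Costate.E at hE
  have h2 : l.c ^ 2 / 2 = l.α * (Real.cosh l.θ - 1) := by linarith
  have key : l.c = 0 ∧ Real.cosh l.θ = 1 := by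
    rcases h0 with h0 | h0 | h0
    · have hc : l.c ^ 2 = 0 := by nlinarith [sq_nonneg l.c]
      have : l.α * (Real.cosh l.θ - 1) = 0 := by rw [← h2, hc]; simp
      exact ⟨by simpa using hc, by linarith [(mul_eq_zero.1 this).resolve_left hα]⟩
    · rw [h0] at h2
      have : l.α * (Real.cosh l.θ - 1) = 0 := by rw [← h2]; simp
      exact ⟨h0, by linarith [(mul_eq_zero.1 this).resolve_left hα]⟩
    · rw [h0, Real.cosh_zero] at h2
      exact ⟨by simpa using h2, by rw [h0, Real.cosh_zero]⟩
  refine ⟨key.1, ?_⟩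
  by_contra hθ
  exact (Real.one_lt_cosh.2 hθ).ne' key.2

theorem iUnion_pieces : (⋃ i, pieces i) = Set.univ := by
  refine Set.eq_univ_of_forall fun l => Set.mem_iUnion.2 ?_
  rcases lt_trichotomy l.α 0 with hα | hα | hα
  · rcases (neg_α_le_E hα).lt_or_eq with hE | hE
    · exact ⟨0, hα, hE⟩
    · exact ⟨4, hα.ne, hE.symm, eq_zero_of_E_eq_neg_α hα.ne hE.symm (Or.inl hα)⟩
  · have hE : l.E = l.c ^ 2 / 2 := by simp [Costate.E, hα]
    by_cases hc : l.c = 0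
    · exact ⟨6, hα, by simp [hE, hc], hc⟩
    · exact ⟨5, hα, by rw [hE]; positivity, hc⟩
  · rcases lt_trichotomy l.E (-l.α) with hE | hE | hE
    · exact ⟨1, hα, hE⟩
    · by_cases h0 : l.c = 0 ∨ l.θ = 0
      · exact ⟨4, hα.ne', hE, eq_zero_of_E_eq_neg_α hα.ne' hE (Or.inr h0)⟩
      · push Not at h0
        exact ⟨3, hα, hE, h0⟩
    · exact ⟨2, hα, hE⟩

theorem disjoint_pieces (i j : Fin 7) (hij : i ≠ j) : Disjoint (pieces i) (pieces j) := by
  wlog hlt : i < j generalizing i j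
  · exact (this j i hij.symm (lt_of_le_of_ne (not_lt.1 hlt) hij.symm)).symm
  rw [Set.disjoint_left]
  intro l hi hj
  fin_cases i <;> fin_cases j <;> first | exact absurd hlt (by decide) | skip
  all_goals
    simp only [pieces, C1, C2, C3, C4, C5, C6, C7] at hi hj
    simp at hi hj
    grind

/-! ### The reflection -/

theorem h_reflect (q ξ : R4) (i : Fin 4) :
    h i (reflect q) (reflect ξ) = reflect (fun j => h j q ξ) i := by
  fin_cases i <;> simp [h_zero, h_one, h_two, h_three, reflect] <;> ring

theorem hasDerivWithinAt_reflect {J : Set ℝ} {q : ℝ → R4} {v : R4} {t : ℝ}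
    (hq : HasDerivWithinAt q v J t) :
    HasDerivWithinAt (fun t => reflect (q t)) (reflect v) J t := by
  rw [hasDerivWithinAt_pi] at hq ⊢
  intro i
  fin_cases i
  · exact hq 0
  · exact (hq 1).neg
  · exact (hq 2).neg
  · exact (hq 3).neg

/-- The map is the cotangent lift of a linear involution. It fixes h₁ and changes the sign of h₂,
h₃, h₄, so it preserves H, and `velocity` and `force` are equivariant under it. -/
theorem IsNormalExtremal.reflect {J : Set ℝ} {q ξ : ℝ → R4} (hq : IsNormalExtremal J q ξ) :
    IsNormalExtremal J (fun t => reflect (q t)) (fun t => reflect (ξ t)) := by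
  rw [isNormalExtremal_iff] at hq ⊢
  intro t ht
  obtain ⟨h1, h2⟩ := hq t ht
  refine ⟨?_, ?_⟩
  · convert hasDerivWithinAt_reflect h1 using 1
    funext i
    fin_cases i <;> simp [velocity, EngelSL.reflect, h_zero, h_one] <;> ring
  · convert hasDerivWithinAt_reflect h2 using 1
    funext i
    fin_cases i <;> simp [force, EngelSL.reflect, h_zero, h_one] <;> ring

theorem IsNormalExtremal.congr_left {J : Set ℝ} {q q' ξ : ℝ → R4} (hq : IsNormalExtremal J q ξ)
    (hqq' : Set.EqOn q' q J) : IsNormalExtremal J q' ξ := by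
  rw [isNormalExtremal_iff] at hq ⊢
  intro t ht
  rw [hqq' ht]
  exact ⟨(hq t ht).1.congr hqq' (hqq' ht), (hq t ht).2⟩

/-! ### From explicit solutions to maximal extremals -/

/-- An explicit solution `(q, h₁, h₂, h₃) = (q, a, b, c)` of the equations for the trajectory and
for the values of the frame. -/
structure IsExplicitSolution (l : Costate) (τ : EReal) (q : ℝ → R4) (a b c : ℝ → ℝ) : Prop where
  pos : 0 < τ
  q_zero : q 0 = 0
  a_zero : a 0 = Real.sinh l.θ
  b_zero : b 0 = Real.cosh l.θ
  c_zero : c 0 = l.c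
  b_pos : ∀ t : ℝ, 0 ≤ t → (t : EReal) < τ → 0 < b t
  sq_sub_sq : ∀ t : ℝ, 0 ≤ t → (t : EReal) < τ → b t ^ 2 - a t ^ 2 = 1
  energy : ∀ t : ℝ, 0 ≤ t → (t : EReal) < τ → c t ^ 2 / 2 - l.α * b t = l.E
  deriv_a : ∀ t : ℝ, 0 ≤ t → (t : EReal) < τ → HasDerivAt a (-(b t * c t)) t
  deriv_b : ∀ t : ℝ, 0 ≤ t → (t : EReal) < τ → HasDerivAt b (-(a t * c t)) t
  deriv_c : ∀ t : ℝ, 0 ≤ t → (t : EReal) < τ → HasDerivAt c (-(l.α * a t)) t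
  deriv_q0 : ∀ t : ℝ, 0 ≤ t → (t : EReal) < τ → HasDerivAt (fun s => q s 0) (-a t) t
  deriv_q1 : ∀ t : ℝ, 0 ≤ t → (t : EReal) < τ → HasDerivAt (fun s => q s 1) (b t) t
  deriv_q2 : ∀ t : ℝ, 0 ≤ t → (t : EReal) < τ →
    HasDerivAt (fun s => q s 2) ((a t * q t 1 + b t * q t 0) / 2) t
  deriv_q3 : ∀ t : ℝ, 0 ≤ t → (t : EReal) < τ →
    HasDerivAt (fun s => q s 3) (b t * (q t 0 ^ 2 + q t 1 ^ 2) / 2) t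

namespace IsExplicitSolution

variable {l : Costate} {τ : EReal} {q : ℝ → R4} {a b c : ℝ → ℝ}

theorem isNormalExtremal (H : IsExplicitSolution l τ q a b c) :
    IsNormalExtremal {t : ℝ | 0 ≤ t ∧ (t : EReal) < τ} q
      (fun t => coframe (q t) ![a t, b t, c t, l.α]) := by
  rw [isNormalExtremal_iff]
  rintro t ⟨h0, h1⟩
  have da := H.deriv_a t h0 h1
  have db := H.deriv_b t h0 h1
  have dc := H.deriv_c t h0 h1
  have d0 := H.deriv_q0 t h0 h1
  have d1 := H.deriv_q1 t h0 h1
  simp only [h_coframe]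
  refine ⟨HasDerivAt.hasDerivWithinAt ?_, HasDerivAt.hasDerivWithinAt ?_⟩
  · rw [hasDerivAt_pi]
    intro i
    fin_cases i
    · simpa [velocity] using d0
    · simpa [velocity] using d1
    · simpa [velocity] using H.deriv_q2 t h0 h1
    · simpa [velocity] using H.deriv_q3 t h0 h1
  · have e2 := dc.sub (d0.mul_const l.α)
    rw [hasDerivAt_pi]
    intro i
    simp only [force, h_coframe]
    fin_cases i
    · refine hasDerivAt_of_eq (da.add ((d1.div_const 2).mul e2)) (fun s => ?_) ?_
      · simp [coframe]
      · simp [coframe]; ring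
    · refine hasDerivAt_of_eq ((db.sub ((d0.div_const 2).mul e2)).sub
        ((((d0.pow 2).add (d1.pow 2)).div_const 2).mul_const l.α)) (fun s => ?_) ?_
      · simp [coframe]
      · simp [coframe]; ring
    · refine hasDerivAt_of_eq e2 (fun s => ?_) ?_
      · simp [coframe]
      · simp; ring
    · exact hasDerivAt_const _ _

theorem startsAt (H : IsExplicitSolution l τ q a b c) :
    StartsAt l q (fun t => coframe (q t) ![a t, b t, c t, l.α]) := by
  refine ⟨H.q_zero, fun i => ?_⟩
  rw [h_coframe, H.a_zero, H.b_zero, H.c_zero]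
  rfl

theorem eq_of_lt (H : IsExplicitSolution l τ q a b c) {T : ℝ} {p ξ : ℝ → R4}
    (hp : IsNormalExtremal (Set.Icc 0 T) p ξ) (hl : StartsAt l p ξ) {t : ℝ} (h0 : 0 ≤ t)
    (hT : t ≤ T) (hτ : (t : EReal) < τ) :
    p t = q t ∧ ∀ i, h i (p t) (ξ t) = ![a t, b t, c t, l.α] i := by
  have hsub : Set.Icc 0 t ⊆ {t : ℝ | 0 ≤ t ∧ (t : EReal) < τ} :=
    fun s hs => ⟨hs.1, (EReal.coe_le_coe_iff.2 hs.2).trans_lt hτ⟩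
  have h2 := H.isNormalExtremal.mono hsub
  have hpq : p 0 = q 0 := hl.1.trans H.q_zero.symm
  obtain ⟨e1, e2⟩ := (hp.mono (Set.Icc_subset_Icc_right hT)).eqOn h2 hpq
    (by
      -- A covector is recovered from its frame values, so equal initial `h i` at the same point
      -- give equal initial covectors.
      rw [← coframe_h (p 0) (ξ 0)]
      rw [hpq]
      congr 1
      funext i
      rw [← hpq, hl.2 i, ← H.startsAt.2 i, h_coframe]) t ⟨h0, le_rfl⟩
  refine ⟨e1, fun i => ?_⟩
  rw [e1, e2, h_coframe]

/-- If an extremal lived on [0, T] with T ≥ τ, its h₃ would be continuous at τ, yet before τ it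
coincides with `c`, which is unbounded there. The condition `hc` is vacuous for τ = ⊤. -/
theorem lt_of_tendsto (H : IsExplicitSolution l τ q a b c)
    (hc : ∀ T : ℝ, τ = T → Tendsto (fun t => |c t|) (𝓝[<] T) atTop) {T : ℝ} {p ξ : ℝ → R4}
    (hp : IsNormalExtremal (Set.Icc 0 T) p ξ) (hl : StartsAt l p ξ) :
    (T : EReal) < τ := by
  by_contra! hle
  have hpos := H.pos
  induction τ with
  | bot => simp at hpos
  | top => simp at hle
  | coe s =>
    have hs : 0 < s := by exact_mod_cast hpos
    have hsT : s ≤ T := by exact_mod_cast hle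
    have hcont : ContinuousWithinAt (fun t => |h 2 (p t) (ξ t)|) (Set.Icc 0 T) s := by
      rw [isNormalExtremal_iff] at hp
      obtain ⟨c1, c2⟩ := hp s ⟨hs.le, hsT⟩
      have c1 := c1.continuousWithinAt
      have c2 := c2.continuousWithinAt
      rw [continuousWithinAt_pi] at c1 c2
      simp only [h_two]
      exact ((c2 2).add ((c1 0).mul (c2 3))).abs
    have h1 : Tendsto (fun t => |h 2 (p t) (ξ t)|) (𝓝[<] s) (𝓝 |h 2 (p s) (ξ s)|) :=
      (hcont.mono_of_mem_nhdsWithin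
        (mem_of_superset (Ioo_mem_nhdsLT hs) fun t ht => ⟨ht.1.le, ht.2.le.trans hsT⟩)).tendsto
    refine not_tendsto_nhds_of_tendsto_atTop (hc s rfl) _ (h1.congr' ?_)
    filter_upwards [Ioo_mem_nhdsLT hs] with t ht
    rw [(H.eq_of_lt hp hl ht.1.le (ht.2.le.trans hsT) (by exact_mod_cast ht.2)).2 2]
    rfl

/-- Here `q` is the form convenient for differentiation and `q'` the closed formula of the theorem;
they need to agree only on [0, τ). Membership in `S` and the condition `P` are reduced to statements
about a costate with prescribed frame values. -/
theorem extremalGivenBy (H : IsExplicitSolution l τ q a b c)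
    (hc : ∀ T : ℝ, τ = T → Tendsto (fun t => |c t|) (𝓝[<] T) atTop) {S : Set Costate}
    {P : ℝ → Costate → Prop}
    {q' : ℝ → R4} (hq : ∀ t : ℝ, 0 ≤ t → (t : EReal) < τ → q' t = q t)
    (hP : ∀ (t : ℝ) (m : Costate), 0 ≤ t → (t : EReal) < τ → Real.sinh m.θ = a t →
      Real.cosh m.θ = b t → m.c = c t → m.α = l.α → m.E = l.E → m ∈ S ∧ P t m) :
    ExtremalGivenBy S l τ P q' := by
  refine ⟨le_antisymm (sSup_le ?_) (le_of_forall_lt fun x hx => ?_),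
    ⟨_, H.isNormalExtremal.congr_left fun t ht => hq t ht.1 ht.2, ?_⟩, fun T p ξ hT hp hl => ?_⟩
  · rintro _ ⟨T, rfl, hT, p, ξ, hp, hl⟩
    exact (H.lt_of_tendsto hc hp hl).le
  -- A real `y` above both `x` and 0 and below τ is an admissible length, so the supremum exceeds
  -- `x`. The maximum with 0 covers negative `x`.
  · obtain ⟨y, hy, hyτ⟩ := EReal.lt_iff_exists_real_btwn.1 (max_lt hx H.pos)
    have hy0 : 0 < y := by exact_mod_cast (le_max_right _ _).trans_lt hy
    have hsub : Set.Icc 0 y ⊆ {t : ℝ | 0 ≤ t ∧ (t : EReal) < τ} :=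
      fun s hs => ⟨hs.1, (EReal.coe_le_coe_iff.2 hs.2).trans_lt hyτ⟩
    exact ((le_max_left _ _).trans_lt hy).trans_le (le_sSup ⟨y, rfl, hy0.le, _, _,
      H.isNormalExtremal.mono hsub, H.startsAt⟩)
  · have h0 := hq 0 le_rfl H.pos
    exact ⟨h0.trans H.q_zero, fun i => by rw [h0, ← H.startsAt.2 i]⟩
  · have hlt := H.lt_of_tendsto hc hp hl
    refine ⟨hlt, fun t ht => ?_⟩
    have htτ : (t : EReal) < τ := (EReal.coe_le_coe_iff.2 ht.2).trans_lt hlt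
    obtain ⟨e1, e2⟩ := H.eq_of_lt hp hl ht.1 ht.2 htτ
    have hsq := H.sq_sub_sq t ht.1 htτ
    obtain ⟨m, hm⟩ := exists_costate (w := ![a t, b t, c t, l.α]) (by simpa using by linarith)
      (H.b_pos t ht.1 htτ)
    have m0 : Real.sinh m.θ = a t := (hm 0).symm
    have m1 : Real.cosh m.θ = b t := (hm 1).symm
    have m2 : m.c = c t := (hm 2).symm
    have m3 : m.α = l.α := (hm 3).symm
    have mE : m.E = l.E := by
      rw [Costate.E, m1, m2, m3, H.energy t ht.1 htτ]
    have hh : ∀ i, h i (p t) (ξ t) = m.hVec i := fun i => (e2 i).trans (hm i)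
    obtain ⟨mS, mP⟩ := hP t m ht.1 htτ m0 m1 m2 m3 mE
    exact ⟨e1.trans (hq t ht.1 htτ).symm, (hVec_eq_of_h hh).1, m, mS, hh, m3, mE, mP⟩

end IsExplicitSolution

/-- The trajectory in terms of `h₁ = a`, `h₃ = c` and `x₂ = X`, when `α ≠ 0`. -/
noncomputable def trajectory (α E : ℝ) (a c X : ℝ → ℝ) (t : ℝ) : R4 :=
  ![(c t - c 0) / α, X t, -(a t - a 0 + (c t + c 0) * X t / 2) / α,
    X t ^ 3 / 6 + (2 / 3 * (E * X t + α * t - a t * c t + a 0 * c 0) + 2 * c 0 * (a t - a 0)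
      + c 0 ^ 2 * X t) / (2 * α ^ 2)]

/-- Integration by parts. The formula for y uses a' = -bc and c' = -αa. For z the remaining integral
is ∫ b (c - c₀)² / (2α²). Since c² = 2E + 2αb and a² = b² - 1, one has (ac)' = -(3/2) b c² + E b +
α, whence ∫ b c² = (2/3)(E X + α t - ac + a₀c₀); the cross term is -2c₀ ∫ bc = 2c₀ (a - a₀). Thus
each piece with α ≠ 0 only has to supply `a`, `c` and `X`. -/
theorem isExplicitSolution_trajectory {l : Costate} {τ : EReal} {a c X : ℝ → ℝ} (hτ : 0 < τ)
    (hα : l.α ≠ 0) (ha : a 0 = Real.sinh l.θ) (hc : c 0 = l.c) (hX : X 0 = 0)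
    (hb : ∀ t : ℝ, 0 ≤ t → (t : EReal) < τ → 0 < (c t ^ 2 / 2 - l.E) / l.α)
    (hab : ∀ t : ℝ, 0 ≤ t → (t : EReal) < τ → ((c t ^ 2 / 2 - l.E) / l.α) ^ 2 - a t ^ 2 = 1)
    (hda : ∀ t : ℝ, 0 ≤ t → (t : EReal) < τ →
      HasDerivAt a (-((c t ^ 2 / 2 - l.E) / l.α * c t)) t)
    (hdc : ∀ t : ℝ, 0 ≤ t → (t : EReal) < τ → HasDerivAt c (-(l.α * a t)) t)
    (hdX : ∀ t : ℝ, 0 ≤ t → (t : EReal) < τ → HasDerivAt X ((c t ^ 2 / 2 - l.E) / l.α) t) :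
    IsExplicitSolution l τ (trajectory l.α l.E a c X) a
      (fun t => (c t ^ 2 / 2 - l.E) / l.α) c where
  pos := hτ
  q_zero := by
    ext i
    fin_cases i <;> simp [trajectory, hX]
  a_zero := ha
  b_zero := by
    rw [hc, Costate.E]
    field_simp
    ring
  c_zero := hc
  b_pos := hb
  sq_sub_sq := hab
  energy t _ _ := by
    field_simp
    ring
  deriv_a := hda
  deriv_c := hdc
  deriv_b t h0 h1 := by
    refine hasDerivAt_of_eq (((((hdc t h0 h1).pow 2).div_const 2).sub_const l.E).div_const l.α)
      (fun _ => rfl) ?_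
    field_simp
    push_cast
    ring
  deriv_q0 t h0 h1 := by
    refine hasDerivAt_of_eq (((hdc t h0 h1).sub_const (c 0)).div_const l.α) (fun _ => rfl) ?_
    field_simp
  deriv_q1 := hdX
  deriv_q2 t h0 h1 := by
    refine hasDerivAt_of_eq ((((hda t h0 h1).sub_const (a 0)).add
      ((((hdc t h0 h1).add_const (c 0)).mul (hdX t h0 h1)).div_const 2)).neg.div_const l.α)
      (fun _ => rfl) ?_
    simp [trajectory]
    field_simp
    ring
  deriv_q3 t h0 h1 := by
    have da := hda t h0 h1
    have dc := hdc t h0 h1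
    have dX := hdX t h0 h1
    have hab := hab t h0 h1
    refine hasDerivAt_of_eq (((dX.pow 3).div_const 6).add
      ((((((((dX.const_mul l.E).add ((hasDerivAt_id t).const_mul l.α)).sub (da.mul dc)).add_const
        (a 0 * c 0)).const_mul (2 / 3)).add ((da.sub_const (a 0)).const_mul (2 * c 0))).add
        (dX.const_mul (c 0 ^ 2))).div_const (2 * l.α ^ 2))) (fun _ => rfl) ?_
    simp [trajectory]
    field_simp
    field_simp at hab
    grind

/-! ### Elliptic integrals and Jacobi functions with parameter below 1 -/

section Jacobi

variable {m : ℝ}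

theorem one_sub_mul_sin_sq_pos (hm : m < 1) (x : ℝ) : 0 < 1 - m * Real.sin x ^ 2 := by
  have h1 := Real.sin_sq_le_one x
  have h2 := sq_nonneg (Real.sin x)
  rcases le_total m 0 with h0 | h0 <;> nlinarith

theorem continuous_ellF_integrand (hm : m < 1) :
    Continuous fun t => 1 / √(1 - m * Real.sin t ^ 2) := by
  refine continuous_const.div (by fun_prop) fun x => ?_
  exact (Real.sqrt_pos.2 (one_sub_mul_sin_sq_pos hm x)).ne'

theorem hasDerivAt_ellF (hm : m < 1) (x : ℝ) :
    HasDerivAt (ellF m) (1 / √(1 - m * Real.sin x ^ 2)) x :=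
  intervalIntegral.integral_hasDerivAt_right
    ((continuous_ellF_integrand hm).intervalIntegrable _ _)
    (continuous_ellF_integrand hm).aestronglyMeasurable.stronglyMeasurableAtFilter
    (continuous_ellF_integrand hm).continuousAt

theorem ellF_strictMono (hm : m < 1) : StrictMono (ellF m) :=
  strictMono_of_hasDerivAt_pos (hasDerivAt_ellF hm)
    fun x => one_div_pos.2 (Real.sqrt_pos.2 (one_sub_mul_sin_sq_pos hm x))

theorem continuous_ellF (hm : m < 1) : Continuous (ellF m) :=
  continuous_iff_continuousAt.2 fun x => (hasDerivAt_ellF hm x).continuousAt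

@[simp]
theorem ellF_zero : ellF m 0 = 0 := by simp [ellF]

theorem ellF_neg (x : ℝ) : ellF m (-x) = -ellF m x := by
  have := intervalIntegral.integral_comp_neg (a := 0) (b := x)
    fun t => 1 / √(1 - m * Real.sin t ^ 2)
  simp only [Real.sin_neg, neg_sq, neg_zero] at this
  rw [ellF, ellF, intervalIntegral.integral_symm, ← this]

/-- The integrand is bounded below because 1 - m sin² ≤ 1 + |m|. This linear growth makes `ellF m`
onto ℝ, so that `am` is a genuine inverse. -/
theorem mul_le_ellF (hm : m < 1) {x : ℝ} (hx : 0 ≤ x) : 1 / √(1 + |m|) * x ≤ ellF m x := by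
  have hd : ∀ y, HasDerivAt (fun y => ellF m y - 1 / √(1 + |m|) * y)
      (1 / √(1 - m * Real.sin y ^ 2) - 1 / √(1 + |m|) * 1) y := fun y =>
    (hasDerivAt_ellF hm y).sub ((hasDerivAt_id y).const_mul _)
  have hmono : Monotone fun y => ellF m y - 1 / √(1 + |m|) * y := by
    refine monotone_of_deriv_nonneg (fun y => (hd y).differentiableAt) fun y => ?_
    rw [(hd y).deriv, mul_one, sub_nonneg]
    refine one_div_le_one_div_of_le (Real.sqrt_pos.2 (one_sub_mul_sin_sq_pos hm y))
      (Real.sqrt_le_sqrt ?_)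
    have h1 := Real.sin_sq_le_one y
    have h2 := sq_nonneg (Real.sin y)
    have h3 := neg_abs_le m
    have h4 := abs_nonneg m
    nlinarith
  have := hmono hx
  simp only [ellF_zero, mul_zero, sub_zero] at this
  linarith

theorem ellF_surjective (hm : m < 1) : Function.Surjective (ellF m) := by
  have hpos : 0 < 1 / √(1 + |m|) := by positivity
  have htop : Tendsto (ellF m) atTop atTop :=
    tendsto_atTop_mono' _ (eventually_ge_atTop 0 |>.mono fun x hx => mul_le_ellF hm hx)
      (tendsto_id.const_mul_atTop hpos)
  refine (continuous_ellF hm).surjective htop ?_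
  have : ellF m = fun x => -ellF m (-x) := by
    funext x
    rw [ellF_neg, neg_neg]
  rw [this]
  exact tendsto_neg_atTop_atBot.comp (htop.comp tendsto_neg_atBot_atTop)

theorem ellF_am (hm : m < 1) (u : ℝ) : ellF m (am m u) = u :=
  Function.invFun_eq (ellF_surjective hm u)

theorem am_ellF (hm : m < 1) (x : ℝ) : am m (ellF m x) = x :=
  Function.leftInverse_invFun (ellF_strictMono hm).injective x

theorem am_strictMono (hm : m < 1) : StrictMono (am m) := fun u v huv => by
  rwa [← (ellF_strictMono hm).lt_iff_lt, ellF_am hm, ellF_am hm]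

theorem continuous_am (hm : m < 1) : Continuous (am m) :=
  (am_strictMono hm).monotone.continuous_of_surjective fun x => ⟨_, am_ellF hm x⟩

theorem am_zero (hm : m < 1) : am m 0 = 0 := by
  conv_lhs => rw [← ellF_zero (m := m)]
  exact am_ellF hm 0

theorem sn_sq_add_cn_sq (u : ℝ) : sn m u ^ 2 + cn m u ^ 2 = 1 := Real.sin_sq_add_cos_sq _

theorem dn_sq (hm : m < 1) (u : ℝ) : dn m u ^ 2 = 1 - m * sn m u ^ 2 :=
  Real.sq_sqrt (one_sub_mul_sin_sq_pos hm _).le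

theorem dn_pos (hm : m < 1) (u : ℝ) : 0 < dn m u :=
  Real.sqrt_pos.2 (one_sub_mul_sin_sq_pos hm _)

theorem hasDerivAt_am (hm : m < 1) (u : ℝ) : HasDerivAt (am m) (dn m u) u := by
  have := (hasDerivAt_ellF hm (am m u)).of_local_left_inverse (continuous_am hm).continuousAt
    (one_div_pos.2 (Real.sqrt_pos.2 (one_sub_mul_sin_sq_pos hm _))).ne'
    (Eventually.of_forall (ellF_am hm))
  simpa [dn] using this

theorem hasDerivAt_sn (hm : m < 1) (u : ℝ) : HasDerivAt (sn m) (cn m u * dn m u) u :=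
  (hasDerivAt_am hm u).sin

theorem hasDerivAt_cn (hm : m < 1) (u : ℝ) : HasDerivAt (cn m) (-(sn m u * dn m u)) u :=
  hasDerivAt_of_eq (hasDerivAt_am hm u).cos (fun _ => rfl) (by simp [sn])

theorem hasDerivAt_dn (hm : m < 1) (u : ℝ) : HasDerivAt (dn m) (-(m * (sn m u * cn m u))) u := by
  have hd := dn_pos hm u
  have := ((((hasDerivAt_sn hm u).pow 2).const_mul m).const_sub 1).sqrt
    (one_sub_mul_sin_sq_pos hm _).ne'
  refine hasDerivAt_of_eq this (fun _ => rfl) ?_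
  have hs : √(1 - m * (sn m ^ 2) u) = dn m u := rfl
  rw [hs]
  field_simp
  ring

theorem continuous_dn (hm : m < 1) : Continuous (dn m) :=
  continuous_iff_continuousAt.2 fun u => (hasDerivAt_dn hm u).continuousAt

theorem continuous_sn (hm : m < 1) : Continuous (sn m) :=
  continuous_iff_continuousAt.2 fun u => (hasDerivAt_sn hm u).continuousAt

theorem continuous_cn (hm : m < 1) : Continuous (cn m) :=
  continuous_iff_continuousAt.2 fun u => (hasDerivAt_cn hm u).continuousAt

theorem hasDerivAt_jacE (hm : m < 1) (u : ℝ) : HasDerivAt (jacE m) (dn m u ^ 2) u :=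
  have hc : Continuous fun t => dn m t ^ 2 := (continuous_dn hm).pow 2
  intervalIntegral.integral_hasDerivAt_right (hc.intervalIntegrable _ _)
    hc.aestronglyMeasurable.stronglyMeasurableAtFilter hc.continuousAt

theorem am_mem_Ioo_iff (hm : m < 1) {u : ℝ} :
    am m u ∈ Set.Ioo (-(Real.pi / 2)) (Real.pi / 2) ↔ u ∈ Set.Ioo (-ellK m) (ellK m) := by
  simp only [Set.mem_Ioo]
  rw [← (ellF_strictMono hm).lt_iff_lt, ← (ellF_strictMono hm).lt_iff_lt (a := am m u),
    ellF_am hm, ellF_neg]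
  rfl

theorem cn_pos (hm : m < 1) {u : ℝ} (hu : u ∈ Set.Ioo (-ellK m) (ellK m)) : 0 < cn m u :=
  Real.cos_pos_of_mem_Ioo ((am_mem_Ioo_iff hm).2 hu)

theorem cn_ellK (hm : m < 1) : cn m (ellK m) = 0 := by
  rw [cn, ellK, am_ellF hm, Real.cos_pi_div_two]

theorem sn_ellK (hm : m < 1) : sn m (ellK m) = 1 := by
  rw [sn, ellK, am_ellF hm, Real.sin_pi_div_two]

/-- `sn` is a bijection from `(-K, K)` to `(-1, 1)`. -/
theorem existsUnique_sn_eq (hm : m < 1) {s : ℝ} (hs : s ∈ Set.Ioo (-1) 1) :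
    ∃! u, u ∈ Set.Ioo (-ellK m) (ellK m) ∧ sn m u = s := by
  refine ⟨ellF m (Real.arcsin s), ⟨?_, ?_⟩, ?_⟩
  · rw [← am_mem_Ioo_iff hm, am_ellF hm]
    exact ⟨Real.neg_pi_div_two_lt_arcsin.2 hs.1, Real.arcsin_lt_pi_div_two.2 hs.2⟩
  · rw [sn, am_ellF hm, Real.sin_arcsin hs.1.le hs.2.le]
  · rintro u ⟨hu, rfl⟩
    obtain ⟨h1, h2⟩ := (am_mem_Ioo_iff hm).2 hu
    rw [sn, Real.arcsin_sin h1.le h2.le, ellF_am hm]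

/-- The integrand has period π and is symmetric under t ↦ π - t, so each quarter of [0, 2π]
contributes K. -/
theorem ellF_two_pi (hm : m < 1) : ellF m (2 * Real.pi) = 4 * ellK m := by
  set f : ℝ → ℝ := fun t => 1 / √(1 - m * Real.sin t ^ 2) with hf
  have hi : ∀ a b, IntervalIntegrable f MeasureTheory.volume a b := fun a b =>
    (continuous_ellF_integrand hm).intervalIntegrable a b
  have hper : Function.Periodic f Real.pi := fun t => by simp [hf, Real.sin_add_pi]
  have h1 : ∫ t in (Real.pi / 2)..Real.pi, f t = ellK m := by
    have := intervalIntegral.integral_comp_sub_left (a := 0) (b := Real.pi / 2) f Real.pi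
    simp only [hf, Real.sin_pi_sub, sub_zero] at this
    rw [ellK, ellF, this]
    congr 1
    ring
  have h2 : ellF m Real.pi = 2 * ellK m := by
    rw [ellF, ← intervalIntegral.integral_add_adjacent_intervals (hi 0 (Real.pi / 2)) (hi _ _), h1,
      two_mul]
    rfl
  have h3 : ∫ t in Real.pi..(2 * Real.pi), f t = ellF m Real.pi := by
    have := hper.intervalIntegral_add_eq 0 Real.pi
    rw [zero_add] at this
    rw [ellF, this, two_mul]
  rw [ellF, ← intervalIntegral.integral_add_adjacent_intervals (hi 0 Real.pi) (hi _ _), h3]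
  change ellF m Real.pi + _ = _
  rw [h2]
  ring

/-- The amplitude maps [0, 4K) bijectively onto [0, 2π), and a point of the unit circle has exactly
one angle there. -/
theorem existsUnique_sn_cn_eq (hm : m < 1) {s c : ℝ} (hsc : s ^ 2 + c ^ 2 = 1) :
    ∃! u, u ∈ Set.Ico 0 (4 * ellK m) ∧ sn m u = s ∧ cn m u = c := by
  have hmem : ∀ u, am m u ∈ Set.Ico 0 (2 * Real.pi) ↔ u ∈ Set.Ico 0 (4 * ellK m) := fun u => by
    simp only [Set.mem_Ico]
    rw [← (ellF_strictMono hm).lt_iff_lt, ← (ellF_strictMono hm).le_iff_le, ellF_am hm,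
      ellF_two_pi hm, ellF_zero]
  have hz : ‖(⟨c, s⟩ : ℂ)‖ = 1 := by
    rw [Complex.norm_def, Complex.normSq_mk, Real.sqrt_eq_one]
    linarith
  -- The argument takes values in (-π, π]; it is shifted to [0, 2π).
  set x := toIcoMod Real.two_pi_pos 0 (Complex.arg ⟨c, s⟩) with hx
  have hxm : x ∈ Set.Ico 0 (2 * Real.pi) := by
    simpa using toIcoMod_mem_Ico Real.two_pi_pos 0 (Complex.arg ⟨c, s⟩)
  have hxe : x = Complex.arg ⟨c, s⟩ - (toIcoDiv Real.two_pi_pos 0 (Complex.arg ⟨c, s⟩) : ℝ) *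
      (2 * Real.pi) := by
    rw [hx, toIcoMod]; simp
  have hsin : Real.sin x = s := by
    rw [hxe, Real.sin_sub_int_mul_two_pi, Complex.sin_arg, hz, div_one]
  have hcos : Real.cos x = c := by
    rw [hxe, Real.cos_sub_int_mul_two_pi, Complex.cos_arg (by rw [← norm_pos_iff, hz]; simp), hz,
      div_one]
  refine ⟨ellF m x, ⟨?_, ?_, ?_⟩, ?_⟩
  · rwa [← hmem, am_ellF hm]
  · rw [sn, am_ellF hm, hsin]
  · rw [cn, am_ellF hm, hcos]
  · rintro u ⟨hu, h1, h2⟩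
    rw [← hmem] at hu
    suffices am m u = x by rw [← this, ellF_am hm]
    have hang : (am m u : Real.Angle) = x :=
      Real.Angle.cos_sin_inj (by rw [hcos]; exact h2) (by rw [hsin]; exact h1)
    -- Two angles in [0, 2π) differ here by 2πk, which leaves only -1 < k < 1.
    obtain ⟨k, hk⟩ := Real.Angle.angle_eq_iff_two_pi_dvd_sub.1 hang
    have hpi := Real.pi_pos
    have k1 : (k : ℝ) < 1 := by nlinarith [hu.2, hxm.1]
    have k2 : (-1 : ℝ) < k := by nlinarith [hu.1, hxm.2]
    have : k = 0 := by
      have k1' : k < 1 := by exact_mod_cast k1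
      have k2' : -1 < k := by exact_mod_cast k2
      omega
    rw [this] at hk
    simp at hk
    linarith

/-- Solutions on `ℝ` of a locally Lipschitz autonomous system are unique. -/
theorem eq_of_hasDerivAt {V : Type*} [NormedAddCommGroup V] [NormedSpace ℝ V]
    {F : V → V} (hF : LocallyLipschitz F) {f g : ℝ → V}
    (hf : ∀ t, HasDerivAt f (F (f t)) t) (hg : ∀ t, HasDerivAt g (F (g t)) t)
    (h0 : f 0 = g 0) : f = g := by
  funext t
  rcases le_total 0 t with ht | ht
  · exact eqOn_Icc_of_hasDerivWithinAt hF (fun s _ => (hf s).hasDerivWithinAt)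
      (fun s _ => (hg s).hasDerivWithinAt) h0 (Set.right_mem_Icc.2 ht)
  -- Negative times are handled by reversing time, which replaces the field by its negative.
  · have hF' : LocallyLipschitz fun v => -F v := by
      intro x
      obtain ⟨K, s, hs, hK⟩ := hF x
      exact ⟨K, s, hs, hK.neg⟩
    have key : ∀ {φ : ℝ → V}, (∀ t, HasDerivAt φ (F (φ t)) t) →
        ∀ s, HasDerivAt (fun s => φ (-s)) (-F (φ (-s))) s := fun hφ s => by
      simpa [Function.comp_def] using (hφ (-s)).scomp s (hasDerivAt_neg s)
    have := eqOn_Icc_of_hasDerivWithinAt hF'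
      (fun s _ => (key hf s).hasDerivWithinAt (s := Set.Icc 0 (-t)))
      (fun s _ => (key hg s).hasDerivWithinAt) (by simpa using h0)
      (Set.right_mem_Icc.2 (neg_nonneg.2 ht))
    simpa using this

/-- The triples solving the system of differential equations of `(sn, cn, dn)` with the same
initial values are `(sn, cn, dn)`, up to a rescaling of time. -/
theorem jacobi_eq_of_hasDerivAt (hm : m < 1) {κ : ℝ} {s c d : ℝ → ℝ}
    (hs : ∀ t, HasDerivAt s (κ * (c t * d t)) t)
    (hc : ∀ t, HasDerivAt c (-(κ * (s t * d t))) t)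
    (hd : ∀ t, HasDerivAt d (-(κ * (m * (s t * c t)))) t)
    (s0 : s 0 = 0) (c0 : c 0 = 1) (d0 : d 0 = 1) (t : ℝ) :
    sn m (κ * t) = s t ∧ cn m (κ * t) = c t ∧ dn m (κ * t) = d t := by
  set F : ℝ × ℝ × ℝ → ℝ × ℝ × ℝ := fun v =>
    (κ * (v.2.1 * v.2.2), -(κ * (v.1 * v.2.2)), -(κ * (m * (v.1 * v.2.1))))
  have hF : LocallyLipschitz F := ContDiff.locallyLipschitz (𝕂 := ℝ) (by fun_prop)
  have lin : ∀ t, HasDerivAt (fun t => κ * t) κ t := fun t => by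
    simpa using (hasDerivAt_id t).const_mul κ
  have := eq_of_hasDerivAt hF (f := fun t => (sn m (κ * t), cn m (κ * t), dn m (κ * t)))
    (g := fun t => (s t, c t, d t))
    (fun t => HasDerivAt.prodMk
      (hasDerivAt_of_eq ((hasDerivAt_sn hm _).comp t (lin t)) (fun _ => rfl) (by ring))
      (HasDerivAt.prodMk
        (hasDerivAt_of_eq ((hasDerivAt_cn hm _).comp t (lin t)) (fun _ => rfl) (by ring))
        (hasDerivAt_of_eq ((hasDerivAt_dn hm _).comp t (lin t)) (fun _ => rfl) (by ring))))
    (fun t => (hs t).prodMk ((hc t).prodMk (hd t)))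
    (by simp [s0, c0, d0, sn, cn, dn, am_zero hm])
  simpa using congrFun this t

end Jacobi

/-! ### Jacobi functions along the phase `κ (φ + t)` -/

theorem hasDerivAt_sn_affine {m : ℝ} (hm : m < 1) (κ φ t : ℝ) :
    HasDerivAt (fun t => sn m (κ * (φ + t)))
      (κ * (cn m (κ * (φ + t)) * dn m (κ * (φ + t)))) t :=
  hasDerivAt_of_eq ((hasDerivAt_sn hm _).comp t (((hasDerivAt_id t).const_add φ).const_mul κ))
    (fun _ => rfl) (by simp; ring)

theorem hasDerivAt_cn_affine {m : ℝ} (hm : m < 1) (κ φ t : ℝ) :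
    HasDerivAt (fun t => cn m (κ * (φ + t)))
      (-(κ * (sn m (κ * (φ + t)) * dn m (κ * (φ + t))))) t :=
  hasDerivAt_of_eq ((hasDerivAt_cn hm _).comp t (((hasDerivAt_id t).const_add φ).const_mul κ))
    (fun _ => rfl) (by simp; ring)

theorem hasDerivAt_dn_affine {m : ℝ} (hm : m < 1) (κ φ t : ℝ) :
    HasDerivAt (fun t => dn m (κ * (φ + t)))
      (-(κ * (m * (sn m (κ * (φ + t)) * cn m (κ * (φ + t)))))) t :=
  hasDerivAt_of_eq ((hasDerivAt_dn hm _).comp t (((hasDerivAt_id t).const_add φ).const_mul κ))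
    (fun _ => rfl) (by simp; ring)

theorem hasDerivAt_jacE_affine {m : ℝ} (hm : m < 1) (κ φ t : ℝ) :
    HasDerivAt (fun t => jacE m (κ * (φ + t))) (κ * dn m (κ * (φ + t)) ^ 2) t :=
  hasDerivAt_of_eq ((hasDerivAt_jacE hm _).comp t (((hasDerivAt_id t).const_add φ).const_mul κ))
    (fun _ => rfl) (by simp; ring)

/-! ### The piece `C₁` -/

section C1

variable {l : Costate}

theorem m1_mem_Ioo (hl : l ∈ C1) : m1 l ∈ Set.Ioo 0 1 := by
  obtain ⟨hα, hE⟩ := hl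
  have h1 : 0 < l.E - l.α := by linarith
  exact ⟨div_pos (by linarith) h1, (div_lt_one h1).2 (by linarith)⟩

theorem ae1_pos (hl : l ∈ C1) : 0 < ae1 l :=
  Real.sqrt_pos.2 (by linarith [hl.1, hl.2])

/-- The parameters `κ` and `g = κ k` express all the constants of `C₁` rationally. -/
theorem exists_param_C1 (hl : l ∈ C1) : ∃ g : ℝ, 0 < g ∧ g < ae1 l ∧
    l.E = ae1 l ^ 2 + g ^ 2 ∧ l.α = g ^ 2 - ae1 l ^ 2 ∧ m1 l = g ^ 2 / ae1 l ^ 2 ∧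
    √(2 * (l.E + l.α)) = 2 * g ∧ √(l.E - l.α) * √(l.E + l.α) = 2 * ae1 l * g ∧
    √2 * √(l.α + l.E) = 2 * g ∧ √(l.α + l.E) / (√2 * l.α ^ 2) = g / l.α ^ 2 := by
  obtain ⟨hα, hE⟩ := hl
  have h1 : 0 < (l.E + l.α) / 2 := by linarith
  have h2 : 0 < (l.E - l.α) / 2 := by linarith
  have hκ : ae1 l ^ 2 = (l.E - l.α) / 2 := Real.sq_sqrt h2.le
  have hκ0 : 0 < ae1 l := Real.sqrt_pos.2 h2
  have hg : √((l.E + l.α) / 2) ^ 2 = (l.E + l.α) / 2 := Real.sq_sqrt h1.le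
  have hg0 : 0 < √((l.E + l.α) / 2) := Real.sqrt_pos.2 h1
  have s2 : √2 * √2 = (2 : ℝ) := Real.mul_self_sqrt (by norm_num)
  have s20 : 0 < √(2 : ℝ) := by positivity
  have e1 : √(l.E + l.α) = √2 * √((l.E + l.α) / 2) := by
    rw [← Real.sqrt_mul (by norm_num)]
    congr 1
    ring
  have e2 : √(l.E - l.α) = √2 * ae1 l := by
    rw [ae1, ← Real.sqrt_mul (by norm_num)]
    congr 1
    ring
  refine ⟨√((l.E + l.α) / 2), hg0, Real.sqrt_lt_sqrt h1.le (by linarith), by linarith,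
    by linarith, ?_, ?_, ?_, ?_, ?_⟩
  · rw [hg, hκ, m1]
    have : l.E - l.α ≠ 0 := by linarith
    field_simp
  · rw [Real.sqrt_mul (by norm_num), e1]
    linear_combination √((l.E + l.α) / 2) * s2
  · rw [e1, e2]
    linear_combination ae1 l * √((l.E + l.α) / 2) * s2
  · rw [add_comm, e1]
    linear_combination √((l.E + l.α) / 2) * s2
  · rw [add_comm, e1]
    field_simp

/-- The formula for c dictates the value `s` of sn, the formula for sinh θ dictates the value `c` of
cn, and conservation of E and H says exactly that (c, s) lies on the unit circle. The amplitude does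
the rest. -/
theorem existsUnique_chart1 (hl : l ∈ C1) :
    ∃! φ : ℝ, φ ∈ Set.Ico 0 (4 * ellK (m1 l) / ae1 l) ∧ Chart1 φ l := by
  obtain ⟨g, hg0, hgκ, hE, hα, hm, r1, r2, -, -⟩ := exists_param_C1 hl
  have hm1 := (m1_mem_Ioo hl).2
  have hκ := ae1_pos hl
  have hαn : l.α ≠ 0 := hl.1.ne
  have hden : g ^ 2 - ae1 l ^ 2 ≠ 0 := hα ▸ hαn
  unfold Chart1
  rw [r1, r2]
  have hen : l.c ^ 2 / 2 - l.α * Real.cosh l.θ = ae1 l ^ 2 + g ^ 2 := by rw [← hE, Costate.E]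
  have hcs := Real.cosh_sq l.θ
  have h1 := Real.one_le_cosh l.θ
  obtain ⟨s, hs⟩ : ∃ s, s = l.c / (2 * g) := ⟨_, rfl⟩
  have hc : l.c = 2 * g * s := by rw [hs]; field_simp
  -- The energy identity is 2g²(s² - 1) = -(κ² - g²)(cosh θ - 1), which is nonpositive because g <
  -- κ; hence s² ≤ 1 and the square root giving dn is positive.
  have hd : 0 < 1 - m1 l * s ^ 2 := by
    have : s ^ 2 ≤ 1 := by
      rw [hc, hα] at hen
      have h2 : 0 ≤ (ae1 l ^ 2 - g ^ 2) * (Real.cosh l.θ - 1) :=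
        mul_nonneg (by nlinarith) (by linarith)
      have : g ^ 2 * (s ^ 2 - 1) ≤ 0 := by linarith
      nlinarith [mul_pos hg0 hg0]
    nlinarith [(m1_mem_Ioo hl).1]
  have hdsq : √(1 - m1 l * s ^ 2) ^ 2 = 1 - m1 l * s ^ 2 := Real.sq_sqrt hd.le
  obtain ⟨d, hdd⟩ : ∃ d, d = √(1 - m1 l * s ^ 2) := ⟨_, rfl⟩
  rw [← hdd] at hdsq
  have hd0 : 0 < d := hdd ▸ Real.sqrt_pos.2 hd
  -- The formula for sinh θ solved for cn.
  obtain ⟨c, hcdef⟩ : ∃ c, c = -(l.α * Real.sinh l.θ) / (2 * ae1 l * g * d) := ⟨_, rfl⟩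
  have hsinh : Real.sinh l.θ = -(2 * ae1 l * g * c * d) / l.α := by
    rw [hcdef]; field_simp
  have hcosh : Real.cosh l.θ = 1 - 2 * g ^ 2 * (1 - s ^ 2) / l.α := by
    rw [hc] at hen
    field_simp
    linear_combination -hen - hα
  have hsc : s ^ 2 + c ^ 2 = 1 := by
    have e : (l.α * Real.sinh l.θ) ^ 2 = (2 * ae1 l * g * d) ^ 2 * (1 - s ^ 2) := by
      have e1 : (l.α * Real.sinh l.θ) ^ 2 = (l.α * Real.cosh l.θ) ^ 2 - l.α ^ 2 := by
        linear_combination -l.α ^ 2 * hcs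
      have e2 : l.α * Real.cosh l.θ = l.α - 2 * g ^ 2 * (1 - s ^ 2) := by
        rw [hcosh]; field_simp
      rw [e1, e2, mul_pow, hdsq, hm, hα]
      field_simp
      ring
    rw [hcdef, div_pow, neg_sq, e]
    field_simp
    ring
  obtain ⟨u, ⟨hu, hus, huc⟩, huniq⟩ := existsUnique_sn_cn_eq hm1 hsc
  have hdn : ∀ v, sn (m1 l) v = s → dn (m1 l) v = d := fun v hv => by
    rw [hdd, ← hv]; rfl
  have hmem : ∀ φ, φ ∈ Set.Ico 0 (4 * ellK (m1 l) / ae1 l) ↔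
      ae1 l * φ ∈ Set.Ico 0 (4 * ellK (m1 l)) := fun φ => by
    simp only [Set.mem_Ico, lt_div_iff₀ hκ, mul_comm φ, mul_nonneg_iff_of_pos_left hκ]
  have hu' : ae1 l * (u / ae1 l) = u := by field_simp
  refine ⟨u / ae1 l, ⟨?_, ?_, ?_, ?_⟩, ?_⟩
  · rwa [hmem, hu']
  · rw [hu', hus, hc]
  · rw [hu', huc, hdn u hus, hsinh]
  · rw [hu', huc, hcosh, hE, hα, ← hsc]
    ring
  · rintro φ ⟨hφ, e1, e2, -⟩
    rw [hmem] at hφ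
    have e3 : sn (m1 l) (ae1 l * φ) = s := by
      rw [hs, e1]; field_simp
    have e4 : cn (m1 l) (ae1 l * φ) = c := by
      rw [hcdef, e2, hdn _ e3]
      field_simp
    rw [← huniq _ ⟨hφ, e3, e4⟩]
    field_simp

theorem extremalGivenBy_C1 (hl : l ∈ C1) {φ₀ : ℝ} (hφ : Chart1 φ₀ l) :
    ExtremalGivenBy C1 l ⊤ (fun t m => Chart1 (φ₀ + t) m) (q1 l φ₀) := by
  obtain ⟨g, hg0, hgκ, hE, hα, hm, r1, r2, r3, r4⟩ := exists_param_C1 hl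
  have hm1 := (m1_mem_Ioo hl).2
  have hκ := ae1_pos hl
  have hαn : l.α ≠ 0 := hl.1.ne
  have hden : g ^ 2 - ae1 l ^ 2 ≠ 0 := hα ▸ hαn
  obtain ⟨h1, h2, -⟩ := hφ
  rw [r1] at h1
  rw [r2] at h2
  set κ := ae1 l with hκdef
  set S : ℝ → ℝ := fun t => sn (m1 l) (κ * (φ₀ + t)) with hS
  set C : ℝ → ℝ := fun t => cn (m1 l) (κ * (φ₀ + t)) with hC
  set D : ℝ → ℝ := fun t => dn (m1 l) (κ * (φ₀ + t)) with hD
  set Ψ : ℝ → ℝ := fun t => jacE (m1 l) (κ * (φ₀ + t)) with hΨ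
  have dS : ∀ t, HasDerivAt S (κ * (C t * D t)) t := hasDerivAt_sn_affine hm1 κ φ₀
  have dC : ∀ t, HasDerivAt C (-(κ * (S t * D t))) t := hasDerivAt_cn_affine hm1 κ φ₀
  have dD : ∀ t, HasDerivAt D (-(κ * (m1 l * (S t * C t)))) t := hasDerivAt_dn_affine hm1 κ φ₀
  have dΨ : ∀ t, HasDerivAt Ψ (κ * D t ^ 2) t := hasDerivAt_jacE_affine hm1 κ φ₀
  have hSC : ∀ t, C t ^ 2 = 1 - S t ^ 2 := fun t => by
    linear_combination sn_sq_add_cn_sq (m := m1 l) (κ * (φ₀ + t))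
  have hDS : ∀ t, κ ^ 2 * D t ^ 2 = κ ^ 2 - g ^ 2 * S t ^ 2 := fun t => by
    simp only [hD, hS, dn_sq hm1]
    rw [hm]
    field_simp
  have eS0 : sn (m1 l) (κ * φ₀) = S 0 := by simp only [hS, add_zero]
  have eC0 : cn (m1 l) (κ * φ₀) = C 0 := by simp only [hC, add_zero]
  have eD0 : dn (m1 l) (κ * φ₀) = D 0 := by simp only [hD, add_zero]
  have eΨ0 : jacE (m1 l) (κ * φ₀) = Ψ 0 := by simp only [hΨ, add_zero]
  have eS : ∀ t, sn (m1 l) (κ * (φ₀ + t)) = S t := fun t => rfl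
  have eC : ∀ t, cn (m1 l) (κ * (φ₀ + t)) = C t := fun t => rfl
  have eD : ∀ t, dn (m1 l) (κ * (φ₀ + t)) = D t := fun t => rfl
  have eΨ : ∀ t, jacE (m1 l) (κ * (φ₀ + t)) = Ψ t := fun t => rfl
  rw [eS0] at h1
  rw [eC0, eD0] at h2
  -- From here S, C, D, Ψ are opaque functions, known only through their derivatives and two
  -- quadratic relations.
  clear_value S C D Ψ
  set a : ℝ → ℝ := fun t => -(2 * κ * g * C t * D t) / l.α with ha
  set c : ℝ → ℝ := fun t => 2 * g * S t with hc
  -- Since g²C² = α + κ²D², cosh θ equals -1 - 2κ²D²/α, whose primitive involves ∫ dn².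
  set X : ℝ → ℝ := fun t => -(2 * κ / l.α) * (Ψ t - Ψ 0) - t with hX
  have hb : ∀ t, (c t ^ 2 / 2 - l.E) / l.α = 1 - 2 * g ^ 2 * C t ^ 2 / l.α := fun t => by
    field_simp
    simp only [hc]
    linear_combination -2 * hE - 2 * hα + 4 * g ^ 2 * hSC t
  have H : IsExplicitSolution l ⊤ (trajectory l.α l.E a c X) a
      (fun t => (c t ^ 2 / 2 - l.E) / l.α) c := by
    refine isExplicitSolution_trajectory (by simp) hαn ?_ ?_ ?_ ?_ ?_ ?_ ?_ ?_
    · simp only [ha, h2]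
    · simp only [hc, h1]
    · simp [hX]
    · intro t _ _
      rw [hb]
      have : 2 * g ^ 2 * C t ^ 2 / l.α ≤ 0 := div_nonpos_of_nonneg_of_nonpos (by positivity) hl.1.le
      linarith
    · intro t _ _
      rw [hb]
      simp only [ha]
      rw [hα]
      field_simp
      linear_combination -4 * g ^ 2 * C t ^ 2 * hDS t + 4 * g ^ 4 * C t ^ 2 * hSC t
    · intro t _ _
      refine hasDerivAt_of_eq ((((dC t).const_mul (2 * κ * g)).mul (dD t)).neg.div_const l.α)
        (fun s => rfl) ?_
      rw [hb]
      simp only [hc]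
      rw [hm, hα]
      field_simp
      linear_combination S t * g ^ 2 * hSC t - S t * hDS t
    · intro t _ _
      refine hasDerivAt_of_eq ((dS t).const_mul (2 * g)) (fun s => rfl) ?_
      simp only [ha]
      field_simp
    · intro t _ _
      refine hasDerivAt_of_eq ((((dΨ t).sub_const (Ψ 0)).const_mul (-(2 * κ / l.α))).sub
        (hasDerivAt_id t)) (fun s => rfl) ?_
      rw [hb]
      field_simp
      linear_combination 2 * hα + 2 * hDS t - 2 * g ^ 2 * hSC t
  refine H.extremalGivenBy (fun T hT => by simp at hT) (fun t _ _ => ?_)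
    fun t μ _ _ e1 e2 e3 e4 e5 => ?_
  · simp only [q1, r3, r4, ← hκdef]
    simp only [eS0, eC0, eD0, eΨ0, eS, eC, eD, eΨ]
    ext i
    fin_cases i
    · simp [trajectory, hc]
      ring
    · simp [trajectory, hX]
    · simp [trajectory, hc, ha, hX]
      field_simp
      ring
    · simp [trajectory, hc, ha, hX]
      field_simp
      rw [hE, hα]
      ring
  · have em : m1 μ = m1 l := by rw [m1, m1, e4, e5]
    have eκ : ae1 μ = κ := by rw [hκdef, ae1, ae1, e4, e5]
    refine ⟨⟨e4 ▸ hl.1, e4 ▸ e5 ▸ hl.2⟩, ?_, ?_, ?_⟩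
    · rw [em, eκ, e4, e5, r1, e3, eS]
    · rw [em, eκ, e4, e5, r2, e1, eC, eD]
    · rw [em, eκ, e4, e5, e2, hb, eC, hE, hα]
      ring

end C1

/-! ### Algebraic identities for `C2` and `C3` -/

section C2Algebra

variable {S C D S₀ C₀ D₀ κ g α E : ℝ}

theorem normSq_C2 (hα : α = κ ^ 2 - g ^ 2) (hE : E = -(κ ^ 2 + g ^ 2)) (hα0 : α ≠ 0)
    (hC : C ≠ 0) (hS : S ^ 2 = 1 - C ^ 2) (hD : κ ^ 2 * D ^ 2 = κ ^ 2 - (κ ^ 2 - g ^ 2) * S ^ 2) :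
    (1 - (α + E) / (α * C ^ 2)) ^ 2 - (2 * κ * g * D / (α * C ^ 2)) ^ 2 = 1 := by
  field_simp
  grind

theorem energy_C2 (hα : α = κ ^ 2 - g ^ 2) (hE : E = -(κ ^ 2 + g ^ 2)) (hα0 : α ≠ 0)
    (hC : C ≠ 0) (hS : S ^ 2 = 1 - C ^ 2) :
    ((2 * g * S / C) ^ 2 / 2 - E) / α = 1 - (α + E) / (α * C ^ 2) := by
  field_simp
  grind

/-- The right-hand side is left in the shape produced by the product, quotient and chain rules, to
be matched with a computed derivative. The same holds for `deriv_X_C2` and the corresponding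
identities on `C3`. -/
theorem deriv_a_C2 {σ m : ℝ} (hα : α = κ ^ 2 - g ^ 2) (hE : E = -(κ ^ 2 + g ^ 2)) (hα0 : α ≠ 0)
    (hC : C ≠ 0) (hS : S ^ 2 = 1 - C ^ 2) (hD : κ ^ 2 * D ^ 2 = κ ^ 2 - (κ ^ 2 - g ^ 2) * S ^ 2)
    (hm : κ ^ 2 * m = κ ^ 2 - g ^ 2) :
    -((1 - (α + E) / (α * C ^ 2)) * -(σ * (2 * g * S / C))) =
      σ * ((2 * κ * g * -(κ * (m * (S * C))) * (α * C ^ 2) -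
        2 * κ * g * D * (α * (2 * C * -(κ * (S * D))))) / (α * C ^ 2) ^ 2) := by
  field_simp
  grind

theorem deriv_X_C2 {m : ℝ} (hα : α = κ ^ 2 - g ^ 2) (hE : E = -(κ ^ 2 + g ^ 2)) (hα0 : α ≠ 0)
    (hC : C ≠ 0) (hS : S ^ 2 = 1 - C ^ 2) (hD : κ ^ 2 * D ^ 2 = κ ^ 2 - (κ ^ 2 - g ^ 2) * S ^ 2)
    (hm : κ ^ 2 * m = κ ^ 2 - g ^ 2) :
    1 - (α + E) / (α * C ^ 2) =
      -(2 * κ * (κ * D ^ 2 - (-(κ * (m * (S * C))) * (S / C) +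
        D * ((κ * (C * D) * C - S * -(κ * (S * D))) / C ^ 2))) + E * 1) / α := by
  field_simp
  grind

/-- This and `z_C2` translate the closed formulas into the integrated form of `trajectory`. The
variable `Ψ` stands for the increment of ∫ dn². -/
theorem y_C2 {σ t Ψ X : ℝ} (hα0 : α ≠ 0) (hC : C ≠ 0) (hC₀ : C₀ ≠ 0) (hS : S ^ 2 = 1 - C ^ 2)
    (hS₀ : S₀ ^ 2 = 1 - C₀ ^ 2)
    (hX : X = -(2 * κ * (Ψ + D₀ * (S₀ / C₀) - D * (S / C)) + E * t) / α) :
    -(g * σ / α ^ 2) * (E * (S₀ / C₀ + S / C) * t +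
      2 * κ * ((S₀ / C₀ + S / C) * Ψ + (D - D₀) * (1 - S₀ / C₀ * (S / C)))) =
    -(σ * (2 * κ * g * D / (α * C ^ 2)) - σ * (2 * κ * g * D₀ / (α * C₀ ^ 2)) +
      (-(σ * (2 * g * S / C)) + -(σ * (2 * g * S₀ / C₀))) * X / 2) / α := by
  rw [hX]
  field_simp
  grind

theorem z_C2 {σ t Ψ X : ℝ} (hσ : σ ^ 2 = 1) (hα : α = κ ^ 2 - g ^ 2) (hE : E = -(κ ^ 2 + g ^ 2))
    (hα0 : α ≠ 0) (hC : C ≠ 0) (hC₀ : C₀ ≠ 0) (hS₀ : S₀ ^ 2 = 1 - C₀ ^ 2)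
    (hX : X = -(2 * κ * (Ψ + D₀ * (S₀ / C₀) - D * (S / C)) + E * t) / α) :
    X ^ 3 / 6 + 2 * κ * (3 * (α + E) * S₀ ^ 2 - E * C₀ ^ 2) / (3 * α ^ 3 * C₀ ^ 2) * Ψ
    + 2 * κ / (3 * α ^ 3 * C ^ 3 * C₀ ^ 3) *
      (C * (α * (C ^ 2 * D₀ * (1 - 3 * C₀ ^ 2) + 3 * C₀ ^ 2 * D)
          + (C ^ 2 * D₀ * (1 - 4 * C₀ ^ 2) + 3 * C₀ ^ 2 * D) * E) * S₀
        - C₀ * D * (α * C₀ ^ 2 + 3 * α * S₀ ^ 2 * C ^ 2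
          + (3 * C ^ 2 + C₀ ^ 2 * (1 - 4 * C ^ 2)) * E) * S)
    + (α + E) * (C₀ ^ 2 * (α - 4 * E) + 3 * E) / (3 * α ^ 3 * C₀ ^ 2) * t =
    X ^ 3 / 6 + (2 / 3 * (E * X + α * t
        - σ * (2 * κ * g * D / (α * C ^ 2)) * -(σ * (2 * g * S / C))
        + σ * (2 * κ * g * D₀ / (α * C₀ ^ 2)) * -(σ * (2 * g * S₀ / C₀)))
      + 2 * -(σ * (2 * g * S₀ / C₀)) *
        (σ * (2 * κ * g * D / (α * C ^ 2)) - σ * (2 * κ * g * D₀ / (α * C₀ ^ 2)))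
      + (-(σ * (2 * g * S₀ / C₀))) ^ 2 * X) / (2 * α ^ 2) := by
  -- The cubic X³/6 is common to both sides; it is cancelled before `X` is expanded. In the rest σ
  -- occurs only in products of two, so σ² = 1 removes it.
  rw [add_assoc, add_assoc, add_right_inj, hX]
  field_simp
  grind

end C2Algebra

section C3Algebra

variable {S C D S₀ C₀ D₀ κ m : ℝ}

theorem normSq_C3 (hC : C ≠ 0) (hS : S ^ 2 = 1 - C ^ 2) :
    ((1 + S ^ 2) / C ^ 2) ^ 2 - (2 * S / C ^ 2) ^ 2 = 1 := by
  field_simp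
  grind

theorem energy_C3 (hκ : κ ≠ 0) (hm : 1 - m ≠ 0) (hC : C ≠ 0) (hS : S ^ 2 = 1 - C ^ 2)
    (hD : D ^ 2 = 1 - m * S ^ 2) :
    ((2 * κ * D / C) ^ 2 / 2 - κ ^ 2 * (1 + m)) / (κ ^ 2 * (1 - m)) = (1 + S ^ 2) / C ^ 2 := by
  field_simp
  grind

theorem deriv_a_C3 {σ : ℝ} (hC : C ≠ 0) (hS : S ^ 2 = 1 - C ^ 2) :
    -((1 + S ^ 2) / C ^ 2 * (σ * (2 * κ * D / C))) =
      -(σ * ((2 * (κ * (C * D)) * C ^ 2 - 2 * S * (2 * C * -(κ * (S * D)))) / (C ^ 2) ^ 2)) := by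
  field_simp
  grind

theorem deriv_c_C3 {σ : ℝ} (hC : C ≠ 0) (hS : S ^ 2 = 1 - C ^ 2) (hD : D ^ 2 = 1 - m * S ^ 2) :
    -(κ ^ 2 * (1 - m) * -(σ * (2 * S / C ^ 2))) =
      σ * ((2 * κ * -(κ * (m * (S * C))) * C - 2 * κ * D * -(κ * (S * D))) / C ^ 2) := by
  field_simp
  grind

theorem deriv_X_C3 (hκ : κ ≠ 0) (hm : 1 - m ≠ 0) (hC : C ≠ 0) (hS : S ^ 2 = 1 - C ^ 2)
    (hD : D ^ 2 = 1 - m * S ^ 2) :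
    (1 + S ^ 2) / C ^ 2 = 2 / (κ * (1 - m)) * (-(κ * (m * (S * C))) * (S / C) +
        D * ((κ * (C * D) * C - S * -(κ * (S * D))) / C ^ 2) - κ * D ^ 2) + 1 := by
  field_simp
  grind

theorem y_C3 {σ t Ψ X : ℝ} (hκ : κ ≠ 0) (hm : 1 - m ≠ 0) (hC : C ≠ 0) (hC₀ : C₀ ≠ 0)
    (hS : S ^ 2 = 1 - C ^ 2) (hS₀ : S₀ ^ 2 = 1 - C₀ ^ 2)
    (hD : D ^ 2 = 1 - m * S ^ 2) (hD₀ : D₀ ^ 2 = 1 - m * S₀ ^ 2)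
    (hX : X = 2 / (κ * (1 - m)) * (D * (S / C) - D₀ * (S₀ / C₀) - Ψ) + t) :
    σ / (κ * (1 - m)) * (2 / (κ * (1 - m)) *
      ((D / C + D₀ / C₀) * Ψ + (D₀ / C₀ * (D / C) + m) * (S₀ - S)) - (D₀ / C₀ + D / C) * t) =
    -(-(σ * (2 * S / C ^ 2)) - -(σ * (2 * S₀ / C₀ ^ 2)) +
      (σ * (2 * κ * D / C) + σ * (2 * κ * D₀ / C₀)) * X / 2) / (κ ^ 2 * (1 - m)) := by
  rw [hX]
  field_simp
  grind

theorem z_C3 {σ t Ψ X : ℝ} (hσ : σ ^ 2 = 1) (hκ : κ ≠ 0) (hm : 1 - m ≠ 0) (hC : C ≠ 0)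
    (hC₀ : C₀ ≠ 0) (hS : S ^ 2 = 1 - C ^ 2) (hS₀ : S₀ ^ 2 = 1 - C₀ ^ 2)
    (hD : D ^ 2 = 1 - m * S ^ 2) (hD₀ : D₀ ^ 2 = 1 - m * S₀ ^ 2)
    (hX : X = 2 / (κ * (1 - m)) * (D * (S / C) - D₀ * (S₀ / C₀) - Ψ) + t) :
    2 * Ψ * (6 - 6 * m + C₀ ^ 2 * (1 + 7 * m)) /
      (3 * κ ^ 3 * C₀ ^ 2 * (-1 + m) ^ 3)
    + 2 * (3 * D₀ ^ 2 + C₀ ^ 2) / (3 * κ ^ 2 * C₀ ^ 2 * (-1 + m) ^ 2) * t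
    + 2 / (3 * κ ^ 3 * C ^ 3 * C₀ ^ 3 * (-1 + m) ^ 3) *
      (C ^ 3 * D₀ * (2 + C₀ ^ 2 - 2 * m + 7 * C₀ ^ 2 * m) * S₀
        - 6 * C₀ ^ 2 * C * D₀ * (m - 1) * S
        + 2 * C₀ ^ 3 * D * (m - 1) * S
        - C₀ * C ^ 2 * D * (6 - 6 * m + C₀ ^ 2 * (1 + 7 * m)) * S) =
    (2 / 3 * (κ ^ 2 * (1 + m) * X + κ ^ 2 * (1 - m) * t
        - -(σ * (2 * S / C ^ 2)) * (σ * (2 * κ * D / C))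
        + -(σ * (2 * S₀ / C₀ ^ 2)) * (σ * (2 * κ * D₀ / C₀)))
      + 2 * (σ * (2 * κ * D₀ / C₀)) * (-(σ * (2 * S / C ^ 2)) - -(σ * (2 * S₀ / C₀ ^ 2)))
      + (σ * (2 * κ * D₀ / C₀)) ^ 2 * X) / (2 * (κ ^ 2 * (1 - m)) ^ 2) := by
  have hm' : -1 + m = -(1 - m) := by ring
  rw [hX, hm']
  -- The recurring denominator 1 - m becomes an atom, so that clearing denominators treats it as one
  -- nonzero factor.
  generalize hn : 1 - m = n at *
  field_simp
  grind

end C3Algebra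

/-! ### Coordinates with values in `(-K / κ, K / κ)` -/

section Coordinate

variable {m κ φ₀ : ℝ}

theorem mem_Ioo_ellK_div_iff (hκ : 0 < κ) {φ : ℝ} :
    φ ∈ Set.Ioo (-(ellK m / κ)) (ellK m / κ) ↔ κ * φ ∈ Set.Ioo (-ellK m) (ellK m) := by
  rw [Set.mem_Ioo, Set.mem_Ioo, ← neg_div, div_lt_iff₀ hκ, lt_div_iff₀ hκ, mul_comm φ]

theorem lt_escapeTime_iff (hκ : 0 < κ) {t : ℝ} :
    t < (ellK m - κ * φ₀) / κ ↔ κ * (φ₀ + t) < ellK m := by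
  rw [lt_div_iff₀ hκ]
  constructor <;> intro h <;> linarith

theorem escapeTime_pos (hκ : 0 < κ) (hφ : φ₀ ∈ Set.Ioo (-(ellK m / κ)) (ellK m / κ)) :
    0 < (ellK m - κ * φ₀) / κ := by
  rw [lt_escapeTime_iff hκ, add_zero]
  exact ((mem_Ioo_ellK_div_iff hκ).1 hφ).2

theorem mul_add_mem_Ioo (hκ : 0 < κ) (hφ : φ₀ ∈ Set.Ioo (-(ellK m / κ)) (ellK m / κ)) {t : ℝ}
    (h0 : 0 ≤ t) (ht : t < (ellK m - κ * φ₀) / κ) :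
    κ * (φ₀ + t) ∈ Set.Ioo (-ellK m) (ellK m) := by
  refine ⟨?_, (lt_escapeTime_iff hκ).1 ht⟩
  have := ((mem_Ioo_ellK_div_iff hκ).1 hφ).1
  have := mul_nonneg hκ.le h0
  linarith

/-- On (-K, K) cn is positive and it vanishes at K. This is the source of the finite escape times on
`C2` and `C3`. -/
theorem tendsto_inv_cn_escapeTime (hm : m < 1) (hκ : 0 < κ)
    (hφ : φ₀ ∈ Set.Ioo (-(ellK m / κ)) (ellK m / κ)) :
    Tendsto (fun t => (cn m (κ * (φ₀ + t)))⁻¹) (𝓝[<] ((ellK m - κ * φ₀) / κ)) atTop := by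
  refine Tendsto.inv_tendsto_nhdsGT_zero (tendsto_nhdsWithin_iff.2 ⟨?_, ?_⟩)
  · have hc : Continuous fun t => cn m (κ * (φ₀ + t)) := (continuous_cn hm).comp (by fun_prop)
    have := hc.tendsto ((ellK m - κ * φ₀) / κ)
    rw [show κ * (φ₀ + (ellK m - κ * φ₀) / κ) = ellK m by field_simp; ring, cn_ellK hm] at this
    exact this.mono_left nhdsWithin_le_nhds
  · filter_upwards [Ioo_mem_nhdsLT (escapeTime_pos hκ hφ)] with t ht
    exact cn_pos hm (mul_add_mem_Ioo hκ hφ ht.1.le ht.2)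

theorem tendsto_sn_escapeTime (hm : m < 1) (hκ : 0 < κ) :
    Tendsto (fun t => sn m (κ * (φ₀ + t))) (𝓝[<] ((ellK m - κ * φ₀) / κ)) (𝓝 1) := by
  have hc : Continuous fun t => sn m (κ * (φ₀ + t)) := (continuous_sn hm).comp (by fun_prop)
  have := hc.tendsto ((ellK m - κ * φ₀) / κ)
  rw [show κ * (φ₀ + (ellK m - κ * φ₀) / κ) = ellK m by field_simp; ring, sn_ellK hm] at this
  exact this.mono_left nhdsWithin_le_nhds

theorem tendsto_dn_escapeTime (hm : m < 1) (hκ : 0 < κ) :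
    Tendsto (fun t => dn m (κ * (φ₀ + t))) (𝓝[<] ((ellK m - κ * φ₀) / κ))
      (𝓝 (dn m (ellK m))) := by
  have hc : Continuous fun t => dn m (κ * (φ₀ + t)) := (continuous_dn hm).comp (by fun_prop)
  have := hc.tendsto ((ellK m - κ * φ₀) / κ)
  rw [show κ * (φ₀ + (ellK m - κ * φ₀) / κ) = ellK m by field_simp; ring] at this
  exact this.mono_left nhdsWithin_le_nhds

end Coordinate

/-! ### Signs of branches -/

theorem sign_sq_eq_one {x : ℝ} (hx : x ≠ 0) : Real.sign x ^ 2 = 1 := by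
  rcases Real.sign_apply_eq_of_ne_zero x hx with h | h <;> rw [h] <;> norm_num

/-- Shows that the sign selecting a branch does not change along an extremal. -/
theorem sign_sign_mul_of_pos {x r : ℝ} (hr : 0 < r) : Real.sign (Real.sign x * r) = Real.sign x := by
  rcases Real.sign_apply_eq x with h | h | h <;> rw [h]
  · rw [neg_one_mul, Real.sign_of_neg (by linarith)]
  · simp
  · rw [one_mul, Real.sign_of_pos hr]

theorem sign_sinh (x : ℝ) : Real.sign (Real.sinh x) = Real.sign x := by
  rcases lt_trichotomy x 0 with h | h | h
  · rw [Real.sign_of_neg h, Real.sign_of_neg (Real.sinh_neg_iff.2 h)]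
  · rw [h, Real.sinh_zero]
  · rw [Real.sign_of_pos h, Real.sign_of_pos (Real.sinh_pos_iff.2 h)]

theorem eq_sign_mul_of_sq_eq {x r : ℝ} (hr : 0 ≤ r) (h : x ^ 2 = r ^ 2) : x = Real.sign x * r := by
  have : |x| = r := by rwa [← sq_eq_sq₀ (abs_nonneg x) hr, sq_abs]
  rw [← this]
  rcases lt_trichotomy x 0 with h | h | h
  · rw [Real.sign_of_neg h, abs_of_neg h]; ring
  · simp [h]
  · rw [Real.sign_of_pos h, abs_of_pos h]; ring

/-! ### The piece `C₂` -/

section C2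

variable {l : Costate}

theorem m2_mem_Ioo (hl : l ∈ C2) : m2 l ∈ Set.Ioo 0 1 := by
  obtain ⟨hα, hE⟩ := hl
  have h1 : 0 < l.α - l.E := by linarith
  exact ⟨div_pos (by linarith) h1, (div_lt_one h1).2 (by linarith)⟩

theorem ae2_pos (hl : l ∈ C2) : 0 < ae2 l :=
  Real.sqrt_pos.2 (by linarith [hl.1, hl.2])

/-- At θ = 0 the energy is c²/2 - α ≥ -α. So sgn θ is ±1 and labels the two branches. -/
theorem θ_ne_zero_of_mem_C2 (hl : l ∈ C2) : l.θ ≠ 0 := by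
  intro h
  have := hl.2
  rw [Costate.E, h, Real.cosh_zero] at this
  linarith [sq_nonneg l.c]

/-- The parameters `κ` and `g` express all the constants of `C₂` rationally. -/
theorem exists_param_C2 (hl : l ∈ C2) : ∃ g : ℝ, 0 < g ∧ g < ae2 l ∧
    l.E = -(ae2 l ^ 2 + g ^ 2) ∧ l.α = ae2 l ^ 2 - g ^ 2 ∧
    m2 l = (ae2 l ^ 2 - g ^ 2) / ae2 l ^ 2 ∧
    √(2 * (-l.α - l.E)) = 2 * g ∧ √(-l.α - l.E) * √(l.α - l.E) = 2 * ae2 l * g ∧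
    √2 * √(-l.α - l.E) = 2 * g ∧
    ∀ σ, √(-l.α - l.E) * σ / (√2 * l.α ^ 2) = g * σ / l.α ^ 2 := by
  obtain ⟨hα, hE⟩ := hl
  have h1 : 0 < (-l.α - l.E) / 2 := by linarith
  have h2 : 0 < (l.α - l.E) / 2 := by linarith
  have hκ : ae2 l ^ 2 = (l.α - l.E) / 2 := Real.sq_sqrt h2.le
  have hg : √((-l.α - l.E) / 2) ^ 2 = (-l.α - l.E) / 2 := Real.sq_sqrt h1.le
  have s2 : √2 * √2 = (2 : ℝ) := Real.mul_self_sqrt (by norm_num)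
  have s20 : 0 < √(2 : ℝ) := by positivity
  have e1 : √(-l.α - l.E) = √2 * √((-l.α - l.E) / 2) := by
    rw [← Real.sqrt_mul (by norm_num)]
    congr 1
    ring
  have e2 : √(l.α - l.E) = √2 * ae2 l := by
    rw [ae2, ← Real.sqrt_mul (by norm_num)]
    congr 1
    ring
  refine ⟨√((-l.α - l.E) / 2), Real.sqrt_pos.2 h1, Real.sqrt_lt_sqrt h1.le (by linarith),
    by linarith, by linarith, ?_, ?_, ?_, ?_, ?_⟩
  · rw [hg, hκ, m2]
    have : l.α - l.E ≠ 0 := by linarith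
    field_simp
    ring
  · rw [Real.sqrt_mul (by norm_num), e1]
    linear_combination √((-l.α - l.E) / 2) * s2
  · rw [e1, e2]
    linear_combination ae2 l * √((-l.α - l.E) / 2) * s2
  · rw [e1]
    linear_combination √((-l.α - l.E) / 2) * s2
  · intro σ
    rw [e1]
    field_simp

/-- The formula for c prescribes T = sn/cn, the tangent of the amplitude. The corresponding sine
T/√(1 + T²) always lies in (-1, 1), where sn is inverted on (-K, K), with cn = 1/√(1 + T²) positive.
-/
theorem existsUnique_chart2 (hl : l ∈ C2) : ∃! φ : ℝ, Chart2 φ l := by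
  obtain ⟨g, hg0, hgκ, hE, hα, hm, r1, r2, -, -⟩ := exists_param_C2 hl
  have hm1 := (m2_mem_Ioo hl).2
  have hκ := ae2_pos hl
  have hα0 : 0 < l.α := hl.1
  have hσ := sign_sq_eq_one (θ_ne_zero_of_mem_C2 hl)
  unfold Chart2
  rw [r1, r2]
  have hen : l.c ^ 2 / 2 - l.α * Real.cosh l.θ = -(ae2 l ^ 2 + g ^ 2) := by rw [← hE, Costate.E]
  have hcs := Real.cosh_sq l.θ
  obtain ⟨T, hT⟩ : ∃ T, T = -(Real.sign l.θ * l.c) / (2 * g) := ⟨_, rfl⟩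
  have hc : l.c = -(Real.sign l.θ * (2 * g * T)) := by
    rw [hT]
    field_simp
    rw [hσ, mul_one]
  have hn0 : 0 < 1 + T ^ 2 := by positivity
  have hn : √(1 + T ^ 2) ^ 2 = 1 + T ^ 2 := Real.sq_sqrt hn0.le
  have hnp : 0 < √(1 + T ^ 2) := Real.sqrt_pos.2 hn0
  have hs : T / √(1 + T ^ 2) ∈ Set.Ioo (-1) 1 := by
    rw [Set.mem_Ioo, ← abs_lt, abs_div, abs_of_pos hnp, div_lt_one hnp]
    exact (Real.lt_sqrt (abs_nonneg T)).2 (by rw [sq_abs]; linarith)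
  obtain ⟨u, ⟨hu, hus⟩, huniq⟩ := existsUnique_sn_eq hm1 hs
  have hcu := cn_pos hm1 hu
  have hsc := sn_sq_add_cn_sq (m := m2 l) u
  have hd0 := dn_pos hm1 u
  have hdn := dn_sq hm1 u
  have hcn2 : cn (m2 l) u ^ 2 = (1 + T ^ 2)⁻¹ := by
    rw [hus, div_pow, hn] at hsc
    field_simp at hsc ⊢
    linarith
  have hcn : cn (m2 l) u = (√(1 + T ^ 2))⁻¹ := by
    rw [← sq_eq_sq₀ hcu.le (by positivity), hcn2, inv_pow, hn]
  have hT' : T = sn (m2 l) u / cn (m2 l) u := by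
    rw [hus, hcn]
    field_simp
  have hcosh : Real.cosh l.θ = 1 - (l.α + l.E) / (l.α * cn (m2 l) u ^ 2) := by
    rw [hcn2]
    rw [hc, neg_sq, mul_pow, hσ] at hen
    field_simp
    linear_combination -hen + hE + T ^ 2 * (hα + hE)
  have hu' : ae2 l * (u / ae2 l) = u := by field_simp
  refine ⟨u / ae2 l, ⟨?_, ?_, ?_, ?_⟩, ?_⟩
  · rwa [mem_Ioo_ellK_div_iff hκ, hu']
  · rw [hu', mul_div_assoc, ← hT', hc]
  · rw [hu']
    -- The relation cosh² - sinh² = 1 fixes only the square of sinh θ; its sign is that of θ.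
    rw [show Real.sign l.θ = Real.sign (Real.sinh l.θ) from (sign_sinh _).symm]
    refine eq_sign_mul_of_sq_eq (by positivity) ?_
    have hD : ae2 l ^ 2 * dn (m2 l) u ^ 2 =
        ae2 l ^ 2 - (ae2 l ^ 2 - g ^ 2) * sn (m2 l) u ^ 2 := by
      rw [hdn]
      generalize sn (m2 l) u = s
      rw [hm]
      field_simp
    have := normSq_C2 hα hE hα0.ne' hcu.ne' (by linarith) hD
    rw [← hcosh] at this
    linarith
  · rw [hu', hcosh]
  · rintro φ ⟨hφ, e1, -, -⟩
    rw [mem_Ioo_ellK_div_iff hκ] at hφ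
    have hcp := cn_pos hm1 hφ
    have hT2 : T = sn (m2 l) (ae2 l * φ) / cn (m2 l) (ae2 l * φ) := by
      rw [hT, e1]
      field_simp
      linear_combination sn (m2 l) (ae2 l * φ) * hσ
    have hsc' := sn_sq_add_cn_sq (m := m2 l) (ae2 l * φ)
    have hr : √(1 + T ^ 2) = (cn (m2 l) (ae2 l * φ))⁻¹ := by
      rw [← sq_eq_sq₀ hnp.le (by positivity), hn, hT2]
      field_simp
      linarith
    rw [← huniq _ ⟨hφ, by rw [hr, hT2]; field_simp⟩]
    field_simp

theorem extremalGivenBy_C2 (hl : l ∈ C2) {φ₀ : ℝ} (hφ : Chart2 φ₀ l) :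
    ExtremalGivenBy C2 l (tSup2 l φ₀) (fun t m => Chart2 (φ₀ + t) m) (q2 l φ₀) := by
  obtain ⟨g, hg0, hgκ, hE, hα, hm, r1, r2, r3, r4⟩ := exists_param_C2 hl
  have hm1 := (m2_mem_Ioo hl).2
  have hκ := ae2_pos hl
  have hα0 : 0 < l.α := hl.1
  have hσ := sign_sq_eq_one (θ_ne_zero_of_mem_C2 hl)
  have hσ0 : Real.sign l.θ ≠ 0 := by rintro h; rw [h] at hσ; norm_num at hσ
  obtain ⟨hφm, h1, h2, -⟩ := hφ
  rw [r1] at h1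
  rw [r2] at h2
  set κ := ae2 l with hκdef
  set σ := Real.sign l.θ with hσdef
  set S : ℝ → ℝ := fun t => sn (m2 l) (κ * (φ₀ + t)) with hS
  set C : ℝ → ℝ := fun t => cn (m2 l) (κ * (φ₀ + t)) with hC
  set D : ℝ → ℝ := fun t => dn (m2 l) (κ * (φ₀ + t)) with hD
  set Ψ : ℝ → ℝ := fun t => jacE (m2 l) (κ * (φ₀ + t)) with hΨ
  have dS : ∀ t, HasDerivAt S (κ * (C t * D t)) t := hasDerivAt_sn_affine hm1 κ φ₀
  have dC : ∀ t, HasDerivAt C (-(κ * (S t * D t))) t := hasDerivAt_cn_affine hm1 κ φ₀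
  have dD : ∀ t, HasDerivAt D (-(κ * (m2 l * (S t * C t)))) t := hasDerivAt_dn_affine hm1 κ φ₀
  have dΨ : ∀ t, HasDerivAt Ψ (κ * D t ^ 2) t := hasDerivAt_jacE_affine hm1 κ φ₀
  have hSC : ∀ t, S t ^ 2 = 1 - C t ^ 2 := fun t => by
    linear_combination sn_sq_add_cn_sq (m := m2 l) (κ * (φ₀ + t))
  have hDS : ∀ t, κ ^ 2 * D t ^ 2 = κ ^ 2 - (κ ^ 2 - g ^ 2) * S t ^ 2 := fun t => by
    simp only [hD, hS, dn_sq hm1]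
    rw [hm]
    field_simp
  have hκm : κ ^ 2 * m2 l = κ ^ 2 - g ^ 2 := by
    rw [hm]
    field_simp
  have hDp : ∀ t, 0 < D t := fun t => dn_pos hm1 _
  have hcC : Tendsto (fun t => (C t)⁻¹) (𝓝[<] ((ellK (m2 l) - κ * φ₀) / κ)) atTop :=
    tendsto_inv_cn_escapeTime hm1 hκ hφm
  have hcS : Tendsto S (𝓝[<] ((ellK (m2 l) - κ * φ₀) / κ)) (𝓝 1) := tendsto_sn_escapeTime hm1 hκ
  have hmem : ∀ t : ℝ, 0 ≤ t → (t : EReal) < tSup2 l φ₀ →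
      κ * (φ₀ + t) ∈ Set.Ioo (-ellK (m2 l)) (ellK (m2 l)) := fun t h0 ht =>
    mul_add_mem_Ioo hκ hφm h0 (EReal.coe_lt_coe_iff.1 ht)
  have hCp : ∀ t : ℝ, 0 ≤ t → (t : EReal) < tSup2 l φ₀ → 0 < C t := fun t h0 ht =>
    cn_pos hm1 (hmem t h0 ht)
  have hτ : 0 < tSup2 l φ₀ := EReal.coe_pos.2 (escapeTime_pos hκ hφm)
  have eS0 : sn (m2 l) (κ * φ₀) = S 0 := by simp only [hS, add_zero]
  have eC0 : cn (m2 l) (κ * φ₀) = C 0 := by simp only [hC, add_zero]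
  have eD0 : dn (m2 l) (κ * φ₀) = D 0 := by simp only [hD, add_zero]
  have eΨ0 : jacE (m2 l) (κ * φ₀) = Ψ 0 := by simp only [hΨ, add_zero]
  have eS : ∀ t, sn (m2 l) (κ * (φ₀ + t)) = S t := fun t => rfl
  have eC : ∀ t, cn (m2 l) (κ * (φ₀ + t)) = C t := fun t => rfl
  have eD : ∀ t, dn (m2 l) (κ * (φ₀ + t)) = D t := fun t => rfl
  have eΨ : ∀ t, jacE (m2 l) (κ * (φ₀ + t)) = Ψ t := fun t => rfl
  rw [eS0, eC0] at h1
  rw [eC0, eD0] at h2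
  clear_value S C D Ψ
  set a : ℝ → ℝ := fun t => σ * (2 * κ * g * D t / (l.α * C t ^ 2)) with ha
  set c : ℝ → ℝ := fun t => -(σ * (2 * g * S t / C t)) with hc
  set X : ℝ → ℝ := fun t => -(2 * κ * (Ψ t - Ψ 0 + D 0 * (S 0 / C 0) - D t * (S t / C t))
    + l.E * t) / l.α with hX
  have hb : ∀ t : ℝ, C t ≠ 0 → (c t ^ 2 / 2 - l.E) / l.α =
      1 - (l.α + l.E) / (l.α * C t ^ 2) := fun t hCt => by
    rw [← energy_C2 hα hE hα0.ne' hCt (hSC t)]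
    simp only [hc]
    rw [neg_sq, mul_pow, hσ, one_mul]
  have H : IsExplicitSolution l (tSup2 l φ₀) (trajectory l.α l.E a c X) a
      (fun t => (c t ^ 2 / 2 - l.E) / l.α) c := by
    refine isExplicitSolution_trajectory hτ hα0.ne' ?_ ?_ ?_ ?_ ?_ ?_ ?_ ?_
    · simp only [ha, h2]
    · simp only [hc, h1]
    · simp [hX]
    · intro t h0 ht
      have : l.E < 0 := by rw [hE]; nlinarith
      exact div_pos (by linarith [sq_nonneg (c t)]) hα0
    · intro t h0 ht
      have hCt := (hCp t h0 ht).ne'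
      rw [hb t hCt]
      simp only [ha]
      rw [mul_pow, hσ, one_mul, normSq_C2 hα hE hα0.ne' hCt (hSC t) (hDS t)]
    · intro t h0 ht
      have hCt := (hCp t h0 ht).ne'
      refine hasDerivAt_of_eq ((((dD t).const_mul (2 * κ * g)).div
        (((dC t).pow 2).const_mul l.α) (by simp; exact ⟨hα0.ne', hCt⟩)).const_mul σ) (fun s => rfl) ?_
      rw [hb t hCt]
      simp only [hc]
      rw [deriv_a_C2 hα hE hα0.ne' hCt (hSC t) (hDS t) hκm]
      simp
    · intro t h0 ht
      have hCt := (hCp t h0 ht).ne'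
      refine hasDerivAt_of_eq (((((dS t).const_mul (2 * g)).div (dC t) hCt).const_mul σ).neg)
        (fun s => rfl) ?_
      simp only [ha]
      field_simp
      rw [hSC]
      ring
    · intro t h0 ht
      have hCt := (hCp t h0 ht).ne'
      refine hasDerivAt_of_eq (((((((dΨ t).sub_const (Ψ 0)).add_const (D 0 * (S 0 / C 0))).sub
        ((dD t).mul ((dS t).div (dC t) hCt))).const_mul (2 * κ)).add
        ((hasDerivAt_id t).const_mul l.E)).neg.div_const l.α) (fun s => rfl) ?_
      rw [hb t hCt, deriv_X_C2 hα hE hα0.ne' hCt (hSC t) (hDS t) hκm]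
      rfl
  refine H.extremalGivenBy (fun T hT => ?_) (fun t h0 ht => ?_)
    fun t μ h0 ht e1 e2 e3 e4 e5 => ?_
  · have hT' : (ellK (m2 l) - κ * φ₀) / κ = T := EReal.coe_injective hT
    rw [hT'] at hcC hcS
    simp only [hc]
    -- This is |c| = 2g|S|/C, where S → 1 and C → 0 from above.
    have hab : Tendsto (fun t => 2 * g * (|S t| * (C t)⁻¹)) (𝓝[<] T) atTop :=
      (Tendsto.pos_mul_atTop one_pos
        (by simpa using hcS.abs : Tendsto (fun t => |S t|) (𝓝[<] T) (𝓝 1)) hcC).const_mul_atTop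
        (by positivity)
    refine hab.congr' ?_
    filter_upwards [hcC.eventually_gt_atTop 0] with t ht
    have hCt : 0 < C t := inv_pos.1 ht
    have hσa : |σ| = 1 := by rwa [← sq_eq_sq₀ (abs_nonneg _) zero_le_one, sq_abs, one_pow]
    rw [abs_neg, abs_mul, hσa, abs_div, abs_mul, abs_of_pos hCt,
      abs_of_pos (by positivity : 0 < 2 * g)]
    ring
  · have hCt := (hCp t h0 ht).ne'
    have hC0 := (hCp 0 le_rfl hτ).ne'
    have g1 := hSC t
    have g2 := hSC 0
    simp only [q2, r3, r4, ← hκdef, ← hσdef, sc, eS0, eC0, eD0, eΨ0, eS, eC, eD, eΨ]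
    ext i
    fin_cases i
    · simp [trajectory, hc]
      ring
    · simp [trajectory, hX]
    · exact y_C2 (D := D t) (D₀ := D 0) (Ψ := Ψ t - Ψ 0) (t := t) hα0.ne' hCt hC0 g1 g2 rfl
    · exact z_C2 (D := D t) (D₀ := D 0) (Ψ := Ψ t - Ψ 0) (t := t) hσ hα hE hα0.ne' hCt hC0 g2 rfl
  · have hCt := hCp t h0 ht
    have em : m2 μ = m2 l := by rw [m2, m2, e4, e5]
    have eκ : ae2 μ = κ := by rw [hκdef, ae2, ae2, e4, e5]
    -- The value `a` is σ times a positive quantity, so the sign of θ persists.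
    have eσ : Real.sign μ.θ = σ := by
      rw [← sign_sinh, e1]
      exact sign_sign_mul_of_pos (by have := hDp t; positivity)
    refine ⟨⟨e4 ▸ hl.1, e4 ▸ e5 ▸ hl.2⟩, ?_, ?_, ?_, ?_⟩
    · rw [em, eκ, mem_Ioo_ellK_div_iff hκ]
      exact hmem t h0 ht
    · rw [em, eκ, eσ, e4, e5, r1, e3, eS, eC]
    · rw [em, eκ, eσ, e4, e5, r2, e1, eC, eD]
    · rw [em, eκ, e4, e5, e2, hb t hCt.ne', eC]

end C2

/-! ### The piece `C₃` -/

section C3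

variable {l : Costate}

theorem m3_lt_one (hl : l ∈ C3) : m3 l < 1 := by
  obtain ⟨hα, hE⟩ := hl
  exact (div_lt_one (by linarith)).2 (by linarith)

theorem ae3_pos (hl : l ∈ C3) : 0 < ae3 l :=
  Real.sqrt_pos.2 (by linarith [hl.2])

/-- At c = 0 the energy is -α cosh θ ≤ -α. So on `C3` it is sgn c that labels the branches. -/
theorem c_ne_zero_of_mem_C3 (hl : l ∈ C3) : l.c ≠ 0 := by
  intro h
  have := hl.2
  rw [Costate.E, h] at this
  nlinarith [Real.one_le_cosh l.θ, hl.1]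

/-- The parameters `κ` and `m = k²` express `E` and `α` rationally on `C₃`. -/
theorem param_C3 (hl : l ∈ C3) :
    l.E = ae3 l ^ 2 * (1 + m3 l) ∧ l.α = ae3 l ^ 2 * (1 - m3 l) := by
  obtain ⟨hα, hE⟩ := hl
  have h1 : 0 < (l.E + l.α) / 2 := by linarith
  have hκ : ae3 l ^ 2 = (l.E + l.α) / 2 := Real.sq_sqrt h1.le
  have h2 : l.E + l.α ≠ 0 := by linarith
  rw [hκ, m3]
  constructor <;> field_simp <;> ring

/-- The formulas for sinh θ and cosh θ force sn = -sgn(c) sinh θ / (1 + cosh θ) = -sgn(c) tanh(θ/2),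
a number in (-1, 1). Then cn² = 2/(1 + cosh θ), and energy conservation yields |c|. -/
theorem existsUnique_chart3 (hl : l ∈ C3) : ∃! φ : ℝ, Chart3 φ l := by
  obtain ⟨hE, hα⟩ := param_C3 hl
  have hm1 := m3_lt_one hl
  have hκ := ae3_pos hl
  have hσ := sign_sq_eq_one (c_ne_zero_of_mem_C3 hl)
  unfold Chart3
  have hen : l.c ^ 2 / 2 - l.α * Real.cosh l.θ = l.E := rfl
  have hcs := Real.cosh_sq l.θ
  have hch : 0 < 1 + Real.cosh l.θ := by linarith [Real.cosh_pos l.θ]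
  obtain ⟨s, hs⟩ : ∃ s, s = -(Real.sign l.c * Real.sinh l.θ) / (1 + Real.cosh l.θ) := ⟨_, rfl⟩
  have hs2 : 1 - s ^ 2 = 2 / (1 + Real.cosh l.θ) := by
    rw [hs, div_pow, neg_sq, mul_pow, hσ]
    field_simp
    linear_combination hcs
  have hsm : s ∈ Set.Ioo (-1) 1 := by
    have : 0 < 1 - s ^ 2 := by rw [hs2]; positivity
    exact ⟨by nlinarith, by nlinarith⟩
  obtain ⟨u, ⟨hu, hus⟩, huniq⟩ := existsUnique_sn_eq hm1 hsm
  have hcu := cn_pos hm1 hu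
  have hcn2 : cn (m3 l) u ^ 2 = 2 / (1 + Real.cosh l.θ) := by
    rw [← hs2, ← hus]
    linear_combination sn_sq_add_cn_sq (m := m3 l) u
  have hcosh : Real.cosh l.θ = (1 + sn (m3 l) u ^ 2) / cn (m3 l) u ^ 2 := by
    rw [hcn2, hus, show 1 + s ^ 2 = 2 - (1 - s ^ 2) by ring, hs2]
    field_simp
    ring
  have hu' : ae3 l * (u / ae3 l) = u := by field_simp
  refine ⟨u / ae3 l, ⟨?_, ?_, ?_, ?_⟩, ?_⟩
  · rwa [mem_Ioo_ellK_div_iff hκ, hu']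
  · rw [hu']
    have hd0 := dn_pos hm1 u
    refine eq_sign_mul_of_sq_eq (by positivity) ?_
    have := energy_C3 hκ.ne' (by linarith : 1 - m3 l ≠ 0) hcu.ne'
      (by linarith [sn_sq_add_cn_sq (m := m3 l) u]) (dn_sq hm1 u)
    rw [← hcosh, ← hE, ← hα, div_eq_iff hl.1.ne'] at this
    linarith
  · rw [hu', hcn2, hus, hs]
    field_simp
    rw [hσ, mul_one]
  · rw [hu', hcosh]
  · rintro φ ⟨hφ, -, e1, e2⟩
    rw [mem_Ioo_ellK_div_iff hκ] at hφ
    have hcp := cn_pos hm1 hφ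
    have hsc' := sn_sq_add_cn_sq (m := m3 l) (ae3 l * φ)
    refine (eq_div_iff hκ.ne').2 ((mul_comm _ _).trans (huniq _ ⟨hφ, ?_⟩))
    have e3 : 1 + Real.cosh l.θ = 2 / cn (m3 l) (ae3 l * φ) ^ 2 := by
      rw [e2]
      field_simp
      linarith
    rw [hs, e3, e1]
    field_simp
    rw [hσ, mul_one]

theorem extremalGivenBy_C3 (hl : l ∈ C3) {φ₀ : ℝ} (hφ : Chart3 φ₀ l) :
    ExtremalGivenBy C3 l (tSup3 l φ₀) (fun t m => Chart3 (φ₀ + t) m) (q3 l φ₀) := by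
  obtain ⟨hE, hα⟩ := param_C3 hl
  have hm1 := m3_lt_one hl
  have hn : 1 - m3 l ≠ 0 := by linarith
  have hκ := ae3_pos hl
  have hα0 : 0 < l.α := hl.1
  have hσ := sign_sq_eq_one (c_ne_zero_of_mem_C3 hl)
  obtain ⟨hφm, h1, h2, -⟩ := hφ
  set κ := ae3 l with hκdef
  obtain ⟨σ, hσdef⟩ : ∃ σ, σ = Real.sign l.c := ⟨_, rfl⟩
  rw [← hσdef] at hσ h1 h2
  set S : ℝ → ℝ := fun t => sn (m3 l) (κ * (φ₀ + t)) with hS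
  set C : ℝ → ℝ := fun t => cn (m3 l) (κ * (φ₀ + t)) with hC
  set D : ℝ → ℝ := fun t => dn (m3 l) (κ * (φ₀ + t)) with hD
  set Ψ : ℝ → ℝ := fun t => jacE (m3 l) (κ * (φ₀ + t)) with hΨ
  have dS : ∀ t, HasDerivAt S (κ * (C t * D t)) t := hasDerivAt_sn_affine hm1 κ φ₀
  have dC : ∀ t, HasDerivAt C (-(κ * (S t * D t))) t := hasDerivAt_cn_affine hm1 κ φ₀
  have dD : ∀ t, HasDerivAt D (-(κ * (m3 l * (S t * C t)))) t := hasDerivAt_dn_affine hm1 κ φ₀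
  have dΨ : ∀ t, HasDerivAt Ψ (κ * D t ^ 2) t := hasDerivAt_jacE_affine hm1 κ φ₀
  have hSC : ∀ t, S t ^ 2 = 1 - C t ^ 2 := fun t => by
    linear_combination sn_sq_add_cn_sq (m := m3 l) (κ * (φ₀ + t))
  have hDS : ∀ t, D t ^ 2 = 1 - m3 l * S t ^ 2 := fun t => dn_sq hm1 _
  have hDp : ∀ t, 0 < D t := fun t => dn_pos hm1 _
  have hcC : Tendsto (fun t => (C t)⁻¹) (𝓝[<] ((ellK (m3 l) - κ * φ₀) / κ)) atTop :=
    tendsto_inv_cn_escapeTime hm1 hκ hφm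
  have hcD : Tendsto D (𝓝[<] ((ellK (m3 l) - κ * φ₀) / κ)) (𝓝 (dn (m3 l) (ellK (m3 l)))) :=
    tendsto_dn_escapeTime hm1 hκ
  have hmem : ∀ t : ℝ, 0 ≤ t → (t : EReal) < tSup3 l φ₀ →
      κ * (φ₀ + t) ∈ Set.Ioo (-ellK (m3 l)) (ellK (m3 l)) := fun t h0 ht =>
    mul_add_mem_Ioo hκ hφm h0 (EReal.coe_lt_coe_iff.1 ht)
  have hCp : ∀ t : ℝ, 0 ≤ t → (t : EReal) < tSup3 l φ₀ → 0 < C t := fun t h0 ht =>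
    cn_pos hm1 (hmem t h0 ht)
  have hτ : 0 < tSup3 l φ₀ := EReal.coe_pos.2 (escapeTime_pos hκ hφm)
  have eS0 : sn (m3 l) (κ * φ₀) = S 0 := by simp only [hS, add_zero]
  have eC0 : cn (m3 l) (κ * φ₀) = C 0 := by simp only [hC, add_zero]
  have eD0 : dn (m3 l) (κ * φ₀) = D 0 := by simp only [hD, add_zero]
  have eΨ0 : jacE (m3 l) (κ * φ₀) = Ψ 0 := by simp only [hΨ, add_zero]
  have eS : ∀ t, sn (m3 l) (κ * (φ₀ + t)) = S t := fun t => rfl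
  have eC : ∀ t, cn (m3 l) (κ * (φ₀ + t)) = C t := fun t => rfl
  have eD : ∀ t, dn (m3 l) (κ * (φ₀ + t)) = D t := fun t => rfl
  have eΨ : ∀ t, jacE (m3 l) (κ * (φ₀ + t)) = Ψ t := fun t => rfl
  rw [eD0, eC0] at h1
  rw [eS0, eC0] at h2
  clear_value S C D Ψ
  set a : ℝ → ℝ := fun t => -(σ * (2 * S t / C t ^ 2)) with ha
  set c : ℝ → ℝ := fun t => σ * (2 * κ * D t / C t) with hc
  set X : ℝ → ℝ := fun t => 2 / (κ * (1 - m3 l)) *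
    (D t * (S t / C t) - D 0 * (S 0 / C 0) - (Ψ t - Ψ 0)) + t with hX
  have hb : ∀ t : ℝ, C t ≠ 0 → (c t ^ 2 / 2 - l.E) / l.α = (1 + S t ^ 2) / C t ^ 2 :=
    fun t hCt => by
    rw [← energy_C3 hκ.ne' hn hCt (hSC t) (hDS t), hE, hα]
    simp only [hc]
    rw [mul_pow, hσ, one_mul]
  have H : IsExplicitSolution l (tSup3 l φ₀) (trajectory l.α l.E a c X) a
      (fun t => (c t ^ 2 / 2 - l.E) / l.α) c := by
    refine isExplicitSolution_trajectory hτ hα0.ne' ?_ ?_ ?_ ?_ ?_ ?_ ?_ ?_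
    · simp only [ha, h2]
    · simp only [hc, h1]
    · simp [hX]
    · intro t h0 ht
      have hCt := hCp t h0 ht
      rw [hb t hCt.ne']
      positivity
    · intro t h0 ht
      have hCt := (hCp t h0 ht).ne'
      rw [hb t hCt]
      simp only [ha]
      rw [neg_sq, mul_pow, hσ, one_mul, normSq_C3 hCt (hSC t)]
    · intro t h0 ht
      have hCt := (hCp t h0 ht).ne'
      refine hasDerivAt_of_eq ((((dS t).const_mul 2).div ((dC t).pow 2)
        (pow_ne_zero 2 hCt)).const_mul σ).neg (fun s => rfl) ?_
      rw [hb t hCt]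
      simp only [hc]
      rw [deriv_a_C3 hCt (hSC t)]
      simp
    · intro t h0 ht
      have hCt := (hCp t h0 ht).ne'
      refine hasDerivAt_of_eq ((((dD t).const_mul (2 * κ)).div (dC t) hCt).const_mul σ)
        (fun s => rfl) ?_
      simp only [ha]
      rw [hα, deriv_c_C3 hCt (hSC t) (hDS t)]
    · intro t h0 ht
      have hCt := (hCp t h0 ht).ne'
      refine hasDerivAt_of_eq ((((((dD t).mul ((dS t).div (dC t) hCt)).sub_const
        (D 0 * (S 0 / C 0))).sub ((dΨ t).sub_const (Ψ 0))).const_mul (2 / (κ * (1 - m3 l)))).add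
        (hasDerivAt_id t)) (fun s => rfl) ?_
      rw [hb t hCt, deriv_X_C3 hκ.ne' hn hCt (hSC t) (hDS t)]
      rfl
  refine H.extremalGivenBy (fun T hT => ?_) (fun t h0 ht => ?_)
    fun t μ h0 ht e1 e2 e3 e4 e5 => ?_
  · have hT' : (ellK (m3 l) - κ * φ₀) / κ = T := EReal.coe_injective hT
    rw [hT'] at hcC hcD
    simp only [hc]
    -- This is |c| = 2κD/C; the numerator tends to 2κ dn(K), which is positive for every m < 1,
    -- negative m included.
    have hab : Tendsto (fun t => 2 * κ * (D t * (C t)⁻¹)) (𝓝[<] T) atTop :=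
      (Tendsto.pos_mul_atTop (dn_pos hm1 _) hcD hcC).const_mul_atTop
        (by positivity)
    refine hab.congr' ?_
    filter_upwards [hcC.eventually_gt_atTop 0] with t ht
    have hCt : 0 < C t := inv_pos.1 ht
    have hσa : |σ| = 1 := by rwa [← sq_eq_sq₀ (abs_nonneg _) zero_le_one, sq_abs, one_pow]
    have := hDp t
    rw [abs_mul, hσa, abs_of_pos (by positivity)]
    ring
  · have hCt := (hCp t h0 ht).ne'
    have hC0 := (hCp 0 le_rfl hτ).ne'
    have g1 := hSC t
    have g2 := hSC 0
    simp only [q3, ← hκdef, ← hσdef, sc, dc, eS0, eC0, eD0, eΨ0, eS, eC, eD, eΨ]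
    ext i
    fin_cases i
    · simp [trajectory, hc]
      rw [hα]
      field_simp
    · simp [trajectory, hX]
    · refine (y_C3 (D := D t) (D₀ := D 0) (Ψ := Ψ t - Ψ 0) (t := t) hκ.ne' hn hCt hC0 g1 g2
        (hDS t) (hDS 0) rfl).trans ?_
      rw [← hα]
      rfl
    · have := z_C3 (D := D t) (D₀ := D 0) (Ψ := Ψ t - Ψ 0) (t := t) hσ hκ.ne' hn hCt hC0 g1 g2
        (hDS t) (hDS 0) rfl
      rw [← hα, ← hE] at this
      refine (congrArg (fun w => w + X t ^ 3 / 6) this).trans ?_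
      exact add_comm _ _
  · have hCt := hCp t h0 ht
    have em : m3 μ = m3 l := by rw [m3, m3, e4, e5]
    have eκ : ae3 μ = κ := by rw [hκdef, ae3, ae3, e4, e5]
    have eσ : Real.sign μ.c = σ := by
      rw [e3]
      simp only [hc]
      rw [hσdef]
      exact sign_sign_mul_of_pos (by have := hDp t; positivity)
    refine ⟨⟨e4 ▸ hl.1, e4 ▸ e5 ▸ hl.2⟩, ?_, ?_, ?_, ?_⟩
    · rw [em, eκ, mem_Ioo_ellK_div_iff hκ]
      exact hmem t h0 ht
    · rw [em, eκ, eσ, e3, eD, eC]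
    · rw [em, eκ, eσ, e1, eS, eC]
    · rw [em, eκ, e2, hb t hCt.ne', eS, eC]

/-! The imaginary modulus transformation. -/

theorem kTilde_sq (hm : m3 l < 0) :
    kTilde l ^ 2 = -m3 l / (1 - m3 l) :=
  Real.sq_sqrt (div_nonneg (by linarith) (by linarith))

/-- The quotients on the right solve the Jacobi system of parameter `m3 l` at speed `ae3 l`, with
initial values 0, 1, 1, so uniqueness gives the identities. The constants match through r = √(1 -
k̃²), with √α r = κ and `m3 l` · r² = -k̃². -/
theorem imaginary_modulus (hl : l ∈ C3) (hm : m3 l < 0) :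
    kTilde l ∈ Set.Ioo 0 1 ∧
    kTilde l = √((l.α - l.E) / (2 * l.α)) ∧
    √(1 - kTilde l ^ 2) = √((l.α + l.E) / (2 * l.α)) ∧
    ∀ φ : ℝ,
      sn (m3 l) (ae3 l * φ) =
        √(1 - kTilde l ^ 2) * sn (kTilde l ^ 2) (√l.α * φ) / dn (kTilde l ^ 2) (√l.α * φ) ∧
      cn (m3 l) (ae3 l * φ) = cn (kTilde l ^ 2) (√l.α * φ) / dn (kTilde l ^ 2) (√l.α * φ) ∧
      dn (m3 l) (ae3 l * φ) = 1 / dn (kTilde l ^ 2) (√l.α * φ) := by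
  obtain ⟨hE, hα⟩ := param_C3 hl
  have hκ := ae3_pos hl
  have hn : 0 < 1 - m3 l := by linarith
  have hk2 := kTilde_sq hm
  have hk1 : kTilde l ^ 2 < 1 := by
    rw [hk2, div_lt_one hn]
    linarith
  have hk0 : 0 < kTilde l := Real.sqrt_pos.2 (div_pos (by linarith) hn)
  have hc2 : 1 - kTilde l ^ 2 = 1 / (1 - m3 l) := by
    rw [hk2]
    field_simp
    ring
  refine ⟨⟨hk0, by nlinarith⟩, ?_, ?_, fun φ => ?_⟩
  · rw [kTilde, hα, hE]
    congr 1
    field_simp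
    ring
  · rw [hc2, hα, hE]
    congr 1
    field_simp
    ring
  · obtain ⟨r, hr⟩ : ∃ r, r = √(1 - kTilde l ^ 2) := ⟨_, rfl⟩
    have hr2 : r ^ 2 * (1 - m3 l) = 1 := by
      rw [hr, Real.sq_sqrt (by linarith), hc2]
      field_simp
    have hr0 : 0 < r := hr ▸ Real.sqrt_pos.2 (by linarith)
    have hκr : √l.α * r = ae3 l := by
      rw [← sq_eq_sq₀ (by positivity) hκ.le, mul_pow, Real.sq_sqrt hl.1.le, hα]
      linear_combination ae3 l ^ 2 * hr2
    rw [← hr]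
    obtain ⟨m, hme⟩ : ∃ m, m = kTilde l ^ 2 := ⟨_, rfl⟩
    rw [← hme] at hk1 ⊢
    have hmr : r ^ 2 = 1 - m := by rw [hr, Real.sq_sqrt (by linarith), hme]
    have hmm : m3 l * r ^ 2 = -m := by linear_combination hmr - hr2
    have lin : ∀ t, HasDerivAt (fun t => √l.α * t) √l.α t := fun t => by
      simpa using (hasDerivAt_id t).const_mul √l.α
    have dS := fun t => (hasDerivAt_sn hk1 (√l.α * t)).comp t (lin t)
    have dC := fun t => (hasDerivAt_cn hk1 (√l.α * t)).comp t (lin t)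
    have dD := fun t => (hasDerivAt_dn hk1 (√l.α * t)).comp t (lin t)
    refine jacobi_eq_of_hasDerivAt (m3_lt_one hl) (κ := ae3 l)
      (s := fun t => r * sn m (√l.α * t) / dn m (√l.α * t))
      (c := fun t => cn m (√l.α * t) / dn m (√l.α * t)) (d := fun t => 1 / dn m (√l.α * t))
      (fun t => ?_) (fun t => ?_) (fun t => ?_) ?_ ?_ ?_ φ
    · have hd := (dn_pos hk1 (√l.α * t)).ne'
      have hdn := dn_sq hk1 (√l.α * t)
      refine hasDerivAt_of_eq (((dS t).const_mul r).div (dD t) hd) (fun _ => rfl) ?_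
      simp only [Function.comp]
      rw [← hκr]
      field_simp
      linear_combination -(√l.α * cn m (√l.α * t)) * hdn
    · have hd := (dn_pos hk1 (√l.α * t)).ne'
      have hdn := dn_sq hk1 (√l.α * t)
      have hsc := sn_sq_add_cn_sq (m := m) (√l.α * t)
      refine hasDerivAt_of_eq ((dC t).div (dD t) hd) (fun _ => rfl) ?_
      simp only [Function.comp]
      rw [← hκr]
      field_simp
      linear_combination √l.α * sn m (√l.α * t) * (-hmr + hdn - m * hsc)
    · have hd := (dn_pos hk1 (√l.α * t)).ne'
      refine hasDerivAt_of_eq ((hasDerivAt_const t (1 : ℝ)).div (dD t) hd) (fun _ => rfl) ?_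
      simp only [Function.comp]
      rw [← hκr]
      field_simp
      linear_combination -(√l.α * sn m (√l.α * t) * cn m (√l.α * t)) * hmm
    · simp [sn, am_zero hk1]
    · simp [cn, dn, am_zero hk1]
    · simp [dn, am_zero hk1]

end C3

/-! ### The piece `C₄` -/

section C4

section Algebra

variable {κ x : ℝ}

theorem normSq_C4 (hx : x ^ 2 - 1 ≠ 0) :
    ((x ^ 2 * (x ^ 2 + 6) + 1) / (x ^ 2 - 1) ^ 2) ^ 2
      - (4 * x * (x ^ 2 + 1) / (x ^ 2 - 1) ^ 2) ^ 2 = 1 := by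
  field_simp
  ring

theorem energy_C4 (hκ : κ ≠ 0) (hx : x ^ 2 - 1 ≠ 0) :
    ((4 * κ * x / (x ^ 2 - 1)) ^ 2 / 2 - -κ ^ 2) / κ ^ 2 =
      (x ^ 2 * (x ^ 2 + 6) + 1) / (x ^ 2 - 1) ^ 2 := by
  field_simp
  ring

/-- In this identity and in `z_C4`, `A` and `A₀` stay atoms while denominators are cleared and are
expanded only for the final polynomial identity. -/
theorem y_C4 {σ t e e₀ X A A₀ : ℝ} (hκ : κ ≠ 0) (he₀ : e₀ ≠ 0) (h : A ≠ 0)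
    (h₀ : A₀ ≠ 0)
    (hA : A = -1 + κ ^ 2 * e ^ 2) (hA₀ : A₀ = -1 + κ ^ 2 * e₀ ^ 2)
    (hX : X = 4 / κ * (1 / A₀ - 1 / A) + t) :
    -σ * (2 * e₀ * (-1 + κ ^ 2 * (e * e₀)) * (2 + κ * t + e / e₀ * (κ * t - 2)) /
      (κ * A₀ * A)) =
    -(σ * (4 * (κ * e) * ((κ * e) ^ 2 + 1) / A ^ 2)
      - σ * (4 * (κ * e₀) * ((κ * e₀) ^ 2 + 1) / A₀ ^ 2)
      + (σ * (4 * κ * (κ * e) / A)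
        + σ * (4 * κ * (κ * e₀) / A₀)) * X / 2) / κ ^ 2 := by
  rw [hX]
  field_simp
  rw [hA, hA₀]
  ring

theorem z_C4 {σ t e e₀ X A A₀ : ℝ} (hσ : σ ^ 2 = 1) (hκ : κ ≠ 0) (he₀ : e₀ ≠ 0)
    (h : A ≠ 0) (h₀ : A₀ ≠ 0)
    (hA : A = -1 + κ ^ 2 * e ^ 2) (hA₀ : A₀ = -1 + κ ^ 2 * e₀ ^ 2)
    (hX : X = 4 / κ * (1 / A₀ - 1 / A) + t) :
    4 / 3 * (6 * e₀ ^ 2 * t / A₀ ^ 2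
      + (-1 - 9 * κ ^ 2 * e₀ ^ 2 * (-2 + κ ^ 2 * e₀ ^ 2)) /
        (κ ^ 2 * κ * A₀ ^ 3)
      + 12 * (1 + κ ^ 2 * e₀ ^ 2 * (-1 + 2 * (e / e₀))) /
        (κ ^ 2 * κ * A₀ * A ^ 2)
      - 8 / (κ ^ 2 * κ * A ^ 3)
      - 3 * (1 + κ ^ 2 * e₀ ^ 2 * (6 + 4 * (e / e₀) - κ ^ 2 * e₀ ^ 2 * (-1 + 4 * (e / e₀)))) /
        (κ ^ 2 * κ * A₀ ^ 2 * A)) =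
    (2 / 3 * (-κ ^ 2 * X + κ ^ 2 * t
        - σ * (4 * (κ * e) * ((κ * e) ^ 2 + 1) / A ^ 2) *
          (σ * (4 * κ * (κ * e) / A))
        + σ * (4 * (κ * e₀) * ((κ * e₀) ^ 2 + 1) / A₀ ^ 2) *
          (σ * (4 * κ * (κ * e₀) / A₀)))
      + 2 * (σ * (4 * κ * (κ * e₀) / A₀)) *
        (σ * (4 * (κ * e) * ((κ * e) ^ 2 + 1) / A ^ 2)
          - σ * (4 * (κ * e₀) * ((κ * e₀) ^ 2 + 1) / A₀ ^ 2))
      + (σ * (4 * κ * (κ * e₀) / A₀)) ^ 2 * X) / (2 * (κ ^ 2) ^ 2) := by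
  have e1 : ∀ u v : ℝ, σ * u * (σ * v) = u * v := fun u v => by
    linear_combination u * v * hσ
  have e3 : ∀ u v w : ℝ, 2 * (σ * u) * (σ * v - σ * w) = 2 * u * (v - w) := fun u v w => by
    linear_combination 2 * u * (v - w) * hσ
  rw [e1, e1, e3, mul_pow σ, hσ, one_mul, hX]
  field_simp
  rw [hA, hA₀]
  ring

end Algebra

variable {l : Costate}

theorem mul_exp_two_mul {α : ℝ} (hα : 0 < α) (u : ℝ) :
    α * Real.exp (2 * u) = (√α * Real.exp u) ^ 2 := by
  rw [mul_pow, Real.sq_sqrt hα.le, ← Real.exp_nat_mul]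
  push_cast
  rfl

/-- `φ` is a coordinate if and only if the costate has the rational form below in terms of
`x = √α exp(√α φ)`. -/
theorem chart4_iff (hα : 0 < l.α) {φ : ℝ} :
    Chart4 φ l ↔ ∀ x, x = √l.α * Real.exp (√l.α * φ) → x ^ 2 ≠ 1 ∧
      l.c = Real.sign l.θ * (4 * √l.α * x / (x ^ 2 - 1)) ∧
      Real.sinh l.θ = Real.sign l.θ * (4 * x * (x ^ 2 + 1) / (x ^ 2 - 1) ^ 2) ∧
      Real.cosh l.θ = (x ^ 2 * (x ^ 2 + 6) + 1) / (x ^ 2 - 1) ^ 2 := by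
  have e1 := mul_exp_two_mul hα (√l.α * φ)
  have e2 : 4 * l.α * Real.exp (√l.α * φ) = 4 * √l.α * (√l.α * Real.exp (√l.α * φ)) := by
    nth_rewrite 1 [← Real.sq_sqrt hα.le]
    ring
  have e3 : 4 * √l.α * Real.exp (√l.α * φ) = 4 * (√l.α * Real.exp (√l.α * φ)) := by ring
  rw [forall_eq, Chart4, e1, e2, e3]

/-- With γ = σc, the formula for c is the quadratic γx² - 4kx - γ = 0. Its roots have product -1, so
exactly one is positive, and x = k exp(kφ) determines φ. -/
theorem existsUnique_chart4 (hl : l ∈ C4) : ∃! φ : ℝ, Chart4 φ l := by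
  obtain ⟨hα, hE, hc, hθ⟩ := hl
  have hσ := sign_sq_eq_one hθ
  obtain ⟨σ, hσdef⟩ : ∃ σ, σ = Real.sign l.θ := ⟨_, rfl⟩
  simp only [chart4_iff hα]
  have hkα : √l.α ^ 2 = l.α := Real.sq_sqrt hα.le
  have hk : 0 < √l.α := Real.sqrt_pos.2 hα
  rw [← hσdef] at hσ ⊢
  generalize √l.α = k at *
  have hen : l.c ^ 2 / 2 - k ^ 2 * Real.cosh l.θ = -k ^ 2 := by rw [hkα, ← hE, Costate.E]
  have hσ0 : σ ≠ 0 := by rintro rfl; norm_num at hσ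
  obtain ⟨γ, hγ⟩ : ∃ γ, γ = σ * l.c := ⟨_, rfl⟩
  have hγ0 : γ ≠ 0 := by rw [hγ]; exact mul_ne_zero hσ0 hc
  have hcγ : l.c = σ * γ := by rw [hγ, ← mul_assoc, ← sq, hσ, one_mul]
  -- The positive root is (2k ± √(4k² + γ²))/γ, with the sign of γ in place of ±.
  have hroot : ∃ x, 0 < x ∧ γ * (x ^ 2 - 1) = 4 * k * x := by
    have hp : √((2 * k) ^ 2 + γ ^ 2) ^ 2 = (2 * k) ^ 2 + γ ^ 2 := Real.sq_sqrt (by positivity)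
    have hp2 : 2 * k < √((2 * k) ^ 2 + γ ^ 2) :=
      Real.lt_sqrt_of_sq_lt (by have := sq_pos_of_ne_zero hγ0; linarith)
    generalize √((2 * k) ^ 2 + γ ^ 2) = p at hp hp2
    rcases lt_or_gt_of_ne hγ0 with h | h
    · refine ⟨(2 * k - p) / γ, div_pos_of_neg_of_neg (by linarith) h, ?_⟩
      field_simp
      linear_combination hp
    · refine ⟨(2 * k + p) / γ, div_pos (by linarith) h, ?_⟩
      field_simp
      linear_combination hp
  obtain ⟨x, hx0, hx⟩ := hroot
  have hx1 : x ^ 2 - 1 ≠ 0 := by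
    intro h
    rw [h, mul_zero] at hx
    have : 0 < 4 * k * x := by positivity
    linarith
  have hγx : γ = 4 * k * x / (x ^ 2 - 1) := by
    field_simp
    linear_combination hx
  have hxe : k * Real.exp (k * (Real.log (x / k) / k)) = x := by
    rw [mul_div_cancel₀ _ hk.ne', Real.exp_log (by positivity)]
    field_simp
  have hcosh : Real.cosh l.θ = (x ^ 2 * (x ^ 2 + 6) + 1) / (x ^ 2 - 1) ^ 2 := by
    rw [← energy_C4 hk.ne' hx1, ← hγx]
    rw [hcγ, mul_pow, hσ] at hen
    field_simp
    linear_combination -2 * hen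
  refine ⟨Real.log (x / k) / k, ?_, ?_⟩
  · rintro _ rfl
    rw [hxe]
    refine ⟨fun h => hx1 (by rw [h, sub_self]), by rw [← hγx, hcγ], ?_, hcosh⟩
    rw [hσdef, ← sign_sinh]
    refine eq_sign_mul_of_sq_eq (by positivity) ?_
    have := normSq_C4 hx1
    rw [← hcosh, Real.cosh_sq] at this
    linarith
  · intro φ hφ
    obtain ⟨h1, h2, -, -⟩ := hφ _ rfl
    have hy0 : 0 < k * Real.exp (k * φ) := by positivity
    have hyφ : φ = Real.log (k * Real.exp (k * φ) / k) / k := by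
      rw [mul_div_cancel_left₀ _ hk.ne', Real.log_exp, mul_div_cancel_left₀ _ hk.ne']
    rw [hyφ]
    congr 3
    generalize k * Real.exp (k * φ) = y at *
    have hy1 : y ^ 2 - 1 ≠ 0 := sub_ne_zero.2 h1
    have hy : γ = 4 * k * y / (y ^ 2 - 1) := by
      rw [hcγ] at h2
      exact mul_left_cancel₀ hσ0 h2
    rw [eq_div_iff hy1] at hy
    -- Eliminating k between the two quadratics leaves the factor xy + 1, nonzero for positive x and
    -- y.
    have key : γ * ((y - x) * (x * y + 1)) = 0 := by linear_combination x * hy - y * hx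
    have hxy : x * y + 1 ≠ 0 := by positivity
    have := (mul_eq_zero.1 ((mul_eq_zero.1 key).resolve_left hγ0)).resolve_right hxy
    linarith

/-- All formulas are rational in x = √α exp(√α(φ₀ + t)), with a pole at x = 1. Leaving τ general
lets one argument serve both cases: x never reaches 1 and τ = ⊤, or x = 1 at the finite time τ. -/
theorem extremalGivenBy_C4 (hl : l ∈ C4) {φ₀ : ℝ} (hφ : Chart4 φ₀ l) {τ : EReal} (hτ : 0 < τ)
    (hne : ∀ t : ℝ, 0 ≤ t → (t : EReal) < τ → √l.α * Real.exp (√l.α * (φ₀ + t)) ≠ 1)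
    (hblow : ∀ T : ℝ, τ = T → √l.α * Real.exp (√l.α * (φ₀ + T)) = 1) :
    ExtremalGivenBy C4 l τ (fun t m => Chart4 (φ₀ + t) m) (q4 l φ₀) := by
  obtain ⟨hα, hE, hc0, hθ⟩ := id hl
  have hσ := sign_sq_eq_one hθ
  rw [chart4_iff hα] at hφ
  obtain ⟨-, h1, h2, -⟩ := hφ _ rfl
  have hkα : √l.α ^ 2 = l.α := Real.sq_sqrt hα.le
  have hk : 0 < √l.α := Real.sqrt_pos.2 hα
  obtain ⟨σ, hσdef⟩ : ∃ σ, σ = Real.sign l.θ := ⟨_, rfl⟩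
  rw [← hσdef] at hσ h1 h2
  obtain ⟨k, hkdef⟩ : ∃ k, k = √l.α := ⟨_, rfl⟩
  rw [← hkdef] at hkα hk hne hblow h1 h2
  have hE' : l.E = -k ^ 2 := by rw [hE, hkα]
  have hσ0 : σ ≠ 0 := by rintro rfl; norm_num at hσ
  set e : ℝ → ℝ := fun t => Real.exp (k * (φ₀ + t)) with he
  set x : ℝ → ℝ := fun t => k * e t with hx
  have he0 : Real.exp (k * φ₀) = e 0 := by simp only [he, add_zero]
  have he' : ∀ t, Real.exp (k * (φ₀ + t)) = e t := fun t => rfl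
  have hep : ∀ t, 0 < e t := fun t => Real.exp_pos _
  have hr : ∀ t, Real.exp (k * (φ₀ + t) - k * φ₀) = e t / e 0 := fun t => by
    rw [Real.exp_sub, he0]
  have hxp : ∀ t, 0 < x t := fun t => mul_pos hk (hep t)
  have dx : ∀ t, HasDerivAt x (k * x t) t := fun t =>
    hasDerivAt_of_eq ((((hasDerivAt_id t).const_add φ₀).const_mul k).exp.const_mul k)
      (fun s => rfl) (by simp only [hx, he, id]; ring)
  have hx1 : ∀ t : ℝ, 0 ≤ t → (t : EReal) < τ → x t ^ 2 - 1 ≠ 0 := fun t h0 ht h => by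
    have : x t = 1 := by
      rw [← pow_left_inj₀ (hxp t).le zero_le_one two_ne_zero, one_pow]
      linarith
    exact hne t h0 ht this
  have hxT : ∀ T : ℝ, τ = T → x T = 1 := hblow
  rw [he0] at h1 h2
  have hxe : ∀ t, k * e t = x t := fun t => rfl
  clear_value e x
  set a : ℝ → ℝ := fun t => σ * (4 * x t * (x t ^ 2 + 1) / (x t ^ 2 - 1) ^ 2) with ha
  set c : ℝ → ℝ := fun t => σ * (4 * k * x t / (x t ^ 2 - 1)) with hc
  set X : ℝ → ℝ := fun t => 4 / k * (1 / (x 0 ^ 2 - 1) - 1 / (x t ^ 2 - 1)) + t with hX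
  have hb : ∀ t : ℝ, x t ^ 2 - 1 ≠ 0 → (c t ^ 2 / 2 - l.E) / l.α =
      (x t ^ 2 * (x t ^ 2 + 6) + 1) / (x t ^ 2 - 1) ^ 2 := fun t ht => by
    rw [← energy_C4 hk.ne' ht, hE', ← hkα]
    simp only [hc]
    rw [mul_pow, hσ, one_mul]
  have H : IsExplicitSolution l τ (trajectory l.α l.E a c X) a
      (fun t => (c t ^ 2 / 2 - l.E) / l.α) c := by
    refine isExplicitSolution_trajectory hτ hα.ne' ?_ ?_ ?_ ?_ ?_ ?_ ?_ ?_
    · simp only [ha, hx, h2]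
    · simp only [hc, hx, h1]
    · simp [hX]
    · intro t h0 ht
      have hxt := hx1 t h0 ht
      rw [hb t hxt]
      positivity
    · intro t h0 ht
      have hxt := hx1 t h0 ht
      rw [hb t hxt]
      simp only [ha]
      rw [mul_pow σ, hσ, one_mul, normSq_C4 hxt]
    · intro t h0 ht
      have hxt := hx1 t h0 ht
      refine hasDerivAt_of_eq (((((dx t).const_mul 4).mul (((dx t).pow 2).add_const 1)).div
        ((((dx t).pow 2).sub_const 1).pow 2) (pow_ne_zero 2 hxt)).const_mul σ) (fun s => rfl) ?_
      rw [hb t hxt]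
      simp only [hc, Pi.pow_apply, Pi.mul_apply]
      push_cast
      generalize x t = y at *
      field_simp
      ring
    · intro t h0 ht
      have hxt := hx1 t h0 ht
      refine hasDerivAt_of_eq ((((dx t).const_mul (4 * k)).div
        (((dx t).pow 2).sub_const 1) hxt).const_mul σ) (fun s => rfl) ?_
      simp only [ha, Pi.pow_apply]
      rw [← hkα]
      push_cast
      generalize x t = y at *
      field_simp
      ring
    · intro t h0 ht
      have hxt := hx1 t h0 ht
      refine hasDerivAt_of_eq (((((hasDerivAt_const t (1 : ℝ)).div
        (((dx t).pow 2).sub_const 1) hxt).const_sub (1 / (x 0 ^ 2 - 1))).const_mul (4 / k)).add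
        (hasDerivAt_id t)) (fun s => rfl) ?_
      rw [hb t hxt]
      simp only [Pi.pow_apply]
      push_cast
      generalize x t = y at *
      field_simp
      ring
  refine H.extremalGivenBy (fun T hT => ?_) (fun t h0 ht => ?_)
    fun t μ h0 ht e1 e2 e3 e4 e5 => ?_
  · have hT0 : 0 < T := by
      rw [hT] at hτ
      exact_mod_cast hτ
    have hσa : |σ| = 1 := by rwa [← sq_eq_sq₀ (abs_nonneg _) zero_le_one, sq_abs, one_pow]
    have hxc : Tendsto x (𝓝[<] T) (𝓝 1) := by
      have := (dx T).continuousAt.tendsto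
      rw [hxT T hT] at this
      exact this.mono_left nhdsWithin_le_nhds
    have h2 : Tendsto (fun t => |x t ^ 2 - 1|) (𝓝[<] T) (𝓝[>] 0) := by
      refine tendsto_nhdsWithin_iff.2 ⟨by simpa using ((hxc.pow 2).sub_const 1).abs, ?_⟩
      filter_upwards [Ioo_mem_nhdsLT hT0] with t ht
      exact abs_pos.2 (hx1 t ht.1.le (by rw [hT]; exact_mod_cast ht.2))
    have h3 : Tendsto (fun t => 4 * k * (x t * |x t ^ 2 - 1|⁻¹)) (𝓝[<] T) atTop :=
      (Tendsto.pos_mul_atTop one_pos hxc h2.inv_tendsto_nhdsGT_zero).const_mul_atTop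
        (by positivity)
    refine h3.congr fun t => ?_
    simp only [hc]
    have hpos : 0 < 4 * k * x t := by
      have := hxp t
      positivity
    rw [abs_mul, hσa, abs_div, abs_of_pos hpos]
    ring
  · have hA : ∀ s, -1 + k ^ 2 * e s ^ 2 = x s ^ 2 - 1 := fun s => by simp only [hx]; ring
    have hx0 := hx1 0 le_rfl hτ
    have hxt := hx1 t h0 ht
    simp only [q4, ← hσdef, ← hkdef, he0, he', hr]
    simp only [← hkα, hA]
    ext i
    fin_cases i
    · simp [trajectory, hc]
      simp only [hx] at hxt hx0 ⊢
      field_simp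
    · simp [trajectory, hX]
    · refine (y_C4 (X := X t) hk.ne' (hep 0).ne' hxt hx0 (hA t).symm (hA 0).symm rfl).trans ?_
      simp only [hxe]
      rfl
    · have := z_C4 (X := X t) hσ hk.ne' (hep 0).ne' hxt hx0 (hA t).symm (hA 0).symm rfl
      refine (congrArg (fun w => X t ^ 3 / 6 + w) this).trans ?_
      rw [← hE']
      simp only [hxe]
      rfl
  · have hxt := hx1 t h0 ht
    have hat : 0 < 4 * x t * (x t ^ 2 + 1) / (x t ^ 2 - 1) ^ 2 := by
      have := hxp t
      positivity
    have eσ : Real.sign μ.θ = σ := by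
      rw [← sign_sinh, e1]
      simp only [ha]
      rw [hσdef]
      exact sign_sign_mul_of_pos hat
    refine ⟨⟨e4 ▸ hα, by rw [e4, e5, hE], ?_, ?_⟩, ?_⟩
    · rw [e3]
      have := hxp t
      exact mul_ne_zero hσ0 (div_ne_zero (by positivity) hxt)
    · intro h
      rw [h, Real.sign_zero] at eσ
      exact hσ0 eσ.symm
    · rw [chart4_iff (e4 ▸ hα), e4, ← hkdef, eσ, he']
      rintro _ rfl
      rw [hxe]
      exact ⟨fun h => hxt (by rw [h, sub_self]), e3, e1, e2.trans (hb t hxt)⟩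

/-- Taking logarithms, `t0` is the only time at which x = 1, so its sign tells whether the pole lies
in the past or in the future. It is not 0 because the chart excludes x = 1. -/
theorem extremal_C4 (hl : l ∈ C4) {φ₀ : ℝ} (hφ : Chart4 φ₀ l) :
    t0 l φ₀ ≠ 0 ∧
    (t0 l φ₀ < 0 → ExtremalGivenBy C4 l ⊤ (fun t m => Chart4 (φ₀ + t) m) (q4 l φ₀)) ∧
    (0 < t0 l φ₀ → ExtremalGivenBy C4 l ((t0 l φ₀ : ℝ) : EReal)
      (fun t m => Chart4 (φ₀ + t) m) (q4 l φ₀)) := by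
  have hα : 0 < l.α := hl.1
  have hk : 0 < √l.α := Real.sqrt_pos.2 hα
  have key : ∀ t, √l.α * Real.exp (√l.α * (φ₀ + t)) = 1 ↔ t = t0 l φ₀ := fun t => by
    rw [t0, ← Real.exp_log hk, ← Real.exp_add, Real.exp_eq_one_iff, Real.exp_log hk,
      Real.log_sqrt hα.le]
    constructor
    · intro h
      field_simp
      linarith
    · rintro rfl
      field_simp
      ring
  have hne : t0 l φ₀ ≠ 0 := fun h => by
    have h0 := (key 0).2 h.symm
    rw [add_zero] at h0
    exact hφ.1 (by rw [mul_exp_two_mul hα, h0, one_pow])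
  refine ⟨hne, fun hneg => ?_, fun hpos => ?_⟩
  · exact extremalGivenBy_C4 hl hφ (by simp) (fun t h0 _ h => by linarith [(key t).1 h])
      fun T hT => by simp at hT
  · refine extremalGivenBy_C4 hl hφ (by exact_mod_cast hpos) (fun t _ ht h => ?_) fun T hT => ?_
    · exact absurd ((key t).1 h) (by exact_mod_cast ht.ne)
    · rw [key]
      exact_mod_cast hT.symm

end C4

/-! ### The pieces `C₅`, `C₆`, `C₇` -/

variable {l : Costate}

theorem extremalGivenBy_C5 (hl : l ∈ C5) :
    ExtremalGivenBy C5 l ⊤ (fun _ m => m.θ = 0 ∧ m.c = 0) q5 := by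
  obtain ⟨hα, hE, hc, hθ⟩ := id hl
  have hb : (0 ^ 2 / 2 - l.E) / l.α = 1 := by
    rw [hE]
    field_simp
    ring
  have H : IsExplicitSolution l ⊤ (trajectory l.α l.E (fun _ => 0) (fun _ => 0) id)
      (fun _ => 0) (fun _ => (0 ^ 2 / 2 - l.E) / l.α) (fun _ => 0) := by
    refine isExplicitSolution_trajectory (by simp) hα ?_ ?_ rfl ?_ ?_ ?_ ?_ ?_
    · simp [hθ]
    · simp [hc]
    · intro t _ _
      rw [hb]
      exact one_pos
    · intro t _ _
      rw [hb]
      norm_num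
    · intro t _ _
      simpa using hasDerivAt_const t (0 : ℝ)
    · intro t _ _
      simpa using hasDerivAt_const t (0 : ℝ)
    · intro t _ _
      rw [hb]
      exact hasDerivAt_id t
  refine H.extremalGivenBy (fun T hT => by simp at hT) (fun t _ _ => ?_)
    fun t μ _ _ e1 _ e3 e4 e5 => ?_
  · ext i
    fin_cases i <;> simp [q5, trajectory, hE]
  · have hμ : μ.θ = 0 := by rwa [← Real.sinh_eq_zero]
    exact ⟨⟨e4 ▸ hα, by rw [e4, e5, hE], e3, hμ⟩, hμ, e3⟩

/-- Hyperbolic functions of integer combinations become Laurent polynomials in two exponentials. In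
`z_deriv_C6` this turns the identity into a rational one in exp(u/2) and exp θ. -/
theorem cosh_eq_of_exp {u θ : ℝ} (n k : ℕ) :
    Real.cosh (n * u - k * θ) = (Real.exp u ^ n * (Real.exp θ)⁻¹ ^ k
      + (Real.exp u)⁻¹ ^ n * Real.exp θ ^ k) / 2 ∧
    Real.sinh (n * u - k * θ) = (Real.exp u ^ n * (Real.exp θ)⁻¹ ^ k
      - (Real.exp u)⁻¹ ^ n * Real.exp θ ^ k) / 2 := by
  rw [Real.cosh_eq, Real.sinh_eq]
  simp only [← Real.exp_neg, ← Real.exp_nat_mul, ← Real.exp_add]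
  have e : -(n * u - k * θ) = n * -u + k * θ := by ring
  rw [e, sub_eq_add_neg, ← mul_neg]
  exact ⟨rfl, rfl⟩

theorem y_deriv_C6 (u θ : ℝ) :
    1 - Real.cosh u = -Real.sinh (u - θ) * (Real.sinh (u - θ) + Real.sinh θ) +
      Real.cosh (u - θ) * (Real.cosh (u - θ) - Real.cosh θ) := by
  have h1 := Real.cosh_add (u - θ) θ
  rw [sub_add_cancel] at h1
  rw [h1]
  linear_combination -Real.cosh_sq (u - θ)

theorem z_deriv_C6 (u θ : ℝ) :
    4 * Real.sinh (3 * u / 2 - 3 * θ) * Real.sinh (u / 2) ^ 3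
      + 4 * Real.cosh (3 * u / 2 - 3 * θ) * Real.sinh (u / 2) ^ 2 * Real.cosh (u / 2)
      - 2 * Real.cosh θ * (1 - Real.cosh u) =
    2 * (Real.cosh (u - θ) * ((Real.cosh (u - θ) - Real.cosh θ) ^ 2
      + (Real.sinh (u - θ) + Real.sinh θ) ^ 2)) := by
  have e1 := cosh_eq_of_exp (u := u / 2) (θ := θ) 3 3
  have e2 := cosh_eq_of_exp (u := u / 2) (θ := θ) 1 0
  have e3 := cosh_eq_of_exp (u := u / 2) (θ := θ) 2 0
  have e4 := cosh_eq_of_exp (u := u / 2) (θ := θ) 2 1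
  rw [show ((3 : ℕ) : ℝ) * (u / 2) - (3 : ℕ) * θ = 3 * u / 2 - 3 * θ by push_cast; ring] at e1
  rw [show ((1 : ℕ) : ℝ) * (u / 2) - (0 : ℕ) * θ = u / 2 by push_cast; ring] at e2
  rw [show ((2 : ℕ) : ℝ) * (u / 2) - (0 : ℕ) * θ = u by push_cast; ring] at e3
  rw [show ((2 : ℕ) : ℝ) * (u / 2) - (1 : ℕ) * θ = u - θ by push_cast; ring] at e4
  rw [e1.1, e1.2, e2.1, e2.2, e3.1, e4.1, e4.2, Real.cosh_eq θ, Real.sinh_eq θ, Real.exp_neg]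
  have hp := (Real.exp_pos (u / 2)).ne'
  have hq := (Real.exp_pos θ).ne'
  generalize Real.exp (u / 2) = p at *
  generalize Real.exp θ = q at *
  field_simp
  ring

/-- For α = 0 the form `trajectory`, which divides by α, does not apply. Instead c is constant and θ
is affine in t, so the coordinates are differentiated directly. -/
theorem extremalGivenBy_C6 (hl : l ∈ C6) :
    ExtremalGivenBy C6 l ⊤ (fun t m => m.c = l.c ∧ m.θ = l.θ - l.c * t) (q6 l) := by
  obtain ⟨hα, hE, hc⟩ := id hl
  have lin : ∀ t, HasDerivAt (fun t => l.c * t) l.c t := fun t => by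
    simpa using (hasDerivAt_id t).const_mul l.c
  have dlin : ∀ t, HasDerivAt (fun t => l.c * t - l.θ) l.c t := fun t => (lin t).sub_const l.θ
  have H : IsExplicitSolution l ⊤ (q6 l) (fun t => -Real.sinh (l.c * t - l.θ))
      (fun t => Real.cosh (l.c * t - l.θ)) (fun _ => l.c) := {
    pos := by simp
    q_zero := by
      ext i
      fin_cases i <;> simp [q6]
    a_zero := by simp
    b_zero := by simp
    c_zero := rfl
    b_pos := fun t _ _ => Real.cosh_pos _
    sq_sub_sq := fun t _ _ => by linarith [Real.cosh_sq (l.c * t - l.θ)]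
    energy := fun t _ _ => by simp [Costate.E, hα]
    deriv_a := fun t _ _ => (dlin t).sinh.neg
    deriv_b := fun t _ _ => hasDerivAt_of_eq (dlin t).cosh (fun _ => rfl) (by ring)
    deriv_c := fun t _ _ => by simpa [hα] using hasDerivAt_const t l.c
    deriv_q0 := fun t _ _ => by
      refine hasDerivAt_of_eq (((dlin t).cosh.sub_const (Real.cosh l.θ)).div_const l.c)
        (fun _ => rfl) ?_
      field_simp
    deriv_q1 := fun t _ _ => by
      refine hasDerivAt_of_eq (((dlin t).sinh.add_const (Real.sinh l.θ)).div_const l.c)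
        (fun _ => rfl) ?_
      field_simp
    deriv_q2 := fun t _ _ => by
      refine hasDerivAt_of_eq (((lin t).sub (lin t).sinh).div_const (2 * l.c ^ 2))
        (fun _ => rfl) ?_
      simp [q6]
      have := y_deriv_C6 (l.c * t) l.θ
      field_simp
      linear_combination -this
    deriv_q3 := fun t _ _ => by
      refine hasDerivAt_of_eq (((((((((lin t).const_mul 3).div_const 2).sub_const
        (3 * l.θ)).cosh.const_mul 4).mul (((lin t).div_const 2).sinh.pow 3)).sub
        (((lin t).sub (lin t).sinh).const_mul (3 * Real.cosh l.θ)))).div_const (6 * l.c ^ 3))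
        (fun _ => rfl) ?_
      simp [q6]
      have := z_deriv_C6 (l.c * t) l.θ
      generalize Real.sinh (3 * (l.c * t) / 2 - 3 * l.θ) = w1 at *
      generalize Real.cosh (3 * (l.c * t) / 2 - 3 * l.θ) = w2 at *
      generalize Real.sinh (l.c * t / 2) = w3 at *
      generalize Real.cosh (l.c * t / 2) = w4 at *
      generalize Real.cosh (l.c * t - l.θ) = w5 at *
      generalize Real.sinh (l.c * t - l.θ) = w6 at *
      generalize Real.cosh (l.c * t) = w7 at *
      field_simp
      linear_combination -3 * this }
  refine H.extremalGivenBy (fun T hT => by simp at hT) (fun t _ _ => rfl)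
    fun t μ _ _ e1 _ e3 e4 e5 => ?_
  refine ⟨⟨e4.trans hα, e5 ▸ hE, e3 ▸ hc⟩, e3, ?_⟩
  rw [← Real.sinh_neg] at e1
  rw [Real.sinh_injective e1]
  ring

theorem extremalGivenBy_C7 (hl : l ∈ C7) :
    ExtremalGivenBy C7 l ⊤ (fun _ m => m.c = 0 ∧ m.θ = l.θ) (q7 l) := by
  obtain ⟨hα, hE, hc⟩ := id hl
  have lin : ∀ r t : ℝ, HasDerivAt (fun t => r * t) r t := fun r t => by
    simpa using (hasDerivAt_id t).const_mul r
  have H : IsExplicitSolution l ⊤ (q7 l) (fun _ => Real.sinh l.θ)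
      (fun _ => Real.cosh l.θ) (fun _ => 0) := {
    pos := by simp
    q_zero := by
      ext i
      fin_cases i <;> simp [q7]
    a_zero := rfl
    b_zero := rfl
    c_zero := hc.symm
    b_pos := fun t _ _ => Real.cosh_pos _
    sq_sub_sq := fun t _ _ => by linarith [Real.cosh_sq l.θ]
    energy := fun t _ _ => by simp [hE, hα]
    deriv_a := fun t _ _ => by simpa using hasDerivAt_const t (Real.sinh l.θ)
    deriv_b := fun t _ _ => by simpa using hasDerivAt_const t (Real.cosh l.θ)
    deriv_c := fun t _ _ => by simpa [hα] using hasDerivAt_const t (0 : ℝ)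
    deriv_q0 := fun t _ _ => lin _ t
    deriv_q1 := fun t _ _ => lin _ t
    deriv_q2 := fun t _ _ => by
      refine hasDerivAt_of_eq (hasDerivAt_const t (0 : ℝ)) (fun _ => rfl) ?_
      simp [q7]
      ring
    deriv_q3 := fun t _ _ => by
      refine hasDerivAt_of_eq (((hasDerivAt_id t).pow 3).const_mul
        (Real.cosh l.θ * (1 + 2 * Real.sinh l.θ ^ 2) / 6)) (fun _ => rfl) ?_
      simp [q7]
      -- Here x₁² + x₂² = (sinh² θ + cosh² θ) t², which cosh² θ = 1 + sinh² θ turns into (1 + 2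
      -- sinh² θ) t².
      have := Real.cosh_sq l.θ
      linear_combination Real.cosh l.θ * t ^ 2 / 2 * this }
  refine H.extremalGivenBy (fun T hT => by simp at hT) (fun t _ _ => rfl)
    fun t μ _ _ e1 _ e3 e4 e5 => ?_
  exact ⟨⟨e4.trans hα, e5.trans hE, e3⟩, e3, Real.sinh_injective e1⟩

end EngelSL

/-! ### The theorem assembled -/

theorem mainTheorem4 :
    -- the costate space in the coordinates (θ, c, α), and its decomposition
    (∀ ξ : EngelSL.R4, (EngelSL.ham 0 ξ = 1 / 2 ∧ 0 < EngelSL.h 1 0 ξ) ↔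
      ∃! l : EngelSL.Costate, ∀ i, EngelSL.h i 0 ξ = l.hVec i) ∧
    ((⋃ i, EngelSL.pieces i) = Set.univ ∧
      ∀ i j, i ≠ j → Disjoint (EngelSL.pieces i) (EngelSL.pieces j)) ∧
    -- the reflection exchanging the extremals with h₂ > 0 and those with h₂ < 0
    (∀ (J : Set ℝ) (q ξ : ℝ → EngelSL.R4), EngelSL.IsNormalExtremal J q ξ →
      EngelSL.IsNormalExtremal J (fun t => EngelSL.reflect (q t))
        (fun t => EngelSL.reflect (ξ t)) ∧
      ∀ t ∈ J, ∀ i, EngelSL.h i (EngelSL.reflect (q t)) (EngelSL.reflect (ξ t)) =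
        EngelSL.reflect (fun j => EngelSL.h j (q t) (ξ t)) i) ∧
    -- C₁
    (∀ l ∈ EngelSL.C1,
      EngelSL.m1 l ∈ Set.Ioo 0 1 ∧
      (∃! φ : ℝ, φ ∈ Set.Ico 0 (4 * EngelSL.ellK (EngelSL.m1 l) / EngelSL.ae1 l) ∧
        EngelSL.Chart1 φ l) ∧
      ∀ φ₀, EngelSL.Chart1 φ₀ l →
        EngelSL.ExtremalGivenBy EngelSL.C1 l ⊤
          (fun t m => EngelSL.Chart1 (φ₀ + t) m) (EngelSL.q1 l φ₀)) ∧
    -- C₂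
    (∀ l ∈ EngelSL.C2,
      EngelSL.m2 l ∈ Set.Ioo 0 1 ∧
      (∃! φ : ℝ, EngelSL.Chart2 φ l) ∧
      ∀ φ₀, EngelSL.Chart2 φ₀ l →
        EngelSL.ExtremalGivenBy EngelSL.C2 l (EngelSL.tSup2 l φ₀)
          (fun t m => EngelSL.Chart2 (φ₀ + t) m) (EngelSL.q2 l φ₀)) ∧
    -- C₃
    (∀ l ∈ EngelSL.C3,
      EngelSL.m3 l < 1 ∧
      (∃! φ : ℝ, EngelSL.Chart3 φ l) ∧
      (∀ φ₀, EngelSL.Chart3 φ₀ l →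
        EngelSL.ExtremalGivenBy EngelSL.C3 l (EngelSL.tSup3 l φ₀)
          (fun t m => EngelSL.Chart3 (φ₀ + t) m) (EngelSL.q3 l φ₀)) ∧
      -- the case of an imaginary modulus, in terms of a real one
      (EngelSL.m3 l < 0 →
        EngelSL.kTilde l ∈ Set.Ioo 0 1 ∧
        EngelSL.kTilde l = √((l.α - l.E) / (2 * l.α)) ∧
        √(1 - EngelSL.kTilde l ^ 2) = √((l.α + l.E) / (2 * l.α)) ∧
        ∀ φ : ℝ,
          EngelSL.sn (EngelSL.m3 l) (EngelSL.ae3 l * φ) =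
            √(1 - EngelSL.kTilde l ^ 2) * EngelSL.sn (EngelSL.kTilde l ^ 2) (√l.α * φ) /
              EngelSL.dn (EngelSL.kTilde l ^ 2) (√l.α * φ) ∧
          EngelSL.cn (EngelSL.m3 l) (EngelSL.ae3 l * φ) =
            EngelSL.cn (EngelSL.kTilde l ^ 2) (√l.α * φ) /
              EngelSL.dn (EngelSL.kTilde l ^ 2) (√l.α * φ) ∧
          EngelSL.dn (EngelSL.m3 l) (EngelSL.ae3 l * φ) =
            1 / EngelSL.dn (EngelSL.kTilde l ^ 2) (√l.α * φ))) ∧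
    -- C₄
    (∀ l ∈ EngelSL.C4,
      (∃! φ : ℝ, EngelSL.Chart4 φ l) ∧
      ∀ φ₀, EngelSL.Chart4 φ₀ l →
        EngelSL.t0 l φ₀ ≠ 0 ∧
        (EngelSL.t0 l φ₀ < 0 →
          EngelSL.ExtremalGivenBy EngelSL.C4 l ⊤
            (fun t m => EngelSL.Chart4 (φ₀ + t) m) (EngelSL.q4 l φ₀)) ∧
        (0 < EngelSL.t0 l φ₀ →
          EngelSL.ExtremalGivenBy EngelSL.C4 l ((EngelSL.t0 l φ₀ : ℝ) : EReal)
            (fun t m => EngelSL.Chart4 (φ₀ + t) m) (EngelSL.q4 l φ₀))) ∧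
    -- C₅
    (∀ l ∈ EngelSL.C5,
      EngelSL.ExtremalGivenBy EngelSL.C5 l ⊤
        (fun _ m => m.θ = 0 ∧ m.c = 0) EngelSL.q5) ∧
    -- C₆
    (∀ l ∈ EngelSL.C6,
      EngelSL.ExtremalGivenBy EngelSL.C6 l ⊤
        (fun t m => m.c = l.c ∧ m.θ = l.θ - l.c * t) (EngelSL.q6 l)) ∧
    -- C₇
    (∀ l ∈ EngelSL.C7,
      EngelSL.ExtremalGivenBy EngelSL.C7 l ⊤
        (fun _ m => m.c = 0 ∧ m.θ = l.θ) (EngelSL.q7 l)) := by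
  exact ⟨EngelSL.spacelike_iff_existsUnique_costate,
    ⟨EngelSL.iUnion_pieces, EngelSL.disjoint_pieces⟩,
    fun J q ξ hq => ⟨hq.reflect, fun t _ i => EngelSL.h_reflect (q t) (ξ t) i⟩,
    fun l hl => ⟨EngelSL.m1_mem_Ioo hl, EngelSL.existsUnique_chart1 hl,
      fun _ hφ => EngelSL.extremalGivenBy_C1 hl hφ⟩,
    fun l hl => ⟨EngelSL.m2_mem_Ioo hl, EngelSL.existsUnique_chart2 hl,
      fun _ hφ => EngelSL.extremalGivenBy_C2 hl hφ⟩,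
    fun l hl => ⟨EngelSL.m3_lt_one hl, EngelSL.existsUnique_chart3 hl,
      fun _ hφ => EngelSL.extremalGivenBy_C3 hl hφ, EngelSL.imaginary_modulus hl⟩,
    fun l hl => ⟨EngelSL.existsUnique_chart4 hl, fun _ hφ => EngelSL.extremal_C4 hl hφ⟩,
    fun l hl => EngelSL.extremalGivenBy_C5 hl,
    fun l hl => EngelSL.extremalGivenBy_C6 hl,
    fun l hl => EngelSL.extremalGivenBy_C7 hl⟩
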